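/- **Setting.** A \emph{descent category} is a category $\mathcal V$ with finite limits together with a subcategory of \emph{covers} (containing all identities) such that pullbacks of covers are covers and such that if $f$ and $gf$ are covers then $g$ is a cover. A \emph{simplicial space} is a simplicial object of $\mathcal V$. For a simplicial set $T$ and a simplicial space $X$, $\mathrm{Map}(T,X)$ is the object of $\mathcal V$ (when it exists) representing simplicial maps $T\to \mathrm{Hom}(-,X_\bullet)$; thus $\mathrm{Map}(\Delta^n,X)=X_n$. For a map $S\to T$ of simplicial sets and $f:X\to Y$ put $\mathrm{Map}(S\to T,f)=\mathrm{Map}(S,X)\times_{\mathrm{Map}(S,Y)}\mathrm{Map}(T,Y)$. Let $\mathbf\Delta^1$ (the thick $1$-simplex) be the nerve of the groupoid with objects $0,1$ and exactly one morphism between any two objects, let $\mathbf\Lambda^1_0=\{0\}\subset\mathbf\Delta^1$, and let $\star$ be the join of simplicial sets. Let $k>0$. A simplicial space $X$ is a \emph{$k$-category} if for all $0<i<n$ the morphism $X_n\to\mathrm{Map}(\Lambda^n_i,X)$ is a cover, and an isomorphism when $n>k$, and if the two morphisms $\mathrm{Map}(\mathbf\Delta^1,X)\to X_0$ induced by the vertices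 of $\mathbf\Delta^1$ are covers. A morphism $f:X\to Y$ of simplicial spaces is a \emph{hypercover} if $X_n\to\mathrm{Map}(\partial\Delta^n\to\Delta^n,f)$ is a cover for all $n\ge0$. A morphism $f:X\to Y$ of $k$-categories is a \emph{weak equivalence} if there are a $k$-category $P$ and hypercovers $p:P\to X$, $q:P\to Y$ such that $f=qs$ for some section $s$ of $p$. **Theorem.** Let $k>0$ and let $f:X\to Y$ be a morphism of $k$-categories in a descent category. Then $f$ is a weak equivalence if and only if both of the following hold: 1. the morphism $X_0\times_{Y_0}\mathrm{Map}(\mathbf\Delta^1,Y)\to Y_0$ is a cover, where the fibre product is formed using the vertex $1$ of $\mathbf\Delta^1$ and the morphism to $Y_0$ is induced by the vertex $0$; 2. for every $n>0$, the morphism $$\mathrm{Map}\bigl(\Delta^n\to\mathbf\Delta^1\star\Delta^{n-1},f\bigr)\longrightarrow\mathrm{Map}\bigl(\partial\Delta^n\to(\mathbf\Delta^1\star\partial\Delta^{n-1})\cup(\mathbf\Lambda^1_0\star\Delta^{n-1}),f\bigr)$$ is a cover, where $\Delta^n=\{1\}\star\Delta^{n-1}\subset\mathbf\Delta^1\star\Delta^{n-1}$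 is spanned by the vertex $1$ of $\mathbf\Delta^1$ (the vertex not in $\mathbf\Lambda^1_0$) and $\Delta^{n-1}$. -/

import Mathlib

open CategoryTheory Opposite Simplicial

universe v u

namespace DescentCat

/-! ### Descent categories -/

/-- A descent category: a category `V` with finite limits together with a subcategory of covers
(a class of morphisms containing identities and closed under composition) such that pullbacks of
covers are covers, and such that `g` is a cover as soon as `f` and `g ∘ f` are covers. -/
structure IsDescentCategory {V : Type u} [Category.{v} V] (cov : MorphismProperty V) : Prop where
  hasFiniteLimits : Limits.HasFiniteLimits V
  isMultiplicative : cov.IsMultiplicative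
  isStableUnderBaseChange : cov.IsStableUnderBaseChange
  of_precomp : ∀ ⦃A B C : V⦄ (f : A ⟶ B) (g : B ⟶ C), cov f → cov (f ≫ g) → cov g

/-! ### Mapping spaces

A simplicial space is a simplicial object of `V`. The space `Map(T, X)` of simplicial morphisms
from a simplicial set `T` to a simplicial space `X` is the object of `V` whose `A`-points, for `A`
in `V`, are the maps of simplicial sets from `T` to `Hom(A, X_•)`. We work with this functor of
points; a morphism between such spaces "is a cover" if both functors are representable, and the
corresponding morphism of `V` between representing objects is a cover. In particular this makes
sense for those infinite simplicial sets `T` for which `Map(T, X)` exists. -/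

section Spaces

variable {V : Type u} [Category.{v} V]

/-- The simplicial set `Hom(A, X_•)` of `A`-points of the simplicial space `X`, as a functor
of `A`. -/
def points (X : SimplicialObject V) : Vᵒᵖ ⥤ SSet.{v} :=
  coyoneda ⋙ (Functor.whiskeringLeft SimplexCategoryᵒᵖ V (Type v)).obj X

/-- The map `Hom(A, X_•) ⟶ Hom(A, Y_•)` induced by a simplicial morphism `X ⟶ Y`. -/
def pointsMap {X Y : SimplicialObject V} (f : X ⟶ Y) : points X ⟶ points Y :=
  Functor.whiskerLeft coyoneda ((Functor.whiskeringLeft SimplexCategoryᵒᵖ V (Type v)).map f)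

/-- The functor of points of `Map(T, X)`. -/
def Map (T : SSet.{v}) (X : SimplicialObject V) : Vᵒᵖ ⥤ Type v :=
  points X ⋙ coyoneda.obj (op T)

/-- The restriction `Map(T, X) ⟶ Map(S, X)` along a map `i : S ⟶ T` of simplicial sets. -/
def restrict {S T : SSet.{v}} (i : S ⟶ T) (X : SimplicialObject V) : Map T X ⟶ Map S X :=
  Functor.whiskerLeft (points X) (coyoneda.map i.op)

/-- The `A`-points of `Map(S → T, f) = Map(S, X) ×_{Map(S, Y)} Map(T, Y)`, for a map `i : S ⟶ T`
of simplicial sets and a morphism `f : X ⟶ Y` of simplicial spaces. -/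
@[ext]
structure RelPoint {S T : SSet.{v}} (i : S ⟶ T) {X Y : SimplicialObject V} (f : X ⟶ Y)
    (A : Vᵒᵖ) : Type v where
  fst : S ⟶ (points X).obj A
  snd : T ⟶ (points Y).obj A
  w : fst ≫ (pointsMap f).app A = i ≫ snd

/-- The functor of points of `Map(S → T, f) = Map(S, X) ×_{Map(S, Y)} Map(T, Y)`. -/
def RelMap {S T : SSet.{v}} (i : S ⟶ T) {X Y : SimplicialObject V} (f : X ⟶ Y) :
    Vᵒᵖ ⥤ Type v where
  obj A := RelPoint i f A
  map h := ↾fun p ↦ ⟨p.fst ≫ (points X).map h, p.snd ≫ (points Y).map h, by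
    rw [Category.assoc, (pointsMap f).naturality h, ← Category.assoc, p.w, Category.assoc]⟩
  map_id A := by
    refine ConcreteCategory.hom_ext _ _ fun p ↦ ?_
    exact RelPoint.ext (by simp) (by simp)
  map_comp h h' := by
    refine ConcreteCategory.hom_ext _ _ fun p ↦ ?_
    exact RelPoint.ext (by simp) (by simp)

/-- The canonical morphism `Map(T, X) ⟶ Map(S → T, f)`. -/
def toRelMap {S T : SSet.{v}} (i : S ⟶ T) {X Y : SimplicialObject V} (f : X ⟶ Y) :
    Map T X ⟶ RelMap i f where
  app A := ↾fun (a : T ⟶ (points X).obj A) ↦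
    (⟨i ≫ a, a ≫ (pointsMap f).app A, Category.assoc _ _ _⟩ : RelPoint i f A)
  naturality A B h := by
    refine ConcreteCategory.hom_ext _ _ fun a ↦ ?_
    have key (a : T ⟶ (points X).obj A) :
        (⟨i ≫ a ≫ (points X).map h, (a ≫ (points X).map h) ≫ (pointsMap f).app B,
          Category.assoc _ _ _⟩ : RelPoint i f B) =
        ⟨(i ≫ a) ≫ (points X).map h, (a ≫ (pointsMap f).app A) ≫ (points Y).map h, by
          simp [(pointsMap f).naturality h]⟩ :=
      RelPoint.ext (by simp) (by simp [(pointsMap f).naturality h])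
    exact key a

/-- The morphism `Map(S → T, f) ⟶ Map(S' → T', f)` induced by a commutative square
of simplicial sets from `i' : S' ⟶ T'` to `i : S ⟶ T`. -/
def relRestrict {S T S' T' : SSet.{v}} (i : S ⟶ T) (i' : S' ⟶ T') (a : S' ⟶ S) (b : T' ⟶ T)
    (w : a ≫ i = i' ≫ b) {X Y : SimplicialObject V} (f : X ⟶ Y) : RelMap i f ⟶ RelMap i' f where
  app A := ↾fun (p : RelPoint i f A) ↦
    (⟨a ≫ p.fst, b ≫ p.snd, by
      rw [Category.assoc, p.w, ← Category.assoc, w, Category.assoc]⟩ : RelPoint i' f A)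
  naturality A B h := by
    refine ConcreteCategory.hom_ext _ _ fun p ↦ ?_
    exact RelPoint.ext (Category.assoc _ _ _).symm (Category.assoc _ _ _).symm

/-- The morphism `Map(S → T, f) = Map(S, X) ×_{Map(S, Y)} Map(T, Y) ⟶ Map(R, Y)` given by the
projection to `Map(T, Y)` followed by restriction along `b : R ⟶ T`. -/
def relProj {S T R : SSet.{v}} (i : S ⟶ T) (b : R ⟶ T) {X Y : SimplicialObject V} (f : X ⟶ Y) :
    RelMap i f ⟶ Map R Y where
  app A := ↾fun (p : RelPoint i f A) ↦ (b ≫ p.snd : R ⟶ (points Y).obj A)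
  naturality A B h := by
    refine ConcreteCategory.hom_ext _ _ fun p ↦ ?_
    exact (Category.assoc b (RelPoint.snd p) ((points Y).map h)).symm

/-- The morphism `α` of functors of points is (represented by) a cover. -/
def IsCover (cov : MorphismProperty V) {F G : Vᵒᵖ ⥤ Type v} (α : F ⟶ G) : Prop :=
  ∃ (A B : V) (eA : yoneda.obj A ≅ F) (eB : yoneda.obj B ≅ G) (p : A ⟶ B),
    cov p ∧ yoneda.map p ≫ eB.hom = eA.hom ≫ α

end Spaces

/-! ### Simplicial sets: thick simplices and joins -/

/-- The thick `n`-simplex, i.e. the nerve of the groupoid with objects `0, …, n` and exactly one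
morphism between any two objects: its `m`-simplices are all functions `{0, …, m} → {0, …, n}`. -/
def thickSimplex (n : ℕ) : SSet.{v} where
  obj m := Fin (m.unop.len + 1) → ULift.{v} (Fin (n + 1))
  map θ := ↾fun s ↦ s ∘ θ.unop.toOrderHom

/-- The inclusion of the vertex `i` in the thick `n`-simplex. -/
def thickVertex (n : ℕ) (i : Fin (n + 1)) : (Δ[0] : SSet.{v}) ⟶ thickSimplex.{v} n :=
  SSet.const (Y := thickSimplex.{v} n) (fun _ ↦ ULift.up i)

/-- The `i`-th thick horn, the union of the faces of the thick `n`-simplex other than the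
`i`-th one. -/
def thickHorn (n : ℕ) (i : Fin (n + 1)) : (thickSimplex.{v} n).Subcomplex where
  obj _ := {s | ∃ j : Fin (n + 1), j ≠ i ∧ ∀ a, s a ≠ ULift.up j}
  map _ _ := fun ⟨j, hj, h⟩ ↦ ⟨j, hj, fun _ ↦ h _⟩

/-- The fibre over the vertex `e` of the map `Δ^m ⟶ Δ^1` given by `c`. -/
def cutFibre {m : SimplexCategory} (c : m ⟶ ⦋1⦌) (e : Fin 2) :
    (SSet.stdSimplex.{v}.obj m).Subcomplex where
  obj _ := {s | ∀ a, (SSet.stdSimplex.objEquiv s ≫ c).toOrderHom a = e}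
  map _ _ hs := fun _ ↦ hs _

/-- The map induced on fibres by `θ : m' ⟶ m`. -/
def cutFibreMap {m m' : SimplexCategory} (θ : m' ⟶ m) (c : m ⟶ ⦋1⦌) (c' : m' ⟶ ⦋1⦌)
    (hc : θ ≫ c = c') (e : Fin 2) :
    (cutFibre.{v} c' e : SSet.{v}) ⟶ (cutFibre.{v} c e : SSet.{v}) :=
  SSet.Subcomplex.lift ((cutFibre.{v} c' e).ι ≫ SSet.stdSimplex.map θ) (by
    subst hc
    rintro k _ ⟨s, rfl⟩
    exact s.2)

/-- An `m`-simplex of the join `S ⋆ T`: a cut of `{0, …, m}` into an initial segment (where `cut`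
is `0`) and the complementary final segment (where `cut` is `1`), together with a simplex of `S`
on the initial segment and a simplex of `T` on the final one, each of these being absent when the
segment is empty. Equivalently, it is an element of
`S_m ⊔ T_m ⊔ ⨆_{j < m} S_j × T_{m - j - 1}`. -/
structure JoinSimplex (S T : SSet.{v}) (m : SimplexCategory) : Type v where
  cut : m ⟶ ⦋1⦌
  left : (cutFibre.{v} cut 0 : SSet.{v}) ⟶ S
  right : (cutFibre.{v} cut 1 : SSet.{v}) ⟶ T

theorem JoinSimplex.ext' {S T : SSet.{v}} {m : SimplexCategory} {x y : JoinSimplex S T m}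
    (h : x.cut = y.cut)
    (hl : x.left = cutFibreMap (𝟙 m) y.cut x.cut (by simp [h]) 0 ≫ y.left)
    (hr : x.right = cutFibreMap (𝟙 m) y.cut x.cut (by simp [h]) 1 ≫ y.right) : x = y := by
  obtain ⟨c, l, r⟩ := x
  obtain ⟨c', l', r'⟩ := y
  dsimp at h
  subst h
  have key : ∀ e, cutFibreMap.{v} (𝟙 m) c c (by simp) e = 𝟙 _ := fun e ↦ by
    ext k s
    refine Subtype.ext ?_
    exact ConcreteCategory.congr_hom
      (congr_app (CategoryTheory.Functor.map_id SSet.stdSimplex m) k) s.1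
  dsimp at hl hr
  rw [key, Category.id_comp] at hl hr
  rw [hl, hr]

/-- The join `S ⋆ T` of two simplicial sets. -/
def join (S T : SSet.{v}) : SSet.{v} where
  obj m := JoinSimplex S T m.unop
  map θ := ↾fun x ↦
    { cut := θ.unop ≫ x.cut
      left := cutFibreMap θ.unop x.cut _ rfl 0 ≫ x.left
      right := cutFibreMap θ.unop x.cut _ rfl 1 ≫ x.right }
  map_id m := by
    ext x
    exact JoinSimplex.ext' (Category.id_comp x.cut) rfl rfl
  map_comp θ θ' := by
    ext x
    refine JoinSimplex.ext' (Category.assoc θ'.unop θ.unop x.cut) ?_ ?_ <;> rfl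

/-- For subcomplexes `A ⊆ S` and `B ⊆ T`, the subcomplex `A ⋆ B` of `S ⋆ T`. -/
def subJoin {S T : SSet.{v}} (A : S.Subcomplex) (B : T.Subcomplex) :
    (join S T).Subcomplex where
  obj m := Set.ofPred (fun x : JoinSimplex S T m.unop ↦
    SSet.Subcomplex.range x.left ≤ A ∧ SSet.Subcomplex.range x.right ≤ B)
  map θ x hx := by
    constructor
    · rintro k _ ⟨s, rfl⟩
      exact hx.1 _ ⟨_, rfl⟩
    · rintro k _ ⟨s, rfl⟩
      exact hx.2 _ ⟨_, rfl⟩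

theorem simplexToJoin_aux (n : ℕ) :
    Monotone (fun i : Fin (n + 2) ↦ if i = 0 then (0 : Fin 2) else 1) := by
  intro i j hij
  dsimp only
  split_ifs with h1 h2 h2
  · exact le_rfl
  · exact Fin.zero_le _
  · exact absurd (Fin.le_zero_iff.1 (h2 ▸ hij)) h1
  · exact le_rfl

/-- The inclusion `Δ^{n+1} = {1} ⋆ Δ^n ⊆ 𝚫^1 ⋆ Δ^n`, where `𝚫^1` is the thick `1`-simplex:
the vertex `0` of `Δ^{n+1}` goes to the vertex `1` of `𝚫^1`, and the vertex `i + 1` goes to the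
vertex `i` of `Δ^n`. -/
def simplexToJoin (n : ℕ) :
    (Δ[n + 1] : SSet.{v}) ⟶ join (thickSimplex.{v} 1) Δ[n] :=
  SSet.yonedaEquiv.symm
    { cut := SimplexCategory.mkHom ⟨fun i ↦ if i = 0 then 0 else 1, simplexToJoin_aux n⟩
      left := SSet.const (Y := thickSimplex.{v} 1) (fun _ ↦ ULift.up 1)
      right := (cutFibre.{v} _ 1).ι ≫ SSet.stdSimplex.map (SimplexCategory.σ 0) }

/-- The subcomplex `𝚫^1 ⋆ ∂Δ^n ∪ 𝚲^1_0 ⋆ Δ^n` of `𝚫^1 ⋆ Δ^n`. -/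
def joinHorn (n : ℕ) : (join (thickSimplex.{v} 1) Δ[n]).Subcomplex :=
  subJoin ⊤ (SSet.boundary n) ⊔ subJoin (thickHorn 1 0) ⊤

theorem boundary_le_joinHorn (n : ℕ) :
    SSet.Subcomplex.range ((SSet.boundary.{v} (n + 1)).ι ≫ simplexToJoin.{v} n) ≤
      joinHorn.{v} n := by
  rintro m _ ⟨⟨s, hs⟩, rfl⟩
  obtain ⟨θ, rfl⟩ := SSet.stdSimplex.objEquiv.symm.surjective s
  have hs' : ¬ Function.Surjective θ.toOrderHom := hs
  simp only [Function.Surjective, not_forall, not_exists] at hs'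
  obtain ⟨j, hj⟩ := hs'
  have aux : ∀ (e : Fin 2) (k : SimplexCategoryᵒᵖ)
      (t : (cutFibre.{v} (θ ≫ SimplexCategory.mkHom ⟨fun i : Fin (n + 2) ↦ if i = 0 then 0 else 1,
        simplexToJoin_aux n⟩) e : SSet.{v}).obj k) (a : Fin (k.unop.len + 1)),
      (if θ.toOrderHom ((SSet.stdSimplex.objEquiv t.1).toOrderHom a) = 0 then (0 : Fin 2) else 1)
        = e := fun e k t a ↦ t.2 a
  obtain rfl | ⟨j, rfl⟩ := Fin.eq_zero_or_eq_succ j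
  · refine Or.inr ⟨?_, le_top⟩
    rintro k _ ⟨t, rfl⟩
    have := aux 0 k t 0
    rw [if_neg (hj _)] at this
    exact absurd this (by decide)
  · refine Or.inl ⟨le_top, ?_⟩
    rintro k _ ⟨t, rfl⟩ hsurj
    obtain ⟨a, ha⟩ := hsurj j
    have h1 := aux 1 k t a
    have h2 : (θ.toOrderHom ((SSet.stdSimplex.objEquiv t.1).toOrderHom a)) ≠ 0 := by
      intro h
      rw [if_pos h] at h1
      exact absurd h1 (by decide)
    have h3 : Fin.predAbove 0 (θ.toOrderHom ((SSet.stdSimplex.objEquiv t.1).toOrderHom a)) = j := ha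
    obtain ⟨i, hi⟩ := Fin.exists_succ_eq.2 h2
    rw [← hi, Fin.predAbove_zero_succ] at h3
    exact hj _ (hi.symm.trans (by rw [h3]))

/-- The inclusion of `∂Δ^{n+1}` in `𝚫^1 ⋆ ∂Δ^n ∪ 𝚲^1_0 ⋆ Δ^n`, obtained by restricting that of
`Δ^{n+1}` in `𝚫^1 ⋆ Δ^n`. -/
def boundaryToJoin (n : ℕ) :
    ((SSet.boundary.{v} (n + 1) : SSet.{v})) ⟶ (joinHorn.{v} n : SSet.{v}) :=
  SSet.Subcomplex.lift ((SSet.boundary.{v} (n + 1)).ι ≫ simplexToJoin.{v} n)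
    (boundary_le_joinHorn n)

/-! ### `k`-categories -/

section KCategories

variable {V : Type u} [Category.{v} V] (cov : MorphismProperty V)

/-- A simplicial space `X` is a `k`-category if, for `0 < i < n`, the morphism
`X_n = Map(Δ^n, X) ⟶ Map(Λ^n_i, X)` is a cover, and an isomorphism for `n > k`, and the morphisms
`Map(𝚫^1, X) ⟶ Map(Δ^0, X) = X_0` induced by the vertices of the thick `1`-simplex `𝚫^1` are
covers. -/
structure IsKCategory (k : ℕ) (X : SimplicialObject V) : Prop where
  horn_cover : ∀ (n : ℕ) (i : Fin (n + 1)), 0 < i → i < Fin.last n →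
    IsCover cov (restrict (SSet.horn.{v} n i).ι X)
  horn_iso : ∀ (n : ℕ) (i : Fin (n + 1)), 0 < i → i < Fin.last n → k < n →
    IsIso (restrict (SSet.horn.{v} n i).ι X)
  vertex_cover : ∀ i : Fin 2, IsCover cov (restrict (thickVertex.{v} 1 i) X)

/-- A morphism `f : X ⟶ Y` of simplicial spaces is a hypercover if, for all `n ≥ 0`, the morphism
`X_n ⟶ Map(∂Δ^n, X) ×_{Map(∂Δ^n, Y)} Y_n` is a cover. -/
def IsHypercover {X Y : SimplicialObject V} (f : X ⟶ Y) : Prop :=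
  ∀ n : ℕ, IsCover cov (toRelMap (SSet.boundary.{v} n).ι f)

/-- A morphism `f : X ⟶ Y` of `k`-categories is a weak equivalence if there are a `k`-category `P`
and hypercovers `p : P ⟶ X` and `q : P ⟶ Y` such that `f = q ∘ s`, where `s` is a section
of `p`. -/
def IsWeakEquivalence (k : ℕ) {X Y : SimplicialObject V} (f : X ⟶ Y) : Prop :=
  ∃ (P : SimplicialObject V) (p : P ⟶ X) (q : P ⟶ Y) (s : X ⟶ P),
    IsKCategory cov k P ∧ IsHypercover cov p ∧ IsHypercover cov q ∧
      s ≫ p = 𝟙 X ∧ f = s ≫ q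

end KCategories

end DescentCat

/-! The morphism `f` is replaced by a path object built from a directed version of the cylinder. The
prism on Δ^n consists of the simplices of 𝚫^1 × Δ^n whose label in {0, 1} may only increase when the
level in Δ^n increases, labels within one level being arbitrary. Put P_n = X_n ×_{Y_n} Map(prism_n,
Y), formed along the copy of Δ^n with label 1. There are a projection p : P → X, a section s of p
given by constant paths, and a map q : P → Y given by the end with label 0, and f = q ∘ s.

A map from ∂Δ^n to the simplicial set of maps out of prisms is a map out of the part of the prism
over ∂Δ^n (`prismBoundaryDesc`). The hypercover conditions on p and q thus become statements about
subcomplexes of a single prism. For p the subcomplex is `prismEnd n 1`: for n = 0 it is a vertex of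
𝚫^1, and for n > 0 the prism arises from it, up to any given skeleton, by filling finitely many
inner horns of dimension > n. So p is always a hypercover, its conditions are isomorphisms for n ≥
k, and P is a k-category (`IsKCategory.of_hypercover`). For q, inner horns lead from `prismEnd n 0`
only to `prismBot n`. What remains is glued along `prismJoin n`, which is 𝚫^1 ⋆ Δ^{n-1} for n > 0
and 𝚫^1 for n = 0. Hence the two conditions of the theorem, read as one family over n ≥ 0, make q a
hypercover.

The horns come from words (`innerExt_word_last`, `innerExt_word_first`). Every simplex of the prism
has a pivot level below which labels are 0 and above which they are 1, and it is a face or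
degeneracy of a long word with alternating labels at that level. Lengthening a word by one letter
fills one horn, whose missing face omits the last or the first letter of the pivot level.

Infinitely many words are needed in principle, but unique inner fillers above dimension k make
Map(T, Y) depend only on the simplices of T of dimension ≤ k + 1 (`UniqueInnerFillers.bijective`).
This allows truncation, and gives representability of Map(T, Y) for degreewise finite T.

Conversely, let f = q ∘ s with p and q hypercovers and s a section of p. Composition with q is a
cover on both sides of the morphism in question, so by the cancellation axiom it is enough to treat
s. There a point is a map to P which on S is s of its image in X, and the problem splits into an
extension in X along inner horns or a vertex of 𝚫^1, followed by a lift along p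
(`relRestrict_of_section`). -/

namespace DescentCat

open Limits

/-! ### Covers as relatively representable morphisms of presheaves -/

section Presheaves

variable {V : Type u} [Category.{v} V]

/-- A commutative square of presheaves of sets is a pullback as soon as compatible pairs lift
uniquely. -/
theorem isPullback_of_existsUnique {F₁ F₂ F₃ F₄ : Vᵒᵖ ⥤ Type v} {t : F₁ ⟶ F₂} {l : F₁ ⟶ F₃}
    {r : F₂ ⟶ F₄} {b : F₃ ⟶ F₄} (w : t ≫ r = l ≫ b)
    (h₁ : ∀ A (x y : F₁.obj A), t.app A x = t.app A y → l.app A x = l.app A y → x = y)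
    (h₂ : ∀ A (x : F₂.obj A) (y : F₃.obj A), r.app A x = b.app A y →
      ∃ z, t.app A z = x ∧ l.app A z = y) : IsPullback t l r b :=
  IsPullback.of_forall_isPullback_app fun A ↦ (Types.isPullback_iff _ _ _ _).2
    ⟨congr_app w A, fun x y h ↦ h₁ A x y h.1 h.2, h₂ A⟩

/-- Base change along a representation of `G` has representable source, and the other projection is
an isomorphism. -/
theorem isRepresentable_of_relativelyRepresentable {F G : Vᵒᵖ ⥤ Type v} {α : F ⟶ G}
    (hα : yoneda.relativelyRepresentable α) (hG : G.IsRepresentable) : F.IsRepresentable := by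
  have := (hα.isPullback G.reprW.hom).isIso_fst_of_isIso
  exact Functor.IsRepresentable.mk' (asIso (hα.fst G.reprW.hom))

theorem relativelyRepresentable_of_isRepresentable [HasPullbacks V] {F G : Vᵒᵖ ⥤ Type v}
    (α : F ⟶ G) (hF : F.IsRepresentable) (hG : G.IsRepresentable) :
    yoneda.relativelyRepresentable α := by
  obtain ⟨p, hp⟩ := yoneda.map_surjective (F.reprW.hom ≫ α ≫ G.reprW.inv)
  have : α = F.reprW.inv ≫ yoneda.map p ≫ G.reprW.hom := by simp [hp]
  rw [this]
  exact (MorphismProperty.cancel_left_of_respectsIso _ _ _).2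
    ((MorphismProperty.cancel_right_of_respectsIso _ _ _).2 (Functor.relativelyRepresentable.map _ p))

theorem isRepresentable_of_isPullback [HasPullbacks V] {F₁ F₂ F₃ F₄ : Vᵒᵖ ⥤ Type v} {t : F₁ ⟶ F₂}
    {l : F₁ ⟶ F₃} {r : F₂ ⟶ F₄} {b : F₃ ⟶ F₄} (sq : IsPullback t l r b)
    (h₂ : F₂.IsRepresentable) (h₃ : F₃.IsRepresentable) (h₄ : F₄.IsRepresentable) :
    F₁.IsRepresentable :=
  isRepresentable_of_relativelyRepresentable
    (MorphismProperty.of_isPullback sq (relativelyRepresentable_of_isRepresentable r h₂ h₄)) h₃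

theorem isRepresentable_of_isIso {F G : Vᵒᵖ ⥤ Type v} (α : F ⟶ G) [IsIso α]
    (hG : G.IsRepresentable) : F.IsRepresentable :=
  isRepresentable_of_natIso _ (asIso α).symm

theorem isIso_of_bijective {F G : Vᵒᵖ ⥤ Type v} (α : F ⟶ G)
    (h : ∀ A, Function.Bijective (α.app A)) : IsIso α := by
  have : ∀ A, IsIso (α.app A) := fun A ↦ (isIso_iff_bijective _).2 (h A)
  exact NatIso.isIso_of_isIso_app α

theorem bijective_of_isIso {F G : Vᵒᵖ ⥤ Type v} (α : F ⟶ G) [IsIso α] (A : Vᵒᵖ) :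
    Function.Bijective (α.app A) :=
  (isIso_iff_bijective _).1 inferInstance

variable {cov : MorphismProperty V}

theorem IsDescentCategory.hasPullbacks (hV : IsDescentCategory cov) : HasPullbacks V :=
  have := hV.hasFiniteLimits
  inferInstance

/-- A morphism of presheaves is a cover if and only if it has representable source and target
and is relatively representable by covers. -/
theorem isCover_iff (hV : IsDescentCategory cov) {F G : Vᵒᵖ ⥤ Type v} (α : F ⟶ G) :
    IsCover cov α ↔ F.IsRepresentable ∧ G.IsRepresentable ∧ cov.presheaf α := by
  have := hV.hasPullbacks
  have := hV.isStableUnderBaseChange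
  constructor
  · rintro ⟨A, B, eA, eB, p, hp, h⟩
    refine ⟨.mk' eA, .mk' eB, ?_⟩
    have : α = eA.inv ≫ yoneda.map p ≫ eB.hom := by simp [h]
    rw [this]
    exact (MorphismProperty.cancel_left_of_respectsIso _ _ _).2
      ((MorphismProperty.cancel_right_of_respectsIso _ _ _).2
        (MorphismProperty.relative_map hp))
  · rintro ⟨hF, hG, hα⟩
    obtain ⟨p, hp⟩ := yoneda.map_surjective (F.reprW.hom ≫ α ≫ G.reprW.inv)
    refine ⟨_, _, F.reprW, G.reprW, p, MorphismProperty.of_relative_map (F := yoneda) ?_,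
      by simp [hp]⟩
    rw [hp]
    exact (MorphismProperty.cancel_left_of_respectsIso _ _ _).2
      ((MorphismProperty.cancel_right_of_respectsIso _ _ _).2 hα)

theorem isCover_of_presheaf (hV : IsDescentCategory cov) {F G : Vᵒᵖ ⥤ Type v} {α : F ⟶ G}
    (hG : G.IsRepresentable) (hα : cov.presheaf α) : IsCover cov α :=
  (isCover_iff hV α).2 ⟨isRepresentable_of_relativelyRepresentable hα.rep hG, hG, hα⟩

/-- This is the cancellation axiom of a descent category, transported through Yoneda; `F` is
representable because `α` is relatively representable and `G` is representable. -/
theorem isCover_of_comp (hV : IsDescentCategory cov) {F G H : Vᵒᵖ ⥤ Type v} {α : F ⟶ G}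
    {β : G ⟶ H} (hα : cov.presheaf α) (hαβ : cov.presheaf (α ≫ β)) (hG : G.IsRepresentable)
    (hH : H.IsRepresentable) : IsCover cov β := by
  obtain ⟨p, hp⟩ := yoneda.map_surjective (G.reprW.hom ≫ β ≫ H.reprW.inv)
  have hF := isRepresentable_of_relativelyRepresentable hα.rep hG
  obtain ⟨q, hq⟩ := yoneda.map_surjective (F.reprW.hom ≫ α ≫ G.reprW.inv)
  have := hV.isStableUnderBaseChange
  refine ⟨_, _, G.reprW, H.reprW, p, hV.of_precomp q p ?_ ?_, by simp [hp]⟩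
  · refine MorphismProperty.of_relative_map (F := yoneda) ?_
    rw [hq]
    exact (MorphismProperty.cancel_left_of_respectsIso _ _ _).2
      ((MorphismProperty.cancel_right_of_respectsIso _ _ _).2 hα)
  · refine MorphismProperty.of_relative_map (F := yoneda) ?_
    have : yoneda.map (q ≫ p) = F.reprW.hom ≫ (α ≫ β) ≫ H.reprW.inv := by
      rw [Functor.map_comp, hp, hq]; simp
    rw [this]
    exact (MorphismProperty.cancel_left_of_respectsIso _ _ _).2
      ((MorphismProperty.cancel_right_of_respectsIso _ _ _).2 hαβ)

theorem presheaf_isStableUnderBaseChange : cov.presheaf.IsStableUnderBaseChange :=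
  MorphismProperty.relative_isStableUnderBaseChange _

theorem IsDescentCategory.presheaf_isMultiplicative (hV : IsDescentCategory cov) :
    cov.presheaf.IsMultiplicative :=
  have := hV.isStableUnderBaseChange
  have := hV.isMultiplicative
  inferInstance

end Presheaves

/-! ### Calculus of mapping spaces and relative mapping spaces -/

section MappingSpaces

variable {V : Type u} [Category.{v} V]

theorem relMap_ext {S T : SSet.{v}} {i : S ⟶ T} {X Y : SimplicialObject V} {f : X ⟶ Y}
    {A : Vᵒᵖ} {x y : (RelMap i f).obj A} (h₁ : RelPoint.fst x = RelPoint.fst y)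
    (h₂ : RelPoint.snd x = RelPoint.snd y) : x = y := RelPoint.ext h₁ h₂

theorem relMap_congr_fst {S T : SSet.{v}} {i : S ⟶ T} {X Y : SimplicialObject V} {f : X ⟶ Y}
    {A : Vᵒᵖ} {x y : (RelMap i f).obj A} (h : x = y) : RelPoint.fst x = RelPoint.fst y := by
  rw [h]

theorem relMap_congr_snd {S T : SSet.{v}} {i : S ⟶ T} {X Y : SimplicialObject V} {f : X ⟶ Y}
    {A : Vᵒᵖ} {x y : (RelMap i f).obj A} (h : x = y) : RelPoint.snd x = RelPoint.snd y := by
  rw [h]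

theorem pointsMap_comp {X Y Z : SimplicialObject V} (f : X ⟶ Y) (g : Y ⟶ Z) :
    pointsMap (f ≫ g) = pointsMap f ≫ pointsMap g := by
  ext A n x
  exact (Category.assoc _ _ _).symm

theorem pointsMap_comp_app_of_section {X P : SimplicialObject V} {p : P ⟶ X} {s : X ⟶ P}
    (hs : s ≫ p = 𝟙 X) (A : Vᵒᵖ) : (pointsMap s).app A ≫ (pointsMap p).app A = 𝟙 _ := by
  rw [← NatTrans.comp_app, ← pointsMap_comp, hs]
  ext n x
  exact Category.comp_id _

/-- The morphism `Map(T, X) ⟶ Map(T, Y)` induced by `X ⟶ Y`. -/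
def mapMap (T : SSet.{v}) {X Y : SimplicialObject V} (f : X ⟶ Y) : Map T X ⟶ Map T Y :=
  Functor.whiskerRight (pointsMap f) (coyoneda.obj (op T))

/-- The projection `Map(S → T, f) ⟶ Map(S, X)`. -/
def relFst {S T : SSet.{v}} (i : S ⟶ T) {X Y : SimplicialObject V} (f : X ⟶ Y) :
    RelMap i f ⟶ Map S X where
  app A := ↾fun (p : RelPoint i f A) ↦ (p.fst : S ⟶ (points X).obj A)

/-- The projection `Map(S → T, f) ⟶ Map(T, Y)`. -/
def relSnd {S T : SSet.{v}} (i : S ⟶ T) {X Y : SimplicialObject V} (f : X ⟶ Y) :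
    RelMap i f ⟶ Map T Y where
  app A := ↾fun (p : RelPoint i f A) ↦ (p.snd : T ⟶ (points Y).obj A)

theorem isPullback_relMap {S T : SSet.{v}} (i : S ⟶ T) {X Y : SimplicialObject V} (f : X ⟶ Y) :
    IsPullback (relSnd i f) (relFst i f) (restrict i Y) (mapMap S f) := by
  refine isPullback_of_existsUnique ?_ ?_ ?_
  · ext A p
    exact (RelPoint.w p).symm
  · exact fun A x y h₁ h₂ ↦ RelPoint.ext h₂ h₁
  · exact fun A x y h ↦ ⟨(⟨y, x, h.symm⟩ : RelPoint i f A), rfl, rfl⟩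

theorem isRepresentable_relMap [HasPullbacks V] {S T : SSet.{v}} (i : S ⟶ T)
    {X Y : SimplicialObject V} (f : X ⟶ Y) (h₁ : (Map S X).IsRepresentable)
    (h₂ : (Map S Y).IsRepresentable) (h₃ : (Map T Y).IsRepresentable) :
    (RelMap i f).IsRepresentable :=
  isRepresentable_of_isPullback (isPullback_relMap i f) h₃ h₁ h₂

theorem restrict_comp {R S T : SSet.{v}} (i : R ⟶ S) (j : S ⟶ T) (X : SimplicialObject V) :
    restrict (i ≫ j) X = restrict j X ≫ restrict i X := by
  ext A p
  exact Category.assoc _ _ _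

instance isIso_restrict {S T : SSet.{v}} (i : S ⟶ T) [IsIso i] (X : SimplicialObject V) :
    IsIso (restrict i X) :=
  ⟨restrict (inv i) X, by
    rw [← restrict_comp, IsIso.inv_hom_id]; ext A p; exact Category.id_comp _, by
    rw [← restrict_comp, IsIso.hom_inv_id]; ext A p; exact Category.id_comp _⟩

theorem isPullback_restrict {A B S T : SSet.{v}} {a : A ⟶ S} {i : A ⟶ B} {j : S ⟶ T} {b : B ⟶ T}
    (h : IsPushout a i j b) (X : SimplicialObject V) :
    IsPullback (restrict b X) (restrict j X) (restrict i X) (restrict a X) := by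
  refine isPullback_of_existsUnique ?_ ?_ ?_
  · rw [← restrict_comp, ← restrict_comp, h.w]
  · exact fun A x y h₁ h₂ ↦ h.hom_ext h₂ h₁
  · exact fun A x y hxy ↦ ⟨h.desc y x hxy.symm, h.inr_desc _ _ _, h.inl_desc _ _ _⟩

/-- Over the pushout `T`, a map to `X` is determined by its restrictions to `S` and `B`, so the only
freedom left once the relative data are given is a filler on `B`. -/
theorem isPullback_toRelMap {A B S T : SSet.{v}} {a : A ⟶ S} {i : A ⟶ B} {j : S ⟶ T} {b : B ⟶ T}
    (h : IsPushout a i j b) {X Y : SimplicialObject V} (f : X ⟶ Y) :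
    IsPullback (restrict b X) (toRelMap j f) (toRelMap i f) (relRestrict j i a b h.w f) := by
  refine isPullback_of_existsUnique ?_ ?_ ?_
  · ext A x
    change T ⟶ (points X).obj A at x
    refine relMap_ext ?_ (Category.assoc b x _)
    change i ≫ b ≫ x = a ≫ j ≫ x
    rw [← Category.assoc, ← h.w, Category.assoc]
  · exact fun A x y h₁ h₂ ↦ h.hom_ext (congr_arg RelPoint.fst h₂) h₁
  · intro A (x : B ⟶ (points X).obj A) (y : RelPoint j f A) hxy
    have h₁ : i ≫ x = a ≫ y.fst := congr_arg RelPoint.fst hxy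
    have h₂ : x ≫ (pointsMap f).app A = b ≫ y.snd := congr_arg RelPoint.snd hxy
    refine ⟨h.desc y.fst x h₁.symm, h.inr_desc _ _ _,
      relMap_ext (h.inl_desc _ _ _) (h.hom_ext (W := (points Y).obj A) ?_ ?_)⟩
    · change j ≫ h.desc y.fst x _ ≫ _ = j ≫ y.snd
      rw [h.inl_desc_assoc, y.w]
    · change b ≫ h.desc y.fst x _ ≫ _ = b ≫ y.snd
      rw [h.inr_desc_assoc, h₂]

variable (W : MorphismProperty (Vᵒᵖ ⥤ Type v)) [W.IsStableUnderBaseChange]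

theorem restrict_of_isPushout {A B S T : SSet.{v}} {a : A ⟶ S} {i : A ⟶ B} {j : S ⟶ T} {b : B ⟶ T}
    (h : IsPushout a i j b) {X : SimplicialObject V} (hi : W (restrict i X)) :
    W (restrict j X) :=
  W.of_isPullback (isPullback_restrict h X) hi

theorem toRelMap_of_isPushout {A B S T : SSet.{v}} {a : A ⟶ S} {i : A ⟶ B} {j : S ⟶ T} {b : B ⟶ T}
    (h : IsPushout a i j b) {X Y : SimplicialObject V} {f : X ⟶ Y} (hi : W (toRelMap i f)) :
    W (toRelMap j f) :=
  W.of_isPullback (isPullback_toRelMap h f) hi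

/-- Lifting from `R` to `T` is done in two stages, and the first stage is a base change of the
lifting problem along `i`. -/
theorem toRelMap_comp [W.IsMultiplicative] {R S T : SSet.{v}} (i : R ⟶ S) (j : S ⟶ T)
    {X Y : SimplicialObject V} (f : X ⟶ Y) (hi : W (toRelMap i f)) (hj : W (toRelMap j f)) :
    W (toRelMap (i ≫ j) f) := by
  have sq : IsPullback (relFst j f) (relRestrict j (i ≫ j) i (𝟙 T) (by simp) f) (toRelMap i f)
      (relRestrict (i ≫ j) i (𝟙 R) j (by simp) f) := by
    refine isPullback_of_existsUnique ?_ ?_ ?_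
    · ext A x
      exact relMap_ext (Category.id_comp _).symm
        ((RelPoint.w x).trans (by exact congr_arg (j ≫ ·) (Category.id_comp _).symm))
    · intro A (x : RelPoint j f A) (y : RelPoint j f A) h₁ h₂
      have h₃ : 𝟙 T ≫ x.snd = 𝟙 T ≫ y.snd := (relMap_congr_snd h₂ :)
      exact relMap_ext h₁ (by simpa using h₃)
    · intro A (x : S ⟶ (points X).obj A) (y : RelPoint (i ≫ j) f A) hxy
      have h₁ : i ≫ x = 𝟙 R ≫ y.fst := congr_arg RelPoint.fst hxy
      have h₂ : x ≫ (pointsMap f).app A = j ≫ y.snd := congr_arg RelPoint.snd hxy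
      rw [Category.id_comp] at h₁
      exact ⟨(⟨x, y.snd, h₂⟩ : RelPoint j f A), rfl,
        relMap_ext h₁ (Category.id_comp _)⟩
  have : toRelMap (i ≫ j) f = toRelMap j f ≫ relRestrict j (i ≫ j) i (𝟙 T) (by simp) f := by
    ext A x
    exact relMap_ext (Category.assoc _ _ _) (Category.id_comp _).symm
  rw [this]
  exact W.comp_mem _ _ hj (W.of_isPullback sq hi)

/-- If `Map(T, X) ⟶ Map(S → T, f)` and `Map(T, Y) ⟶ Map(S, Y)` are in a class of morphisms, then
so is `Map(T, X) ⟶ Map(S, X)`. -/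
theorem restrict_of_toRelMap [W.IsMultiplicative] {S T : SSet.{v}} (i : S ⟶ T)
    {X Y : SimplicialObject V} (f : X ⟶ Y) (h : W (toRelMap i f)) (hY : W (restrict i Y)) :
    W (restrict i X) :=
  W.comp_mem _ _ h (W.of_isPullback (isPullback_relMap i f) hY)

/-- Enlarging `T` in `Map(S → T, f)`. -/
theorem relRestrict_of_restrict {S T T' : SSet.{v}} (i' : S ⟶ T') (t : T' ⟶ T) (i : S ⟶ T)
    (hi : i' ≫ t = i) {X Y : SimplicialObject V} (f : X ⟶ Y) (h : W (restrict t Y)) :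
    W (relRestrict i i' (𝟙 S) t (by simp [hi]) f) := by
  have sq : IsPullback (relSnd i f) (relRestrict i i' (𝟙 S) t (by simp [hi]) f)
      (restrict t Y) (relSnd i' f) := by
    refine isPullback_of_existsUnique ?_ ?_ ?_
    · ext A x
      rfl
    · intro A (x : RelPoint i f A) (y : RelPoint i f A) h₁ h₂
      have h₃ : 𝟙 S ≫ x.fst = 𝟙 S ≫ y.fst := (relMap_congr_fst h₂ :)
      exact relMap_ext (by simpa using h₃) h₁
    · intro A (x : T ⟶ (points Y).obj A) (y : RelPoint i' f A) hxy
      have hxy' : t ≫ x = y.snd := hxy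
      refine ⟨(⟨y.fst, x, ?_⟩ : RelPoint i f A), rfl,
        relMap_ext (Category.id_comp _) hxy⟩
      rw [y.w, ← hi, Category.assoc, hxy']
  exact W.of_isPullback sq h

/-- Gluing along the target `T`. -/
theorem relRestrict_of_isPushout {S S' J H T T' : SSet.{v}} {h : H ⟶ J} {k : H ⟶ T'} {t : T' ⟶ T}
    {j : J ⟶ T} (sq : IsPushout k h t j) (i : S ⟶ J) (i' : S' ⟶ H) (a : S' ⟶ S)
    (w : a ≫ i = i' ≫ h) {X Y : SimplicialObject V} (f : X ⟶ Y)
    (hW : W (relRestrict i i' a h w f)) :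
    W (relRestrict (i ≫ j) (i' ≫ k) a t
      (by rw [Category.assoc, sq.w, ← Category.assoc, w, Category.assoc]) f) := by
  have w' : a ≫ i ≫ j = (i' ≫ k) ≫ t := by
    rw [Category.assoc, sq.w, ← Category.assoc, w, Category.assoc]
  have pb : IsPullback (relRestrict (i ≫ j) i (𝟙 S) j (by simp) f)
      (relRestrict (i ≫ j) (i' ≫ k) a t w' f) (relRestrict i i' a h w f)
      (relRestrict (i' ≫ k) i' (𝟙 S') k (by simp) f) := by
    refine isPullback_of_existsUnique ?_ ?_ ?_
    · ext A x
      change RelPoint (i ≫ j) f A at x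
      refine relMap_ext ?_ ?_
      · change a ≫ 𝟙 S ≫ x.fst = 𝟙 S' ≫ a ≫ x.fst
        simp
      · change h ≫ j ≫ x.snd = k ≫ t ≫ x.snd
        rw [← Category.assoc, ← sq.w, Category.assoc]
    · intro A (x : RelPoint (i ≫ j) f A) (y : RelPoint (i ≫ j) f A) h₁ h₂
      refine relMap_ext ?_ (sq.hom_ext (congr_arg RelPoint.snd h₂) (congr_arg RelPoint.snd h₁))
      have h₃ : 𝟙 S ≫ x.fst = 𝟙 S ≫ y.fst := (relMap_congr_fst h₁ :)
      simpa using h₃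
    · intro A (x : RelPoint i f A) (y : RelPoint (i' ≫ k) f A) hxy
      have h₁ : a ≫ x.fst = 𝟙 _ ≫ y.fst := congr_arg RelPoint.fst hxy
      have h₂ : h ≫ x.snd = k ≫ y.snd := congr_arg RelPoint.snd hxy
      rw [Category.id_comp] at h₁
      refine ⟨(⟨x.fst, sq.desc y.snd x.snd h₂.symm, ?_⟩ :
        RelPoint (i ≫ j) f A), relMap_ext (Category.id_comp _) (sq.inr_desc _ _ _),
        relMap_ext h₁ (sq.inl_desc _ _ _)⟩
      rw [x.w, Category.assoc, sq.inr_desc]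
  exact W.of_isPullback pb hW

/-- If `s` is a section of `p` and `p` has the extension property with respect to `S ∪ T' → T`, then
`Map(S → T, s) ⟶ Map(S' → T', s)` is controlled by the restriction along `T' → T`. -/
theorem relRestrict_of_section [W.IsMultiplicative] {S S' T T' R : SSet.{v}} {i : S ⟶ T}
    {i' : S' ⟶ T'} {a : S' ⟶ S} {b : T' ⟶ T} (w : a ≫ i = i' ≫ b) {jS : S ⟶ R} {jT : T' ⟶ R}
    (po : IsPushout i' a jT jS) (r : R ⟶ T) (hrS : jS ≫ r = i) (hrT : jT ≫ r = b)
    {X P : SimplicialObject V} {p : P ⟶ X} {s : X ⟶ P} (hs : s ≫ p = 𝟙 X)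
    (hp : W (toRelMap r p)) (hX : W (restrict b X)) :
    W (relRestrict i i' a b w s) := by
  have hs' := pointsMap_comp_app_of_section hs
  let pr : RelMap i' s ⟶ Map T' X := relSnd i' s ≫ mapMap T' p
  -- A point of `Q` is a point of Map(S' → T', s) together with an extension to `T` of its image in
  -- `X`; only the lift of this extension to `P` is missing.
  let Q := pullback (restrict b X) pr
  have hQ : W (pullback.snd (restrict b X) pr) :=
    W.of_isPullback (IsPullback.of_hasPullback _ _) hX
  let q₁ : ∀ A, Q.obj A → (T ⟶ (points X).obj A) :=
    fun A z ↦ (pullback.fst (restrict b X) pr).app A z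
  let q₂ : ∀ A, Q.obj A → RelPoint i' s A := fun A z ↦ (pullback.snd (restrict b X) pr).app A z
  have q₁_map : ∀ {A B} (h : A ⟶ B) (z : Q.obj A),
      q₁ B (Q.map h z) = q₁ A z ≫ (points X).map h := fun h z ↦
    ConcreteCategory.congr_hom ((pullback.fst (restrict b X) pr).naturality h) z
  have q₂_map : ∀ {A B} (h : A ⟶ B) (z : Q.obj A),
      (q₂ B (Q.map h z)).snd = (q₂ A z).snd ≫ (points P).map h := fun h z ↦
    congr_arg RelPoint.snd
      (ConcreteCategory.congr_hom ((pullback.snd (restrict b X) pr).naturality h) z)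
  have hQw : ∀ A (z : Q.obj A), b ≫ q₁ A z = (q₂ A z).snd ≫ (pointsMap p).app A := fun A z ↦
    ConcreteCategory.congr_hom (congr_app (pullback.condition (f := restrict b X) (g := pr)) A) z
  -- As `s` is a section of `p`, the component in `X` of a relative point is redundant: it is
  -- recovered by applying `p` to the component in `P`.
  have e : ∀ {A} {S T : SSet.{v}} {i : S ⟶ T} (z : RelPoint i s A),
      z.fst = i ≫ z.snd ≫ (pointsMap p).app A := by
    intro A S T i z
    rw [← Category.assoc, ← z.w, Category.assoc, hs', Category.comp_id]
  let c : RelMap i s ⟶ Q := pullback.lift (relSnd i s ≫ mapMap T p) (relRestrict i i' a b w s) (by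
    ext A x
    exact (Category.assoc _ _ _).symm)
  have hc : relRestrict i i' a b w s = c ≫ pullback.snd _ _ := (pullback.lift_snd _ _ _).symm
  have hglue : ∀ A (z : Q.obj A),
      i' ≫ (q₂ A z).snd = a ≫ (i ≫ q₁ A z) ≫ (pointsMap s).app A := by
    intro A z
    rw [← RelPoint.w, e (q₂ A z), ← hQw, ← Category.assoc i', ← w]
    simp
  -- The lift to `P` is prescribed on `T'` by the given point and on `S` by `s`; these agree on `S'`
  -- and define a lifting problem for `p` along `r`.
  let d : Q ⟶ RelMap r p :=
    { app A := ↾fun z ↦ (⟨po.desc (q₂ A z).snd ((i ≫ q₁ A z) ≫ (pointsMap s).app A) (hglue A z),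
        q₁ A z, by
          apply po.hom_ext
          · rw [po.inl_desc_assoc, reassoc_of% hrT, hQw]
          · rw [po.inr_desc_assoc, reassoc_of% hrS, Category.assoc, hs', Category.comp_id]⟩ :
            RelPoint r p A)
      naturality A B h := by
        refine ConcreteCategory.hom_ext _ _ fun z ↦ ?_
        refine relMap_ext (po.hom_ext (W := (points P).obj B) ?_ ?_) (q₁_map h z)
        · refine (po.inl_desc _ _ _).trans ((q₂_map h z).trans ?_)
          refine Eq.trans ?_ (Category.assoc _ _ _)
          exact congr_arg (· ≫ (points P).map h) (po.inl_desc _ _ _).symm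
        · refine (po.inr_desc _ _ _).trans ?_
          refine Eq.trans ?_ (Category.assoc _ _ _)
          refine Eq.trans ?_ (congr_arg (· ≫ (points P).map h) (po.inr_desc _ _ _).symm)
          change (i ≫ q₁ B (Q.map h z)) ≫ _ = _
          rw [q₁_map]
          simp }
  have c₁ : ∀ A (z : RelPoint i s A), q₁ A (c.app A z) = z.snd ≫ (pointsMap p).app A := fun A z ↦
    ConcreteCategory.congr_hom (congr_app (pullback.lift_fst (f := restrict b X) (g := pr)
      (relSnd i s ≫ mapMap T p) (relRestrict i i' a b w s) _) A) z
  have c₂ : ∀ A (z : RelPoint i s A), q₂ A (c.app A z) = (relRestrict i i' a b w s).app A z :=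
    fun A z ↦ ConcreteCategory.congr_hom (congr_app hc.symm A) z
  have sq : IsPullback (relSnd i s) c (toRelMap r p) d := by
    refine isPullback_of_existsUnique ?_ ?_ ?_
    · ext A x
      change RelPoint i s A at x
      refine relMap_ext (po.hom_ext (W := (points P).obj A) ?_ ?_) (c₁ A x).symm
      · refine Eq.trans ?_ (po.inl_desc _ _ _).symm
        refine Eq.trans ?_ (congr_arg RelPoint.snd (c₂ A x)).symm
        exact (Category.assoc _ _ _).symm.trans (congr_arg (· ≫ x.snd) hrT)
      · refine Eq.trans ?_ (po.inr_desc _ _ _).symm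
        change jS ≫ r ≫ x.snd = (i ≫ q₁ A (c.app A x)) ≫ _
        rw [c₁, ← e x, x.w, reassoc_of% hrS]
    · intro A (x : RelPoint i s A) (y : RelPoint i s A) h₁ h₂
      have h₁' : x.snd = y.snd := h₁
      refine relMap_ext ?_ h₁
      rw [e x, e y, h₁']
    · intro A (x : T ⟶ (points P).obj A) y hxy
      have h₁ : r ≫ x = po.desc _ _ (hglue A y) := congr_arg RelPoint.fst hxy
      have h₂ : x ≫ (pointsMap p).app A = q₁ A y := congr_arg RelPoint.snd hxy
      have h₃ : (i ≫ x ≫ (pointsMap p).app A) ≫ (pointsMap s).app A = i ≫ x := by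
        rw [h₂, ← po.inr_desc _ _ (hglue A y), ← h₁, reassoc_of% hrS]
      have h₄ : b ≫ x = (q₂ A y).snd := by
        rw [← po.inl_desc _ _ (hglue A y), ← h₁, reassoc_of% hrT]
      let z : RelPoint i s A := ⟨i ≫ x ≫ (pointsMap p).app A, x, h₃⟩
      refine ⟨z, rfl, ?_⟩
      have pb := (IsPullback.of_hasPullback (restrict b X) pr).map ((evaluation _ _).obj A)
      refine Types.ext_of_isPullback pb ((c₁ A z).trans h₂)
        ((c₂ A z).trans (relMap_ext (y := q₂ A y) ?_ h₄))
      change a ≫ i ≫ x ≫ (pointsMap p).app A = _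
      rw [e (q₂ A y), ← h₄, ← Category.assoc, w]
      simp
  rw [hc]
  exact W.comp_mem _ _ (W.of_isPullback sq hp) hQ

/-- The morphism `Map(S → T, s) ⟶ Map(S → T, q ∘ s)` induced by `q`. -/
def relPostcomp {S T : SSet.{v}} (i : S ⟶ T) {X P Y : SimplicialObject V} (s : X ⟶ P) (q : P ⟶ Y)
    (f : X ⟶ Y) (hf : f = s ≫ q) : RelMap i s ⟶ RelMap i f where
  app A := ↾fun (x : RelPoint i s A) ↦ (⟨x.fst, x.snd ≫ (pointsMap q).app A, by
    have : (pointsMap f).app A = (pointsMap s).app A ≫ (pointsMap q).app A := by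
      rw [hf, pointsMap_comp]; rfl
    rw [this, ← Category.assoc, x.w, Category.assoc]⟩ : RelPoint i f A)
  naturality A B h := by
    refine ConcreteCategory.hom_ext _ _ fun x ↦ ?_
    refine RelPoint.ext rfl ?_
    change (RelPoint.snd x ≫ (points P).map h) ≫ (pointsMap q).app B =
      (RelPoint.snd x ≫ (pointsMap q).app A) ≫ (points Y).map h
    rw [Category.assoc, Category.assoc, (pointsMap q).naturality]

/-- For a fixed point of Map(S → T, f), the lifts to Map(S → T, s) are the solutions in `P` of a
lifting problem for `q`, whose data on `S` come from `s`. The morphism is therefore a base change of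
`toRelMap i q`. -/
theorem relPostcomp_mem {S T : SSet.{v}} (i : S ⟶ T) {X P Y : SimplicialObject V} (s : X ⟶ P)
    (q : P ⟶ Y) (f : X ⟶ Y) (hf : f = s ≫ q) (hq : W (toRelMap i q)) :
    W (relPostcomp i s q f hf) := by
  let d : RelMap i f ⟶ RelMap i q :=
    { app A := ↾fun (x : RelPoint i f A) ↦ (⟨x.fst ≫ (pointsMap s).app A, x.snd, by
        have : (pointsMap f).app A = (pointsMap s).app A ≫ (pointsMap q).app A := by
          rw [hf, pointsMap_comp]; rfl
        rw [← x.w, this, Category.assoc]⟩ : RelPoint i q A)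
      naturality A B h := by
        refine ConcreteCategory.hom_ext _ _ fun x ↦ ?_
        refine RelPoint.ext ?_ rfl
        change (RelPoint.fst x ≫ (points X).map h) ≫ (pointsMap s).app B =
          (RelPoint.fst x ≫ (pointsMap s).app A) ≫ (points P).map h
        rw [Category.assoc, Category.assoc, (pointsMap s).naturality] }
  refine W.of_isPullback (f' := relSnd i s) (f := d) (g := toRelMap i q)
    (isPullback_of_existsUnique ?_ ?_ ?_) hq
  · ext A x
    exact relMap_ext (RelPoint.w x).symm rfl
  · intro A x y h₁ h₂
    have h₃ : RelPoint.fst ((relPostcomp i s q f hf).app A x) =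
      RelPoint.fst ((relPostcomp i s q f hf).app A y) := by rw [h₂]
    exact relMap_ext h₃ h₁
  · intro A (x : T ⟶ (points P).obj A) (y : RelPoint i f A) h
    have h₁ : i ≫ x = y.fst ≫ (pointsMap s).app A := congr_arg RelPoint.fst h
    have h₂ : x ≫ (pointsMap q).app A = y.snd := congr_arg RelPoint.snd h
    exact ⟨(⟨y.fst, x, h₁.symm⟩ : RelPoint i s A), rfl, relMap_ext rfl h₂⟩

theorem relPostcomp_relRestrict {S T S' T' : SSet.{v}} {i : S ⟶ T} {i' : S' ⟶ T'} {a : S' ⟶ S}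
    {b : T' ⟶ T} (w : a ≫ i = i' ≫ b) {X P Y : SimplicialObject V} (s : X ⟶ P) (q : P ⟶ Y)
    (f : X ⟶ Y) (hf : f = s ≫ q) :
    relPostcomp i s q f hf ≫ relRestrict i i' a b w f =
      relRestrict i i' a b w s ≫ relPostcomp i' s q f hf := by
  ext A x
  exact relMap_ext rfl (Category.assoc _ _ _).symm

theorem relRestrict_comp {S T S' T' S'' T'' : SSet.{v}} {i : S ⟶ T} {i' : S' ⟶ T'}
    {i'' : S'' ⟶ T''} {a : S' ⟶ S} {b : T' ⟶ T} {a' : S'' ⟶ S'} {b' : T'' ⟶ T'}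
    (w : a ≫ i = i' ≫ b) (w' : a' ≫ i' = i'' ≫ b') {X Y : SimplicialObject V} (f : X ⟶ Y) :
    relRestrict i i' a b w f ≫ relRestrict i' i'' a' b' w' f =
      relRestrict i i'' (a' ≫ a) (b' ≫ b) (by simp [w, reassoc_of% w']) f := by
  ext A x
  exact relMap_ext (Category.assoc _ _ _).symm (Category.assoc _ _ _).symm

theorem isIso_relRestrict {S T S' T' : SSet.{v}} {i : S ⟶ T} {i' : S' ⟶ T'} {a : S' ⟶ S}
    {b : T' ⟶ T} [IsIso a] [IsIso b] (w : a ≫ i = i' ≫ b) {X Y : SimplicialObject V} (f : X ⟶ Y) :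
    IsIso (relRestrict i i' a b w f) := by
  have w' : inv a ≫ i' = i ≫ inv b := by
    rw [IsIso.inv_comp_eq, ← Category.assoc, IsIso.eq_comp_inv, w]
  refine ⟨relRestrict i' i (inv a) (inv b) w' f, ?_, ?_⟩
  · ext A x
    change RelPoint i f A at x
    refine relMap_ext ?_ ?_
    · change inv a ≫ a ≫ x.fst = x.fst
      simp
    · change inv b ≫ b ≫ x.snd = x.snd
      simp
  · ext A x
    change RelPoint i' f A at x
    refine relMap_ext ?_ ?_
    · change a ≫ inv a ≫ x.fst = x.fst
      simp
    · change b ≫ inv b ≫ x.snd = x.snd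
      simp

theorem IsCover.of_iso {cov : MorphismProperty V} {F G F' G' : Vᵒᵖ ⥤ Type v} {α : F ⟶ G}
    {α' : F' ⟶ G'} (h : IsCover cov α) (e : F ⟶ F') (e' : G ⟶ G') [IsIso e] [IsIso e']
    (w : e ≫ α' = α ≫ e') : IsCover cov α' := by
  obtain ⟨A, B, eA, eB, p, hp, h⟩ := h
  exact ⟨A, B, eA ≪≫ asIso e, eB ≪≫ asIso e', p, hp, by simp [w, reassoc_of% h]⟩

end MappingSpaces

end DescentCat

namespace DescentCat

open Limits

/-! ### Attaching simplices along boundaries -/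

section Cells

variable {U : SSet.{v}}

/-- Gluing the source of `x : B ⟶ U` to a subcomplex `A` of `U` along the part `Λ` of `B` which is
mapped to `A`. -/
theorem isPushout_attach {B : SSet.{v}} (A C : U.Subcomplex) (x : B ⟶ U) (Λ : B.Subcomplex)
    (hΛ : A.preimage x = Λ)
    (hx : ∀ n (s t : B.obj n), s ∉ Λ.obj n → x.app n s = x.app n t → s = t)
    (hC : A ⊔ SSet.Subcomplex.range x = C) :
    IsPushout (SSet.Subcomplex.lift (B := A) (Λ.ι ≫ x) (by
        subst hΛ; rintro n _ ⟨s, rfl⟩; exact s.2)) Λ.ι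
      (SSet.Subcomplex.homOfLE (hC ▸ le_sup_left))
      (SSet.Subcomplex.lift x (hC ▸ le_sup_right)) := by
  subst hΛ hC
  refine IsPushout.of_forall_isPushout_app fun n ↦ ?_
  have hmono : Mono ((SSet.Subcomplex.homOfLE
      (le_sup_left : A ≤ A ⊔ SSet.Subcomplex.range x)).app n) :=
    inferInstance
  refine Types.isPushout_of_isPullback_of_mono' ((Types.isPullback_iff _ _ _ _).2 ⟨?_, ?_, ?_⟩)
    ?_ ?_
  · rfl
  · rintro s t ⟨-, h⟩
    exact Subtype.ext h
  · rintro ⟨s, hs⟩ t h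
    have h' : s = x.app n t := congr_arg Subtype.val h
    subst h'
    exact ⟨⟨t, hs⟩, rfl, rfl⟩
  · refine Set.eq_univ_iff_forall.2 ?_
    rintro ⟨s, hs | ⟨t, rfl⟩⟩
    · exact Or.inl ⟨⟨s, hs⟩, rfl⟩
    · exact Or.inr ⟨t, rfl⟩
  · intro s t hs _ h
    exact hx n s t (fun h' ↦ hs ⟨⟨s, h'⟩, rfl⟩) (congr_arg Subtype.val h)

/-- The part of a nondegenerate simplex `x` lying in a subcomplex `A` which contains its faces but
not `x` itself is the boundary. -/
theorem preimage_eq_boundary (A : U.Subcomplex) {n : ℕ} (x : U _⦋n⦌) (hxA : x ∉ A.obj (op ⦋n⦌))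
    (h : SSet.boundary n ≤ A.preimage (SSet.yonedaEquiv.symm x)) :
    A.preimage (SSet.yonedaEquiv.symm x) = SSet.boundary n := by
  refine le_antisymm ?_ h
  rintro m s hs hsurj
  -- A simplex of Δ^n off the boundary is a split epimorphism; restricting its image along a section
  -- would put `x` itself in `A`.
  have hepi : Epi (SSet.stdSimplex.objEquiv s) := SimplexCategory.epi_iff_surjective.2 hsurj
  have := isSplitEpi_of_epi (SSet.stdSimplex.objEquiv s)
  have hs' : U.map (SSet.stdSimplex.objEquiv s).op x ∈ A.obj m := hs
  refine hxA ?_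
  have : U.map (section_ (SSet.stdSimplex.objEquiv s)).op
      (U.map (SSet.stdSimplex.objEquiv s).op x) ∈ A.obj (op ⦋n⦌) := A.map _ hs'
  rwa [← Functor.map_comp_apply, ← op_comp, IsSplitEpi.id, op_id, Functor.map_id_apply] at this

/-- A simplex off the boundary is an epimorphism, so this is the uniqueness part of the
Eilenberg–Zilber lemma. -/
theorem injective_off_boundary {n : ℕ} (x : U _⦋n⦌) (hx : x ∈ U.nonDegenerate n)
    (m : SimplexCategoryᵒᵖ) (s t : (Δ[n] : SSet.{v}).obj m)
    (hs : s ∉ (SSet.boundary n).obj m)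
    (h : (SSet.yonedaEquiv.symm x).app m s = (SSet.yonedaEquiv.symm x).app m t) : s = t := by
  have hepi : Epi (SSet.stdSimplex.objEquiv s) :=
    SimplexCategory.epi_iff_surjective.2 (not_not.1 hs)
  apply SSet.stdSimplex.objEquiv.injective
  obtain ⟨m⟩ := m
  induction m using SimplexCategory.rec with | _ m
  exact SSet.unique_nonDegenerate_map (X := U) (x := U.map (SSet.stdSimplex.objEquiv s).op x)
    _ ⟨x, hx⟩ rfl _ ⟨x, hx⟩ h

theorem isPushout_boundary (A : U.Subcomplex) {n : ℕ} (x : U _⦋n⦌) (hx : x ∈ U.nonDegenerate n)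
    (hA : A.preimage (SSet.yonedaEquiv.symm x) = SSet.boundary n) :
    IsPushout (SSet.Subcomplex.lift (B := A) ((SSet.boundary n).ι ≫ SSet.yonedaEquiv.symm x) (by
        rw [← hA]; rintro n _ ⟨s, rfl⟩; exact s.2)) (SSet.boundary n).ι
      (SSet.Subcomplex.homOfLE (le_sup_left : A ≤ A ⊔ SSet.Subcomplex.ofSimplex x))
      (SSet.Subcomplex.lift (SSet.yonedaEquiv.symm x)
        (by rw [SSet.Subcomplex.range_eq_ofSimplex, Equiv.apply_symm_apply]; exact le_sup_right)) :=
  isPushout_attach A _ _ _ hA (injective_off_boundary x hx)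
    (by rw [SSet.Subcomplex.range_eq_ofSimplex, Equiv.apply_symm_apply])

/-- Induction on the attachment of simplices of dimension `< N` along their boundaries. -/
theorem attach_induction (P : U.Subcomplex → Prop) (N : ℕ)
    (step : ∀ (A : U.Subcomplex) (n : ℕ) (x : U _⦋n⦌), n < N → P A → x ∈ U.nonDegenerate n →
      x ∉ A.obj (op ⦋n⦌) → A.preimage (SSet.yonedaEquiv.symm x) = SSet.boundary n →
      P (A ⊔ SSet.Subcomplex.ofSimplex x)) (n : ℕ) (hn : n < N) (x : U _⦋n⦌)
    (A : U.Subcomplex) (hA : P A) : P (A ⊔ SSet.Subcomplex.ofSimplex x) := by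
  induction n using Nat.strong_induction_on generalizing A with
  | _ n ih =>
  by_cases hxd : x ∈ U.nonDegenerate n
  swap
  · rw [← SSet.mem_degenerate_iff_notMem_nonDegenerate, SSet.mem_degenerate_iff] at hxd
    obtain ⟨m, hm, θ, hθ, y, rfl⟩ := hxd
    rw [SSet.Subcomplex.ofSimplex_map_of_epi]
    exact ih m hm (hm.trans hn) y A hA
  -- By induction on dimension all faces of `x` can be attached first. Then either `x` is already
  -- present or it is attached along its whole boundary.
  have key : ∃ B : U.Subcomplex, A ≤ B ∧ B ≤ A ⊔ SSet.Subcomplex.ofSimplex x ∧ P B ∧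
      SSet.boundary n ≤ B.preimage (SSet.yonedaEquiv.symm x) := by
    obtain _ | n := n
    · exact ⟨A, le_rfl, le_sup_left, hA, by simp⟩
    · have : ∀ s : Finset (Fin (n + 2)),
          P (A ⊔ s.sup (fun i ↦ SSet.Subcomplex.ofSimplex (U.δ i x))) := by
        intro s
        induction s using Finset.induction with
        | empty => simpa using hA
        | insert a s _ hs =>
          rw [Finset.sup_insert, sup_comm (SSet.Subcomplex.ofSimplex _), ← sup_assoc]
          exact ih n (Nat.lt_succ_self n) ((Nat.lt_succ_self n).trans hn) _ _ hs
      refine ⟨_, le_sup_left, sup_le le_sup_left ?_, this Finset.univ, ?_⟩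
      · refine Finset.sup_le fun i _ ↦ le_trans ?_ le_sup_right
        exact SSet.Subcomplex.ofSimplex_map_le _ _
      · rw [SSet.boundary_eq_iSup, iSup_le_iff]
        intro i
        rw [SSet.stdSimplex.face_singleton_compl, SSet.Subcomplex.ofSimplex_le_iff]
        refine (le_sup_right : _ ≤ A ⊔ _) _ ?_
        have := Finset.le_sup (f := fun i ↦ SSet.Subcomplex.ofSimplex (U.δ i x))
          (Finset.mem_univ i)
        exact this _ (SSet.Subcomplex.mem_ofSimplex_obj _)
  obtain ⟨B, hAB, hBx, hB, hbd⟩ := key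
  have e : A ⊔ SSet.Subcomplex.ofSimplex x = B ⊔ SSet.Subcomplex.ofSimplex x :=
    le_antisymm (sup_le_sup_right hAB _) (sup_le hBx le_sup_right)
  rw [e]
  by_cases hxB : x ∈ B.obj (op ⦋n⦌)
  · rwa [sup_eq_left.2 ((SSet.Subcomplex.ofSimplex_le_iff _ _).2 hxB)]
  · exact step B n x hn hB hxd hxB (preimage_eq_boundary B x hxB hbd)

/-- `attach_induction` for the skeleton of a simplicial set with finitely many simplices in every
degree. -/
theorem skeleton_induction [∀ n, Finite (U.obj n)] (P : U.Subcomplex → Prop) (N : ℕ)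
    (step : ∀ (A : U.Subcomplex) (n : ℕ) (x : U _⦋n⦌), n < N → P A → x ∈ U.nonDegenerate n →
      x ∉ A.obj (op ⦋n⦌) → A.preimage (SSet.yonedaEquiv.symm x) = SSet.boundary n →
      P (A ⊔ SSet.Subcomplex.ofSimplex x)) (A : U.Subcomplex) (hA : P A) :
    P (A ⊔ U.skeleton N) := by
  classical
  have : Fintype (Σ n : Fin N, U.nonDegenerate n.1) := Fintype.ofFinite _
  have h : ∀ s : Finset (Σ n : Fin N, U.nonDegenerate n.1),
      P (A ⊔ s.sup (fun x ↦ SSet.Subcomplex.ofSimplex x.2.1)) := by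
    intro s
    induction s using Finset.induction with
    | empty => simpa using hA
    | insert a s _ hs =>
      rw [Finset.sup_insert, sup_comm (SSet.Subcomplex.ofSimplex _), ← sup_assoc]
      exact attach_induction P N step _ a.1.2 _ _ hs
  have e : U.skeleton N = Finset.univ.sup
      (fun x : (Σ n : Fin N, U.nonDegenerate n.1) ↦ SSet.Subcomplex.ofSimplex x.2.1) := by
    apply le_antisymm
    · change (⨆ (i : Fin N) (x : U.nonDegenerate i), SSet.Subcomplex.ofSimplex x.1) ≤ _
      simp only [iSup_le_iff]
      intro i x
      exact Finset.le_sup (f := fun x : (Σ n : Fin N, U.nonDegenerate n.1) ↦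
        SSet.Subcomplex.ofSimplex x.2.1) (Finset.mem_univ ⟨i, x⟩)
    · exact Finset.sup_le fun x _ ↦ U.ofSimplex_le_skeleton _ x.1.2
  rw [e]
  exact h _

end Cells

/-! ### Unique inner fillers and coskeletality -/

section Coskeletal

variable {Z : SSet.{v}} {k : ℕ}

/-- `Z` has unique fillers for inner horns of dimension `> k`. -/
def UniqueInnerFillers (k : ℕ) (Z : SSet.{v}) : Prop :=
  ∀ (n : ℕ) (i : Fin (n + 1)), 0 < i → i < Fin.last n → k < n →
    Function.Bijective (fun g : Δ[n] ⟶ Z ↦ (SSet.horn n i).ι ≫ g)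

/-- Since n > k > 0 gives n ≥ 2, the boundary contains the inner horn at vertex 1, which already
determines the filler. -/
theorem UniqueInnerFillers.boundary_injective (hZ : UniqueInnerFillers k Z) (hk : 0 < k) {n : ℕ}
    (hn : k < n) {g g' : Δ[n] ⟶ Z} (h : (SSet.boundary n).ι ≫ g = (SSet.boundary n).ι ≫ g') :
    g = g' := by
  obtain ⟨n, rfl⟩ : ∃ m, n = m + 2 := ⟨n - 2, by omega⟩
  refine (hZ (n + 2) 1 (by simp) (by simp [Fin.lt_def]) hn).1 ?_
  have hle : SSet.horn.{v} (n + 2) 1 ≤ SSet.boundary (n + 2) := by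
    rw [SSet.horn_eq_iSup, iSup_le_iff]
    exact fun i ↦ SSet.face_singleton_compl_le_boundary _
  change SSet.Subcomplex.homOfLE hle ≫ (SSet.boundary (n + 2)).ι ≫ g =
    SSet.Subcomplex.homOfLE hle ≫ (SSet.boundary (n + 2)).ι ≫ g'
  rw [h]

/-- Fill the inner horn at vertex 1. The filler agrees with `b` on the remaining face because it
does on the boundary of that face; uniqueness is needed in dimension n - 1 > k, whence the bound k +
1 < n. -/
theorem UniqueInnerFillers.boundary_surjective (hZ : UniqueInnerFillers k Z) (hk : 0 < k) {n : ℕ}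
    (hn : k + 1 < n) (b : (SSet.boundary n : SSet.{v}) ⟶ Z) :
    ∃ g : Δ[n] ⟶ Z, (SSet.boundary n).ι ≫ g = b := by
  obtain ⟨n, rfl⟩ : ∃ m, n = m + 3 := ⟨n - 3, by omega⟩
  have hle : SSet.horn.{v} (n + 3) 1 ≤ SSet.boundary (n + 3) := by
    rw [SSet.horn_eq_iSup, iSup_le_iff]
    exact fun i ↦ SSet.face_singleton_compl_le_boundary _
  obtain ⟨g, hg⟩ := (hZ (n + 3) 1 (by simp) (by simp [Fin.lt_def]) (by omega)).2
    (SSet.Subcomplex.homOfLE hle ≫ b)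
  have hg' : ∀ d (s : (Δ[n + 3] : SSet.{v}).obj d) (hs : s ∈ (SSet.horn (n + 3) 1).obj d),
      g.app d s = b.app d ⟨s, hle _ hs⟩ := fun d s hs ↦
    ConcreteCategory.congr_hom (congr_app hg d) ⟨s, hs⟩
  refine ⟨g, SSet.boundary.hom_ext fun j ↦ ?_⟩
  refine hZ.boundary_injective hk (show k < n + 2 by omega) ?_
  ext d s
  refine hg' d _ ?_
  obtain ⟨d⟩ := d
  induction d using SimplexCategory.rec with | _ d
  obtain ⟨i, hi⟩ := (SSet.mem_boundary_iff_notMem_range s.1).1 s.2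
  rw [SSet.mem_horn_iff_notMem_range]
  -- A proper face of the face opposite 1 omits a second vertex too, and therefore lies in the horn.
  by_cases hj : j = 1
  · subst hj
    refine ⟨Fin.succAbove 1 i, Fin.succAbove_ne _ _, ?_⟩
    rintro ⟨a, ha⟩
    exact hi ⟨a, Fin.succAbove_right_injective ha⟩
  · refine ⟨j, hj, ?_⟩
    rintro ⟨a, ha⟩
    exact Fin.succAbove_ne _ _ ha

variable {U : SSet.{v}}

/-- The skeleton of index k + 1 contains the simplices of dimension ≤ k. In higher dimensions a
simplex of `Z` is determined by its boundary, so induction on dimension applies. -/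
theorem UniqueInnerFillers.hom_ext (hZ : UniqueInnerFillers k Z) (hk : 0 < k) {A B : U.Subcomplex}
    (hAB : A ≤ B) (hA : U.skeleton (k + 1) ≤ A) {g g' : (B : SSet.{v}) ⟶ Z}
    (h : SSet.Subcomplex.homOfLE hAB ≫ g = SSet.Subcomplex.homOfLE hAB ≫ g') : g = g' := by
  have key : ∀ (n : ℕ) (x : (B : SSet.{v}) _⦋n⦌), g.app _ x = g'.app _ x := by
    intro n
    induction n with
    | zero =>
      intro x
      exact ConcreteCategory.congr_hom (congr_app h _) ⟨x.1, hA _ (U.mem_skeleton x.1)⟩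
    | succ n ih =>
      intro x
      by_cases hn : n + 1 < k + 1
      · exact ConcreteCategory.congr_hom (congr_app h _) ⟨x.1, hA _ (U.mem_skeleton x.1)⟩
      · have : SSet.yonedaEquiv.symm x ≫ g = SSet.yonedaEquiv.symm x ≫ g' := by
          refine hZ.boundary_injective hk (by omega) (SSet.boundary.hom_ext fun j ↦ ?_)
          apply SSet.yonedaEquiv.injective
          exact ih ((B : SSet.{v}).δ j x)
        simpa using congr_arg SSet.yonedaEquiv this
  ext n x
  obtain ⟨n⟩ := n
  induction n using SimplexCategory.rec with | _ n
  exact key n x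

theorem UniqueInnerFillers.exists_extension (hZ : UniqueInnerFillers k Z) (hk : 0 < k)
    (A : U.Subcomplex) (hA : U.skeleton (k + 2) ≤ A) (g : (A : SSet.{v}) ⟶ Z) :
    ∃ g' : U ⟶ Z, A.ι ≫ g' = g := by
  -- Extensions are built over `A` and one simplex at a time: every new cell has dimension > k + 1,
  -- where boundaries have fillers.
  let P (B : U.Subcomplex) : Prop := ∃ (h : A ≤ B) (g' : (B : SSet.{v}) ⟶ Z),
    SSet.Subcomplex.homOfLE h ≫ g' = g
  have hP : ∀ (n : ℕ) (x : U _⦋n⦌), P (A ⊔ SSet.Subcomplex.ofSimplex x) := by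
    intro n x
    refine attach_induction P (n + 1) ?_ n (Nat.lt_succ_self n) x A ⟨le_rfl, g, rfl⟩
    rintro B m y - ⟨hB, g', hg'⟩ hy hyB hpre
    have hm : k + 1 < m := by
      by_contra! hm
      exact hyB (hB _ (hA _ (U.mem_skeleton y (by omega))))
    have po := isPushout_boundary B y hy hpre
    obtain ⟨l, hl⟩ := hZ.boundary_surjective hk hm (SSet.Subcomplex.lift (B := B)
      ((SSet.boundary m).ι ≫ SSet.yonedaEquiv.symm y) (by
        rw [← hpre]; rintro n _ ⟨s, rfl⟩; exact s.2) ≫ g')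
    refine ⟨hB.trans le_sup_left, po.desc g' l hl.symm, ?_⟩
    exact (congr_arg (SSet.Subcomplex.homOfLE hB ≫ ·) (po.inl_desc g' l hl.symm)).trans hg'
  have hA' : U.skeleton (k + 1) ≤ A := (U.skeleton.monotone (by omega)).trans hA
  have hP' : ∀ (n : SimplexCategoryᵒᵖ) (x : U.obj n), P (A ⊔ Subfunctor.ofSection x) := by
    rintro ⟨n⟩ x
    induction n using SimplexCategory.rec with | _ n
    exact hP n x
  -- Uniqueness of extensions makes the choices for different simplices compatible, so they glue
  -- with no finiteness assumption on `U`.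
  choose h e he using hP'
  refine ⟨{ app n := ↾fun x ↦ (e n x).app n ⟨x, Or.inr (Subfunctor.mem_ofSection_obj x)⟩,
            naturality := ?_ }, ?_⟩
  · intro n m θ
    refine ConcreteCategory.hom_ext _ _ fun x ↦ ?_
    have hle : A ⊔ Subfunctor.ofSection (U.map θ x) ≤ A ⊔ Subfunctor.ofSection x :=
      sup_le_sup_left (by
        rw [Subfunctor.ofSection_le_iff]
        exact (Subfunctor.ofSection x).map θ (Subfunctor.mem_ofSection_obj x)) _
    have := hZ.hom_ext hk (h _ _) hA' (g := SSet.Subcomplex.homOfLE hle ≫ e n x)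
      (g' := e m (U.map θ x)) ((he n x).trans (he m _).symm)
    change (e m (U.map θ x)).app m _ = Z.map θ ((e n x).app n _)
    refine (ConcreteCategory.congr_hom (congr_app this.symm m) _).trans ?_
    exact ConcreteCategory.congr_hom ((e n x).naturality θ)
      ⟨x, Or.inr (Subfunctor.mem_ofSection_obj x)⟩
  · ext n x
    exact ConcreteCategory.congr_hom (congr_app (he n x.1) n) x

theorem UniqueInnerFillers.bijective (hZ : UniqueInnerFillers k Z) (hk : 0 < k)
    (A : U.Subcomplex) (hA : U.skeleton (k + 2) ≤ A) :
    Function.Bijective (fun g : U ⟶ Z ↦ A.ι ≫ g) := by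
  refine ⟨fun g g' h ↦ ?_, hZ.exists_extension hk A hA⟩
  have := hZ.hom_ext hk (le_top : A ≤ ⊤) ((U.skeleton.monotone (by omega)).trans hA)
    (g := (⊤ : U.Subcomplex).ι ≫ g) (g' := (⊤ : U.Subcomplex).ι ≫ g') h
  rwa [← cancel_epi (SSet.Subcomplex.topIso U).hom]

end Coskeletal

end DescentCat

namespace DescentCat

open Limits

/-! ### Iterated filling of inner horns -/

section InnerExtensions

variable {U : SSet.{v}}

/-- `B` is obtained from `A` by filling an inner horn of dimension at least `d`. -/
def InnerStep (d : ℕ) (A B : U.Subcomplex) : Prop :=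
  ∃ (m : ℕ) (i : Fin (m + 1)) (x : Δ[m] ⟶ U), d ≤ m ∧ 0 < i ∧ i < Fin.last m ∧
    A.preimage x = SSet.horn m i ∧
    (∀ n (s t : (Δ[m] : SSet.{v}).obj n), s ∉ (SSet.horn m i).obj n → x.app n s = x.app n t →
      s = t) ∧ A ⊔ SSet.Subcomplex.range x = B

/-- `B` is obtained from `A` by successively filling inner horns of dimension at least `d`. -/
def InnerExt (d : ℕ) : U.Subcomplex → U.Subcomplex → Prop :=
  Relation.ReflTransGen (InnerStep d)

theorem InnerStep.le {d : ℕ} {A B : U.Subcomplex} (h : InnerStep d A B) : A ≤ B := by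
  obtain ⟨m, i, x, -, -, -, -, -, rfl⟩ := h
  exact le_sup_left

theorem InnerExt.le {d : ℕ} {A B : U.Subcomplex} (h : InnerExt d A B) : A ≤ B := by
  induction h with
  | refl => exact le_rfl
  | tail _ h ih => exact ih.trans h.le

variable {V : Type u} [Category.{v} V] {k d : ℕ} {X Y : SimplicialObject V}
  (W : MorphismProperty (Vᵒᵖ ⥤ Type v)) [W.IsStableUnderBaseChange]

theorem InnerStep.restrict_mem (hW : ∀ (m : ℕ) (i : Fin (m + 1)), d ≤ m → 0 < i → i < Fin.last m →
    W (restrict (SSet.horn.{v} m i).ι Y)) {A B : U.Subcomplex} (h : InnerStep d A B) :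
    W (restrict (SSet.Subcomplex.homOfLE h.le) Y) := by
  obtain ⟨m, i, x, hm, hi, hi', hpre, hinj, rfl⟩ := h
  exact restrict_of_isPushout W (isPushout_attach A _ x _ hpre hinj rfl) (hW m i hm hi hi')

variable [W.IsMultiplicative]

theorem InnerExt.restrict_mem (hW : ∀ (m : ℕ) (i : Fin (m + 1)), d ≤ m → 0 < i → i < Fin.last m →
    W (restrict (SSet.horn.{v} m i).ι Y)) {A B : U.Subcomplex} (h : InnerExt d A B) :
    W (restrict (SSet.Subcomplex.homOfLE h.le) Y) := by
  induction h with
  | refl =>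
    have := isIso_restrict (𝟙 (A : SSet.{v})) Y
    exact MorphismProperty.of_isIso W (restrict (𝟙 (A : SSet.{v})) Y)
  | @tail B C h₁ h₂ ih =>
    have := W.comp_mem _ _ (h₂.restrict_mem W hW) ih
    rwa [← restrict_comp] at this

theorem uniqueInnerFillers_points (hY : ∀ (n : ℕ) (i : Fin (n + 1)), 0 < i → i < Fin.last n →
    k < n → IsIso (restrict (SSet.horn.{v} n i).ι Y)) (A : Vᵒᵖ) :
    UniqueInnerFillers k ((points Y).obj A) := fun n i h h' hn ↦
  have := hY n i h h' hn
  bijective_of_isIso (restrict (SSet.horn.{v} n i).ι Y) A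

variable (hk : 0 < k) (hY : ∀ (n : ℕ) (i : Fin (n + 1)), 0 < i → i < Fin.last n →
    k < n → IsIso (restrict (SSet.horn.{v} n i).ι Y))

include hk hY

theorem isIso_restrict_of_skeleton_le (A : U.Subcomplex) (hA : U.skeleton (k + 2) ≤ A) :
    IsIso (restrict A.ι Y) :=
  isIso_of_bijective _ fun _ ↦ (uniqueInnerFillers_points hY _).bijective hk A hA

theorem isIso_restrict_homOfLE {A B : U.Subcomplex} (h : A ≤ B)
    (hA : B ⊓ U.skeleton (k + 2) ≤ A) : IsIso (restrict (SSet.Subcomplex.homOfLE h) Y) := by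
  -- Coskeletality is applied with `B` itself as the ambient simplicial set.
  have e : SSet.Subcomplex.homOfLE h = SSet.Subcomplex.toRange (SSet.Subcomplex.homOfLE h) ≫
    (SSet.Subcomplex.range (SSet.Subcomplex.homOfLE h)).ι := rfl
  have : IsIso (SSet.Subcomplex.toRange (SSet.Subcomplex.homOfLE h)) :=
    isIso_of_mono_of_epi _
  have := isIso_restrict_of_skeleton_le hk hY (SSet.Subcomplex.range (SSet.Subcomplex.homOfLE h))
    (by
      change (⨆ (i : Fin (k + 2)) (x : (B : SSet.{v}).nonDegenerate i),
        SSet.Subcomplex.ofSimplex x.1) ≤ _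
      simp only [iSup_le_iff, SSet.Subcomplex.ofSimplex_le_iff]
      rintro i ⟨x, -⟩
      exact ⟨⟨x.1, hA _ ⟨x.2, U.mem_skeleton x.1⟩⟩, rfl⟩)
  rw [e, restrict_comp]
  infer_instance

/-- Finitely many horns suffice: the simplices of `B` not reached by `B'` have dimension at least k
+ 2, and adjoining them does not change the mapping space. -/
theorem restrict_mem_of_innerExt
    (hW : ∀ (m : ℕ) (i : Fin (m + 1)), d ≤ m → 0 < i → i < Fin.last m →
      W (restrict (SSet.horn.{v} m i).ι Y)) {A B : U.Subcomplex} (hAB : A ≤ B)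
    (h : ∃ B' : U.Subcomplex, InnerExt d A B' ∧ B' ≤ B ∧ B ⊓ U.skeleton (k + 2) ≤ B') :
    W (restrict (SSet.Subcomplex.homOfLE hAB) Y) := by
  obtain ⟨B', h₁, h₂, h₃⟩ := h
  have := isIso_restrict_homOfLE hk hY h₂ h₃
  have := W.comp_mem _ _ (MorphismProperty.of_isIso W
    (restrict (SSet.Subcomplex.homOfLE h₂) Y)) (h₁.restrict_mem W hW)
  rwa [← restrict_comp] at this

end InnerExtensions

theorem skeleton_stdSimplex (n : ℕ) :
    (Δ[n] : SSet.{v}).skeleton n = SSet.boundary n := by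
  apply le_antisymm
  · change (⨆ (i : Fin n) (x : (Δ[n] : SSet.{v}).nonDegenerate i),
      SSet.Subcomplex.ofSimplex x.1) ≤ _
    simp only [iSup_le_iff, SSet.Subcomplex.ofSimplex_le_iff]
    rintro i ⟨x, -⟩
    rw [SSet.boundary_obj_eq_univ i n i.2]
    trivial
  · obtain _ | n := n
    · rw [SSet.boundary_zero]
      exact bot_le
    · rw [SSet.boundary_eq_iSup, iSup_le_iff]
      intro i
      rw [SSet.stdSimplex.face_singleton_compl, SSet.Subcomplex.ofSimplex_le_iff]
      exact SSet.mem_skeleton _ _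

theorem skeleton_succ_stdSimplex (n : ℕ) : (Δ[n] : SSet.{v}).skeleton (n + 1) = ⊤ := by
  rw [eq_top_iff, ← SSet.stdSimplex.ofSimplex_objEquiv_symm_id, SSet.Subcomplex.ofSimplex_le_iff]
  exact SSet.mem_skeleton _ _

/-! ### Representability of mapping spaces -/

section Representability

variable {V : Type u} [Category.{v} V]

theorem isRepresentable_map_bot [HasTerminal V] (U : SSet.{v}) (Y : SimplicialObject V) :
    (Map ((⊥ : U.Subcomplex) : SSet.{v}) Y).IsRepresentable := by
  let α : Map ((⊥ : U.Subcomplex) : SSet.{v}) Y ⟶ yoneda.obj (⊤_ V) :=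
    { app A := ↾fun _ ↦ terminal.from A.unop
      naturality A B h := by
        refine ConcreteCategory.hom_ext _ _ fun _ ↦ ?_
        exact Subsingleton.elim (α := (B.unop ⟶ ⊤_ V)) _ _ }
  have : IsIso α := by
    refine isIso_of_bijective α fun A ↦ ⟨?_, ?_⟩
    · intro (x : ((⊥ : U.Subcomplex) : SSet.{v}) ⟶ (points Y).obj A)
        (y : ((⊥ : U.Subcomplex) : SSet.{v}) ⟶ (points Y).obj A) _
      exact NatTrans.ext (funext fun n ↦ ConcreteCategory.hom_ext _ _ fun s ↦ s.2.elim)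
    · intro y
      refine ⟨({ app n := ↾fun s ↦ s.2.elim
                 naturality n m θ := ConcreteCategory.hom_ext _ _ fun s ↦ s.2.elim } :
          ((⊥ : U.Subcomplex) : SSet.{v}) ⟶ (points Y).obj A), ?_⟩
      exact Subsingleton.elim (α := (A.unop ⟶ ⊤_ V)) _ _
  exact isRepresentable_of_isIso α (.mk' (Iso.refl _))

/-- `Map(Δ^n, Y)` is represented by `Y_n`. -/
def mapStdSimplexIso (n : SimplexCategory) (Y : SimplicialObject V) :
    Map (SSet.stdSimplex.{v}.obj n) Y ≅ yoneda.obj (Y.obj (op n)) :=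
  NatIso.ofComponents (fun A ↦ Equiv.toIso (SSet.yonedaEquiv (X := (points Y).obj A)))
    (fun {A B} h ↦ by
      refine ConcreteCategory.hom_ext _ _ fun x ↦ ?_
      rfl)

variable {k : ℕ} {Y : SimplicialObject V}

theorem isRepresentable_map_sup [HasPullbacks V] {U : SSet.{v}} {A : U.Subcomplex} {n : ℕ}
    {x : U _⦋n⦌} (hx : x ∈ U.nonDegenerate n)
    (hA : A.preimage (SSet.yonedaEquiv.symm x) = SSet.boundary n)
    (h₁ : (Map (SSet.boundary.{v} n : SSet.{v}) Y).IsRepresentable)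
    (h₂ : (Map (A : SSet.{v}) Y).IsRepresentable) :
    (Map ((A ⊔ SSet.Subcomplex.ofSimplex x : U.Subcomplex) : SSet.{v}) Y).IsRepresentable :=
  isRepresentable_of_isPullback (isPullback_restrict (isPushout_boundary A x hx hA) Y)
    (.mk' (mapStdSimplexIso _ Y).symm) h₂ h₁

variable [HasPullbacks V] [HasTerminal V]

theorem isRepresentable_map_boundary (Y : SimplicialObject V) (n : ℕ) :
    (Map (SSet.boundary.{v} n : SSet.{v}) Y).IsRepresentable := by
  induction n using Nat.strong_induction_on with
  | _ n ih =>
  have := skeleton_induction (U := Δ[n]) (fun A ↦ (Map (A : SSet.{v}) Y).IsRepresentable) n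
    (fun A m x hm hA hx _ hpre ↦ isRepresentable_map_sup hx hpre (ih m hm) hA) ⊥
    (isRepresentable_map_bot _ Y)
  rwa [bot_sup_eq, skeleton_stdSimplex] at this

/-- A skeleton of a degreewise finite simplicial set is built from finitely many cells, each giving
a fibre product of representables; coskeletality passes from the skeleton to all of `T`. -/
theorem isRepresentable_map (hk : 0 < k)
    (hY : ∀ (n : ℕ) (i : Fin (n + 1)), 0 < i → i < Fin.last n →
      k < n → IsIso (restrict (SSet.horn.{v} n i).ι Y)) (T : SSet.{v}) [∀ n, Finite (T.obj n)] :
    (Map T Y).IsRepresentable := by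
  have := skeleton_induction (U := T) (fun A ↦ (Map (A : SSet.{v}) Y).IsRepresentable) (k + 2)
    (fun A m x _ hA hx _ hpre ↦ isRepresentable_map_sup hx hpre
      (isRepresentable_map_boundary Y m) hA) ⊥ (isRepresentable_map_bot _ Y)
  rw [bot_sup_eq] at this
  have := isIso_restrict_of_skeleton_le hk hY (T.skeleton (k + 2)) le_rfl
  exact isRepresentable_of_isIso (restrict (T.skeleton (k + 2)).ι Y) ‹_›

end Representability

/-! ### Lifting along hypercovers -/

section Hypercovers

variable {V : Type u} [Category.{v} V] {k d : ℕ} {P X : SimplicialObject V} {p : P ⟶ X}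
  (W : MorphismProperty (Vᵒᵖ ⥤ Type v)) [W.IsStableUnderBaseChange] [W.IsMultiplicative]

theorem toRelMap_mem_of_isIso {S T : SSet.{v}} (i : S ⟶ T) (hP : IsIso (restrict i P))
    (hX : IsIso (restrict i X)) : W (toRelMap i p) := by
  have := (isPullback_relMap i p).isIso_snd_of_isIso
  have e : toRelMap i p ≫ relFst i p = restrict i P := rfl
  have : IsIso (toRelMap i p) := by
    have : IsIso (toRelMap i p ≫ relFst i p) := e ▸ hP
    exact IsIso.of_isIso_comp_right _ (relFst i p)
  exact MorphismProperty.of_isIso W _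

variable (hp : ∀ n, d ≤ n → W (toRelMap (SSet.boundary.{v} n).ι p)) {T : SSet.{v}}
  [∀ n, Finite (T.obj n)] (S : T.Subcomplex) (hS : T.skeleton d ≤ S)

include hp hS

/-- Simplices of dimension < d already lie in `S`, so only the hypothesis in dimensions ≥ d is used
when cells are attached. -/
theorem toRelMap_sup_skeleton_mem (N : ℕ) :
    W (toRelMap (SSet.Subcomplex.homOfLE (le_sup_left : S ≤ S ⊔ T.skeleton N)) p) := by
  refine (skeleton_induction (U := T) (fun A ↦ ∃ h : S ≤ A,
    W (toRelMap (SSet.Subcomplex.homOfLE h) p)) N ?_ S ⟨le_rfl, ?_⟩).2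
  · rintro A n x - ⟨h, hA⟩ hx hxA hpre
    refine ⟨h.trans le_sup_left, ?_⟩
    have hn : d ≤ n := by
      by_contra! hn
      exact hxA (h _ (hS _ (T.mem_skeleton x hn)))
    exact toRelMap_comp W _ _ p hA
      (toRelMap_of_isPushout W (isPushout_boundary A x hx hpre) (hp n hn))
  · exact toRelMap_mem_of_isIso W _ (isIso_restrict (𝟙 _) P) (isIso_restrict (𝟙 _) X)

/-- For finite-dimensional `T` no coskeletality of `P` is required; this is what makes it usable in
showing that `P` is a k-category. -/
theorem toRelMap_mem_of_skeleton_eq_top {N : ℕ} (hN : T.skeleton N = ⊤) :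
    W (toRelMap S.ι p) := by
  have e : S ⊔ T.skeleton N = ⊤ := by rw [hN, sup_top_eq]
  have : IsIso (S ⊔ T.skeleton N).ι := by
    rw [e]
    exact (SSet.Subcomplex.topIso T).isIso_hom
  exact toRelMap_comp W _ (S ⊔ T.skeleton N).ι p (toRelMap_sup_skeleton_mem W hp S hS N)
    (toRelMap_mem_of_isIso W _ inferInstance inferInstance)

theorem toRelMap_mem (hk : 0 < k) (hP : ∀ (n : ℕ) (i : Fin (n + 1)), 0 < i → i < Fin.last n →
      k < n → IsIso (restrict (SSet.horn.{v} n i).ι P))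
    (hX : ∀ (n : ℕ) (i : Fin (n + 1)), 0 < i → i < Fin.last n →
      k < n → IsIso (restrict (SSet.horn.{v} n i).ι X)) :
    W (toRelMap S.ι p) :=
  toRelMap_comp W _ (S ⊔ T.skeleton (k + 2)).ι p (toRelMap_sup_skeleton_mem W hp S hS (k + 2))
    (toRelMap_mem_of_isIso W _ (isIso_restrict_of_skeleton_le hk hP _ le_sup_right)
      (isIso_restrict_of_skeleton_le hk hX _ le_sup_right))

end Hypercovers

end DescentCat

namespace DescentCat

/-! ### Recognising inner horn attachments from faces -/

section HornSteps

variable {U : SSet.{v}}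

theorem preimage_eq_horn (A : U.Subcomplex) {n : ℕ} (x : U _⦋n + 1⦌) (i : Fin (n + 2))
    (hA : ∀ b, b ≠ i → U.δ b x ∈ A.obj (op ⦋n⦌)) (hi : U.δ i x ∉ A.obj (op ⦋n⦌)) :
    A.preimage (SSet.yonedaEquiv.symm x) = SSet.horn (n + 1) i := by
  apply le_antisymm
  · rw [SSet.subcomplex_le_horn_iff, SSet.stdSimplex.face_singleton_compl,
      SSet.Subcomplex.ofSimplex_le_iff]
    exact hi
  · rw [SSet.horn_eq_iSup, iSup_le_iff]
    rintro ⟨b, hb⟩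
    rw [SSet.stdSimplex.face_singleton_compl, SSet.Subcomplex.ofSimplex_le_iff]
    exact hA b hb

/-- If a simplex has all its faces but the `i`-th in a subcomplex, then it is attached along a
horn. -/
theorem innerStep_of_faces {d : ℕ} (A : U.Subcomplex) {n : ℕ} (x : U _⦋n + 1⦌) (i : Fin (n + 2))
    (hd : d ≤ n + 1) (h₀ : 0 < i) (h₁ : i < Fin.last (n + 1))
    (hA : ∀ b, b ≠ i → U.δ b x ∈ A.obj (op ⦋n⦌)) (hi : U.δ i x ∉ A.obj (op ⦋n⦌)) :
    InnerStep d A (A ⊔ SSet.Subcomplex.ofSimplex x) := by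
  have hpre := preimage_eq_horn A x i hA hi
  -- If `x` were a degeneracy of `y`, then `y` would occur as two consecutive faces of `x`. One of
  -- them is not the `i`-th, so `y`, and with it every face of `x`, would lie in `A`.
  have hx : x ∈ U.nonDegenerate (n + 1) := by
    intro hx
    rw [SSet.degenerate_eq_iUnion_range_σ, Set.mem_iUnion] at hx
    obtain ⟨c, y, rfl⟩ := hx
    have hy : y ∈ A.obj (op ⦋n⦌) := by
      by_cases hc : c.castSucc = i
      · have := hA c.succ (by rw [← hc]; exact (Fin.castSucc_lt_succ).ne')
        rwa [SSet.δ_comp_σ_succ_apply] at this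
      · have := hA c.castSucc hc
        rwa [SSet.δ_comp_σ_self_apply] at this
    exact hi (A.map _ (A.map _ hy))
  -- If the `i`-th face were a degeneracy of `y`, then `y` would be a face of `x` of codimension 2,
  -- hence in the horn, and the face itself would lie in `A`.
  have hz : U.δ i x ∈ U.nonDegenerate n := by
    intro hz
    obtain _ | n := n
    · rw [SSet.degenerate_zero] at hz
      exact hz
    · rw [SSet.degenerate_eq_iUnion_range_σ, Set.mem_iUnion] at hz
      obtain ⟨c, y, hy⟩ := hz
      have hy' : U.δ c.castSucc (U.δ i x) = y := by
        rw [← hy, SSet.δ_comp_σ_self_apply]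
      have : SSet.stdSimplex.objEquiv.symm (SimplexCategory.δ c.castSucc ≫ SimplexCategory.δ i) ∈
          (A.preimage (SSet.yonedaEquiv.symm x)).obj (op ⦋n⦌) := by
        rw [hpre, SSet.horn_obj_eq_univ i n]
        trivial
      have : U.map (SimplexCategory.δ c.castSucc ≫ SimplexCategory.δ i).op x ∈ A.obj _ := this
      rw [op_comp, Functor.map_comp_apply] at this
      refine hi ?_
      rw [← hy, ← hy']
      exact A.map _ this
  refine ⟨n + 1, i, SSet.yonedaEquiv.symm x, hd, h₀, h₁, hpre, ?_,
    by rw [SSet.Subcomplex.range_eq_ofSimplex, Equiv.apply_symm_apply]⟩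
  rintro ⟨m⟩ s t hs hst
  induction m using SimplexCategory.rec with | _ m
  obtain ⟨s, rfl⟩ := SSet.stdSimplex.objEquiv.symm.surjective s
  obtain ⟨t, rfl⟩ := SSet.stdSimplex.objEquiv.symm.surjective t
  change ⦋m⦌ ⟶ ⦋n + 1⦌ at s t
  have hst : U.map s.op x = U.map t.op x := hst
  congr 1
  -- A simplex off the horn maps onto Δ^{n+1} or onto its `i`-th face. Nondegeneracy of `x` settles
  -- the first case and nondegeneracy of the `i`-th face the second.
  by_cases hs' : Function.Surjective s.toOrderHom
  · have : Epi s := SimplexCategory.epi_iff_surjective.2 hs'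
    exact SSet.unique_nonDegenerate_map U _ s ⟨x, hx⟩ rfl t ⟨x, hx⟩ hst
  by_cases ht' : Function.Surjective t.toOrderHom
  · have : Epi t := SimplexCategory.epi_iff_surjective.2 ht'
    exact (SSet.unique_nonDegenerate_map U _ t ⟨x, hx⟩ rfl s ⟨x, hx⟩ hst.symm).symm
  have hs₁ : ∀ b, b ≠ i → ∃ p, s.toOrderHom p = b := by
    intro b hb
    by_contra! h
    exact hs ((SSet.mem_horn_iff_notMem_range _ _).2 ⟨b, hb, fun ⟨p, hp⟩ ↦ h p hp⟩)
  have hs₂ : ∀ p, s.toOrderHom p ≠ i := by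
    intro p hp
    refine hs' fun b ↦ ?_
    by_cases hb : b = i
    · exact ⟨p, hp.trans hb.symm⟩
    · exact hs₁ b hb
  obtain ⟨σ, rfl⟩ := SimplexCategory.eq_comp_δ_of_not_surjective' s i hs₂
  simp only [Function.Surjective, not_forall, not_exists] at ht'
  obtain ⟨b, hb⟩ := ht'
  obtain ⟨τ, rfl⟩ := SimplexCategory.eq_comp_δ_of_not_surjective' t b hb
  rw [op_comp, op_comp, Functor.map_comp_apply, Functor.map_comp_apply] at hst
  by_cases hbi : b = i
  · subst hbi
    have : Epi σ := SimplexCategory.epi_iff_surjective.2 fun c ↦ by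
      obtain ⟨p, hp⟩ := hs₁ (Fin.succAbove b c) (Fin.succAbove_ne _ _)
      exact ⟨p, Fin.succAbove_right_injective hp⟩
    rw [SSet.unique_nonDegenerate_map U _ σ ⟨_, hz⟩ rfl τ ⟨_, hz⟩ hst]
  · refine absurd ?_ hs
    rw [← hpre]
    change U.map (σ ≫ SimplexCategory.δ i).op x ∈ A.obj _
    rw [op_comp, Functor.map_comp_apply, hst]
    exact A.map _ (hA b hbi)

end HornSteps

/-- An `m`-simplex of the prism of dimension `n`. -/
@[ext]
structure PrismSimplex (n m : ℕ) : Type v where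
  eps : Fin (m + 1) → Fin 2
  lvl : Fin (m + 1) →o Fin (n + 1)
  compat : ∀ p q, lvl p < lvl q → eps p ≤ eps q

/-- The pullback of a simplex of a prism along a monotone map. -/
def PrismSimplex.precomp {n m m' : ℕ} (s : PrismSimplex.{v} n m) (θ : Fin (m' + 1) →o Fin (m + 1)) :
    PrismSimplex.{v} n m' where
  eps p := s.eps (θ p)
  lvl := s.lvl.comp θ
  compat _ _ h := s.compat _ _ h

/-- The map of prisms induced by a monotone map. -/
def PrismSimplex.postcomp {n n' m : ℕ} (s : PrismSimplex.{v} n m)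
    (φ : Fin (n + 1) →o Fin (n' + 1)) : PrismSimplex.{v} n' m where
  eps := s.eps
  lvl := φ.comp s.lvl
  compat p q h := s.compat p q (lt_of_not_ge fun h' ↦ absurd h (not_lt.2 (φ.monotone h')))

/-- The prism on `Δ^n`: it consists of the simplices of the product of the thick `1`-simplex
with `Δ^n` whose component in the thick `1`-simplex is monotone with respect to changes of level
in `Δ^n`. -/
def prism : SimplexCategory ⥤ SSet.{v} where
  obj n :=
    { obj m := PrismSimplex.{v} n.len m.unop.len
      map θ := ↾fun s ↦ s.precomp θ.unop.toOrderHom }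
  map φ := { app m := ↾fun s ↦ PrismSimplex.postcomp s φ.toOrderHom }

end DescentCat

/-! ### Distinguished subcomplexes of the prism -/

namespace DescentCat

theorem inf_skeleton_le {U : SSet.{v}} {A B : U.Subcomplex} {K : ℕ}
    (h : ∀ m, m < K → ∀ x : U _⦋m⦌, x ∈ A.obj (op ⦋m⦌) → x ∈ B.obj (op ⦋m⦌)) :
    A ⊓ U.skeleton K ≤ B := by
  rw [SSet.Subcomplex.le_iff_contains_nonDegenerate]
  rintro m x ⟨hxA, hx⟩
  rw [SSet.mem_skeleton_obj_iff_of_nonDegenerate] at hx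
  exact h m hx _ hxA

theorem PrismSimplex.ext_val {n m : ℕ} {s t : PrismSimplex.{v} n m}
    (h₁ : ∀ p, (s.eps p : ℕ) = t.eps p) (h₂ : ∀ p, (s.lvl p : ℕ) = t.lvl p) : s = t :=
  PrismSimplex.ext (funext fun p ↦ Fin.ext (h₁ p))
    (OrderHom.ext _ _ (funext fun p ↦ Fin.ext (h₂ p)))

/-- The prism on `Δ^n`. -/
abbrev prismObj (n : ℕ) : SSet.{v} := prism.{v}.obj ⦋n⦌

theorem mem_ofSimplex_prism {n N m : ℕ} (w : PrismSimplex.{v} n N) (s : PrismSimplex.{v} n m) :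
    (s : (prismObj.{v} n).obj (op ⦋m⦌)) ∈
      (SSet.Subcomplex.ofSimplex (X := prismObj.{v} n) (n := N) w).obj (op ⦋m⦌) ↔
      ∃ θ : Fin (m + 1) →o Fin (N + 1), w.precomp θ = s := by
  refine (SSet.Subcomplex.mem_ofSimplex_obj_iff (X := prismObj.{v} n) (n := N) w (m := op ⦋m⦌) s).trans ?_
  exact ⟨fun ⟨f, hf⟩ ↦ ⟨f.toOrderHom, hf⟩, fun ⟨θ, hθ⟩ ↦ ⟨SimplexCategory.mkHom θ, hθ⟩⟩

/-- The simplices of the prism lying over the boundary of `Δ^n`. -/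
def prismBoundary (n : ℕ) : (prismObj.{v} n).Subcomplex where
  obj m := Set.ofPred fun s : PrismSimplex.{v} n m.unop.len ↦
    ¬ Function.Surjective s.lvl
  map _ _ hs h := hs (Function.Surjective.of_comp h)

/-- The union of the part of the prism over the boundary of `Δ^n` and of the copy of `Δ^n` with
label `e`. -/
def prismEnd (n : ℕ) (e : Fin 2) : (prismObj.{v} n).Subcomplex where
  obj m := Set.ofPred fun s : PrismSimplex.{v} n m.unop.len ↦
    ¬ Function.Surjective s.lvl ∨ ∀ p, s.eps p = e
  map _ _ hs := hs.imp (fun h h' ↦ h (Function.Surjective.of_comp h')) (fun h _ ↦ h _)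

/-- The union of the part of the prism over the boundary of `Δ^n` and of the simplices whose
vertices of level `0` have label `0`. -/
def prismBot (n : ℕ) : (prismObj.{v} n).Subcomplex where
  obj m := Set.ofPred fun s : PrismSimplex.{v} n m.unop.len ↦
    ¬ Function.Surjective s.lvl ∨ ∀ p, s.lvl p = 0 → s.eps p = 0
  map _ _ hs := hs.imp (fun h h' ↦ h (Function.Surjective.of_comp h')) (fun h _ ↦ h _)

/-- The simplices of the prism whose vertices of positive level have label `1`. -/
def prismJoin (n : ℕ) : (prismObj.{v} n).Subcomplex where
  obj m := Set.ofPred fun s : PrismSimplex.{v} n m.unop.len ↦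
    ∀ p, 0 < s.lvl p → s.eps p = 1
  map _ _ hs _ := hs _

/-! ### Alternating words generating the prism -/

section Words

/-- The simplex of the prism with vertices of label `0` and level `l` for `l < j`, then `L + 1`
vertices of level `j` with alternating labels, the first one having the parity of `c`, and then
vertices of label `1` and level `l` for `l > j`. -/
def word (n j L c : ℕ) (hj : j ≤ n) : PrismSimplex.{v} n (n + L) where
  eps l := ⟨if (l : ℕ) < j then 0 else if (l : ℕ) ≤ j + L then (c + (l - j)) % 2 else 1, by
    split_ifs <;> omega⟩
  lvl := ⟨fun l ↦ ⟨if (l : ℕ) < j then (l : ℕ) else if (l : ℕ) ≤ j + L then j else l - L, by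
      have := l.2
      split_ifs <;> omega⟩, fun l l' h ↦ by
      have : (l : ℕ) ≤ l' := h
      simp only [Fin.mk_le_mk]
      split_ifs <;> omega⟩
  compat l l' h := by
    replace h : (if (l : ℕ) < j then (l : ℕ) else if (l : ℕ) ≤ j + L then j else l - L) <
      (if (l' : ℕ) < j then (l' : ℕ) else if (l' : ℕ) ≤ j + L then j else l' - L) := h
    simp only [Fin.mk_le_mk]
    split_ifs at h ⊢ <;> omega

variable {n j L c : ℕ} {hj : j ≤ n}

theorem word_eps (l : Fin (n + L + 1)) : ((word.{v} n j L c hj).eps l : ℕ) =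
    if (l : ℕ) < j then 0 else if (l : ℕ) ≤ j + L then (c + (l - j)) % 2 else 1 := rfl

theorem word_lvl (l : Fin (n + L + 1)) : ((word.{v} n j L c hj).lvl l : ℕ) =
    if (l : ℕ) < j then (l : ℕ) else if (l : ℕ) ≤ j + L then j else l - L := rfl

theorem word_lvl_surjective : Function.Surjective (word.{v} n j L c hj).lvl := by
  intro q
  have hq := q.2
  by_cases h : (q : ℕ) ≤ j
  · refine ⟨⟨(q : ℕ), by omega⟩, Fin.ext ?_⟩
    rw [word_lvl]
    dsimp only
    split_ifs <;> omega
  · refine ⟨⟨q + L, by omega⟩, Fin.ext ?_⟩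
    rw [word_lvl]
    dsimp only
    split_ifs <;> omega

theorem val_succAbove {N : ℕ} (b : Fin (N + 1)) (l : Fin N) :
    (b.succAbove l : ℕ) = if (l : ℕ) < b then (l : ℕ) else l + 1 := by
  simp only [Fin.succAbove, Fin.lt_def, Fin.val_castSucc]
  split_ifs <;> rfl

theorem exists_orderHom {a b : ℕ} (f : Fin (a + 1) → ℕ) (hf : ∀ l, f l < b + 1)
    (hf' : ∀ l l', l ≤ l' → f l ≤ f l') :
    ∃ θ : Fin (a + 1) →o Fin (b + 1), ∀ l, (θ l : ℕ) = f l :=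
  ⟨⟨fun l ↦ ⟨f l, hf l⟩, fun l l' h ↦ hf' l l' h⟩, fun _ ↦ rfl⟩

/-- The `b`-th face of a simplex of the prism. -/
def PrismSimplex.face {m : ℕ} (s : PrismSimplex.{v} n (m + 1)) (b : Fin (m + 2)) :
    PrismSimplex.{v} n m :=
  s.precomp (Fin.succAboveOrderEmb b).toOrderHom

theorem word_face_eps (b : Fin (n + L + 2)) (l : Fin (n + L + 1)) :
    (((word.{v} n j (L + 1) c hj).face b).eps l : ℕ) =
    if (if (l : ℕ) < b then (l : ℕ) else l + 1) < j then 0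
    else if (if (l : ℕ) < b then (l : ℕ) else l + 1) ≤ j + (L + 1) then
      (c + ((if (l : ℕ) < b then (l : ℕ) else l + 1) - j)) % 2 else 1 := by
  rw [← val_succAbove]
  rfl

theorem word_face_lvl (b : Fin (n + L + 2)) (l : Fin (n + L + 1)) :
    (((word.{v} n j (L + 1) c hj).face b).lvl l : ℕ) =
    if (if (l : ℕ) < b then (l : ℕ) else l + 1) < j then
      (if (l : ℕ) < b then (l : ℕ) else l + 1)
    else if (if (l : ℕ) < b then (l : ℕ) else l + 1) ≤ j + (L + 1) then j
    else (if (l : ℕ) < b then (l : ℕ) else l + 1) - (L + 1) := by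
  rw [← val_succAbove]
  rfl

theorem word_face_last (b : Fin (n + L + 2)) (hb : (b : ℕ) = j + (L + 1)) :
    (word.{v} n j (L + 1) c hj).face b = word n j L c hj := by
  refine PrismSimplex.ext_val (fun l ↦ ?_) (fun l ↦ ?_)
  · rw [word_face_eps, word_eps]
    split_ifs <;> omega
  · rw [word_face_lvl, word_lvl]
    split_ifs <;> omega

theorem word_face_first (b : Fin (n + L + 2)) (hb : (b : ℕ) = j) :
    (word.{v} n j (L + 1) c hj).face b = word n j L (c + 1) hj := by
  refine PrismSimplex.ext_val (fun l ↦ ?_) (fun l ↦ ?_)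
  · rw [word_face_eps, word_eps]
    split_ifs <;> omega
  · rw [word_face_lvl, word_lvl]
    split_ifs <;> omega

/-- Deleting an interior letter of the alternating block brings two equal letters together. The face
is then a degeneracy of a simplex with fewer letters, which fits in the word without its first
letter. Only deletion of the last letter has to be excluded. -/
theorem word_face_eq_precomp (b : Fin (n + L + 2)) (h₁ : j ≤ b) (h₂ : (b : ℕ) ≤ j + L) :
    ∃ θ, (word.{v} n j L (c + 1) hj).precomp θ = (word.{v} n j (L + 1) c hj).face b := by
  obtain ⟨θ, hθ⟩ := exists_orderHom (a := n + L) (b := n + L)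
    (fun l ↦ if (l : ℕ) < j then (l : ℕ) else if (l : ℕ) < b then l + 1 else l)
    (fun l ↦ by have := l.2; have := b.2; split_ifs <;> omega)
    (fun l l' h ↦ by have : (l : ℕ) ≤ l' := h; split_ifs <;> omega)
  refine ⟨θ, ?_⟩
  refine PrismSimplex.ext_val (fun l ↦ ?_) (fun l ↦ ?_)
  · rw [word_face_eps]
    refine (word_eps.{v} (j := j) (L := L) (c := c + 1) (hj := hj) _).trans ?_
    rw [hθ]
    split_ifs <;> omega
  · rw [word_face_lvl]
    refine (word_lvl.{v} (j := j) (L := L) (c := c + 1) (hj := hj) _).trans ?_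
    rw [hθ]
    split_ifs <;> omega

/-- The mirror image of the preceding lemma: the face fits in the word without its last letter,
unless it is the first letter that is deleted. -/
theorem word_face_eq_precomp' (b : Fin (n + L + 2)) (h₁ : j < b) (h₂ : (b : ℕ) ≤ j + (L + 1)) :
    ∃ θ, (word.{v} n j L c hj).precomp θ = (word.{v} n j (L + 1) c hj).face b := by
  obtain ⟨θ, hθ⟩ := exists_orderHom (a := n + L) (b := n + L)
    (fun l ↦ if (l : ℕ) < b then (l : ℕ) else if (l : ℕ) ≤ j + L then l - 1 else l)
    (fun l ↦ by have := l.2; have := b.2; split_ifs <;> omega)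
    (fun l l' h ↦ by have : (l : ℕ) ≤ l' := h; split_ifs <;> omega)
  refine ⟨θ, ?_⟩
  refine PrismSimplex.ext_val (fun l ↦ ?_) (fun l ↦ ?_)
  · rw [word_face_eps]
    refine (word_eps.{v} (j := j) (L := L) (c := c) (hj := hj) _).trans ?_
    rw [hθ]
    split_ifs <;> omega
  · rw [word_face_lvl]
    refine (word_lvl.{v} (j := j) (L := L) (c := c) (hj := hj) _).trans ?_
    rw [hθ]
    split_ifs <;> omega

theorem word_face_not_surjective (b : Fin (n + L + 2)) (h : (b : ℕ) < j ∨ j + (L + 1) < b) :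
    ¬ Function.Surjective ((word.{v} n j (L + 1) c hj).face b).lvl := by
  intro hs
  have hb := b.2
  rcases h with h | h
  · obtain ⟨l, hl⟩ := hs ⟨b, by omega⟩
    have := congr_arg Fin.val hl
    rw [word_face_lvl] at this
    dsimp only at this
    split_ifs at this <;> omega
  · obtain ⟨l, hl⟩ := hs ⟨b - (L + 1), by omega⟩
    have := congr_arg Fin.val hl
    rw [word_face_lvl] at this
    dsimp only at this
    split_ifs at this <;> omega

/-- Consecutive vertices of a word differ in level or in label, so a map θ exhibiting one word as a
face or degeneracy of the other is strictly monotone, hence the identity. But the letters at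
position `j` differ. -/
theorem word_notMem_ofSimplex :
    (word.{v} n j L (c + 1) hj : (prismObj.{v} n).obj (op ⦋n + L⦌)) ∉
      (SSet.Subcomplex.ofSimplex (X := prismObj.{v} n) (n := n + L)
        (word.{v} n j L c hj)).obj (op ⦋n + L⦌) := by
  rw [mem_ofSimplex_prism]
  rintro ⟨θ, hθ⟩
  have h₁ (l : Fin (n + L + 1)) : (word.{v} n j L c hj).eps (θ l) =
    (word.{v} n j L (c + 1) hj).eps l := congr_fun (congr_arg PrismSimplex.eps hθ) l
  have h₂ (l : Fin (n + L + 1)) : (word.{v} n j L c hj).lvl (θ l) =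
    (word.{v} n j L (c + 1) hj).lvl l := by rw [← hθ]; rfl
  have h₃ : StrictMono θ := by
    rw [Fin.strictMono_iff_lt_succ]
    intro l
    refine lt_of_le_of_ne (θ.monotone (Fin.castSucc_lt_succ).le) fun h ↦ ?_
    have h₄ := congr_arg Fin.val ((h₁ l.castSucc).symm.trans ((congr_arg _ h).trans (h₁ l.succ)))
    have h₅ := congr_arg Fin.val ((h₂ l.castSucc).symm.trans ((congr_arg _ h).trans (h₂ l.succ)))
    rw [word_eps, word_eps] at h₄
    rw [word_lvl, word_lvl] at h₅
    simp only [Fin.val_castSucc, Fin.val_succ] at h₄ h₅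
    split_ifs at h₄ h₅ <;> omega
  have h₄ : θ ⟨j, by omega⟩ = ⟨j, by omega⟩ := by
    have : Mono (SimplexCategory.mkHom θ) :=
      SimplexCategory.mono_iff_injective.2 h₃.injective
    have := SimplexCategory.eq_id_of_mono (SimplexCategory.mkHom θ)
    exact congr_arg (fun f : ⦋n + L⦌ ⟶ ⦋n + L⦌ ↦ f.toOrderHom ⟨j, by simp; omega⟩) this
  have := congr_arg Fin.val (h₁ ⟨j, by omega⟩)
  rw [h₄, word_eps, word_eps] at this
  dsimp only at this
  split_ifs at this <;> omega

/-- A simplex has pivot `j` if its vertices of level `< j` have label `0` and its vertices of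
level `> j` have label `1`. -/
def PrismSimplex.IsPivot {m : ℕ} (s : PrismSimplex.{v} n m) (j : ℕ) : Prop :=
  ∀ p, ((s.lvl p : ℕ) < j → s.eps p = 0) ∧ (j < (s.lvl p : ℕ) → s.eps p = 1)

theorem PrismSimplex.IsPivot.mem_ofSimplex {m : ℕ} {s : PrismSimplex.{v} n m} (hs : s.IsPivot j)
    (c : ℕ) (hL : 2 * m + 2 ≤ L) : (s : (prismObj.{v} n).obj (op ⦋m⦌)) ∈
      (SSet.Subcomplex.ofSimplex (X := prismObj.{v} n) (n := n + L)
        (word.{v} n j L c hj)).obj (op ⦋m⦌) := by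
  rw [mem_ofSimplex_prism]
  -- The letters at j + 2l and j + 2l + 1 carry both labels, so vertex `l` of level `j` chooses the
  -- one it needs. The pairs for different `l` are disjoint and ordered; since l ≤ m they fit as
  -- soon as L ≥ 2m + 1.
  obtain ⟨θ, hθ⟩ := exists_orderHom (a := m) (b := n + L)
    (fun l ↦ if (s.lvl l : ℕ) < j then (s.lvl l : ℕ) else if (s.lvl l : ℕ) = j then
      j + 2 * l + (c + s.eps l) % 2 else s.lvl l + L)
    (fun l ↦ by
      have := l.2
      have := (s.lvl l).2
      split_ifs <;> omega)
    (fun l l' h ↦ by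
      have h₁ : (s.lvl l : ℕ) ≤ s.lvl l' := s.lvl.monotone h
      have h₂ : (l : ℕ) ≤ l' := h
      have := l.2
      have := l'.2
      obtain h₃ | h₃ := h₂.eq_or_lt
      · obtain rfl := Fin.ext h₃
        exact le_rfl
      · split_ifs <;> omega)
  refine ⟨θ, ?_⟩
  refine PrismSimplex.ext_val (fun l ↦ ?_) (fun l ↦ ?_)
  · refine (word_eps.{v} (j := j) (L := L) (c := c) (hj := hj) _).trans ?_
    rw [hθ]
    have := l.2
    have := (s.eps l).2
    have h₁ := fun h ↦ congr_arg Fin.val ((hs l).1 h)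
    have h₂ := fun h ↦ congr_arg Fin.val ((hs l).2 h)
    simp only [Fin.val_zero, Fin.val_one] at h₁ h₂
    split_ifs <;> omega
  · refine (word_lvl.{v} (j := j) (L := L) (c := c) (hj := hj) _).trans ?_
    rw [hθ]
    have := l.2
    split_ifs <;> omega

end Words

end DescentCat

namespace DescentCat

/-- The subcomplex of the prism generated by a word. -/
abbrev wordComplex (n j L c : ℕ) (hj : j ≤ n) : (prismObj.{v} n).Subcomplex :=
  SSet.Subcomplex.ofSimplex (X := prismObj.{v} n) (n := n + L) (word.{v} n j L c hj)

/-! ### Filling the part of the prism with a given pivot -/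

section Filling

variable {n j : ℕ} {hj : j ≤ n} (e : Fin 2) (A : (prismObj.{v} n).Subcomplex)

theorem wordComplex_mem_iff {L c m : ℕ} (s : PrismSimplex.{v} n m) :
    (s : (prismObj.{v} n).obj (op ⦋m⦌)) ∈ (wordComplex n j L c hj).obj (op ⦋m⦌) ↔
      ∃ θ : Fin (m + 1) →o Fin (n + L + 1), (word n j L c hj).precomp θ = s :=
  mem_ofSimplex_prism _ _

theorem wordComplex_le_iff {L c : ℕ} : wordComplex.{v} n j L c hj ≤ A ↔
    (word.{v} n j L c hj : (prismObj.{v} n).obj (op ⦋n + L⦌)) ∈ A.obj (op ⦋n + L⦌) :=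
  SSet.Subcomplex.ofSimplex_le_iff _ _

theorem prismBoundary_le_prismEnd : prismBoundary.{v} n ≤ prismEnd n e := fun _ _ h ↦ Or.inl h

variable
  (h₁ : ∀ m (s : PrismSimplex.{v} n m), (s : (prismObj.{v} n).obj (op ⦋m⦌)) ∈ A.obj (op ⦋m⦌) →
    Function.Surjective s.lvl → ∀ p, (s.lvl p : ℕ) = j → s.eps p = e)
  (h₂ : ∀ L c, prismBoundary n ⊓ wordComplex n j L c hj ≤ A)

include h₁ in
-- All level-`j` vertices of level-surjective simplices of `A` have label `e`, so one letter
-- different from `e` excludes a word from `A`. This keeps the missing face of each horn out of `A`.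
theorem word_notMem (L c l : ℕ) (hl : l ≤ L) (hc : (c + l) % 2 ≠ e) :
    (word.{v} n j L c hj : (prismObj.{v} n).obj (op ⦋n + L⦌)) ∉ A.obj (op ⦋n + L⦌) := by
  intro h
  have h₃ := congr_arg Fin.val (h₁ _ _ h word_lvl_surjective ⟨j + l, by omega⟩ (by
    rw [word_lvl]; dsimp only; split_ifs <;> omega))
  rw [word_eps] at h₃
  dsimp only at h₃
  split_ifs at h₃ <;> omega

theorem word_face_mem (L c : ℕ) (b : Fin (n + L + 2)) :
    ((word.{v} n j (L + 1) c hj).face b : (prismObj.{v} n).obj (op ⦋n + L⦌)) ∈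
      (wordComplex n j (L + 1) c hj).obj (op ⦋n + L⦌) :=
  (wordComplex_mem_iff _).2 ⟨_, rfl⟩

include h₂ in
theorem word_face_mem_of_boundary (L c : ℕ) (b : Fin (n + L + 2))
    (hb : (b : ℕ) < j ∨ j + (L + 1) < b) :
    ((word.{v} n j (L + 1) c hj).face b : (prismObj.{v} n).obj (op ⦋n + L⦌)) ∈
      A.obj (op ⦋n + L⦌) :=
  h₂ (L + 1) c _ ⟨word_face_not_surjective b hb, word_face_mem L c b⟩

include h₁ h₂

/-- Filling inner horns to attach the words with a fixed last letter of level `j < n`. -/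
theorem innerExt_word_last (hjn : j < n)
    (h₃ : (word.{v} n j 0 e hj : (prismObj.{v} n).obj (op ⦋n + 0⦌)) ∈ A.obj (op ⦋n + 0⦌)) (N : ℕ) :
    InnerExt (n + 1) A (A ⊔ wordComplex n j N (e + N) hj) := by
  induction N with
  | zero =>
    have := sup_eq_left.2 ((wordComplex_le_iff (hj := hj) A).2 h₃)
    exact this.symm ▸ Relation.ReflTransGen.refl
  | succ N ih =>
    have hface : ((word.{v} n j (N + 1) (e + (N + 1)) hj).face (⟨j, by omega⟩ : Fin (n + N + 2))) =
        word n j N (e + N) hj := by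
      rw [word_face_first (j := j) _ rfl]
      refine PrismSimplex.ext_val (fun p ↦ ?_) (fun p ↦ rfl)
      rw [word_eps, word_eps]
      split_ifs <;> omega
    have hle : wordComplex.{v} n j N (e + N) hj ≤ wordComplex n j (N + 1) (e + (N + 1)) hj := by
      rw [wordComplex_le_iff]
      have := word_face_mem.{v} (hj := hj) N (e + (N + 1)) ⟨j, by omega⟩
      rwa [hface] at this
    refine ih.tail ?_
    -- The missing face omits the last letter of level `j`; as j < n, vertices of higher level
    -- follow it and the horn is inner. The parity e + (N + 1) makes the last letter equal to `e`.
    have step := innerStep_of_faces (U := prismObj.{v} n) (d := n + 1)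
      (A ⊔ wordComplex n j N (e + N) hj) (n := n + N) (word.{v} n j (N + 1) (e + (N + 1)) hj)
      ⟨j + (N + 1), by omega⟩ (by omega) (by simp [Fin.lt_def]) (by simp [Fin.lt_def]; omega) ?_ ?_
    · rwa [sup_assoc, sup_eq_right.2 hle] at step
    · intro b hb
      have hb' : (b : ℕ) ≠ j + (N + 1) := fun h ↦ hb (Fin.ext h)
      by_cases hb₁ : (b : ℕ) < j ∨ j + (N + 1) < b
      · exact Or.inl (word_face_mem_of_boundary A h₂ N _ b hb₁)
      · refine Or.inr ((wordComplex_mem_iff ((word.{v} n j (N + 1) (e + (N + 1)) hj).face b)).2 ?_)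
        have := word_face_eq_precomp.{v} (hj := hj) (c := e + (N + 1)) b (by omega) (by omega)
        rwa [← hface, word_face_first (j := j) _ rfl]
    · rintro (h | h)
      · change ((word.{v} n j (N + 1) (e + (N + 1)) hj).face (⟨j + (N + 1), by omega⟩ : Fin (n + N + 2)) :
          (prismObj.{v} n).obj (op ⦋n + N⦌)) ∈ A.obj (op ⦋n + N⦌) at h
        rw [word_face_last _ rfl] at h
        exact word_notMem e A h₁ N _ N le_rfl (by have := e.2; omega) h
      · change ((word.{v} n j (N + 1) (e + (N + 1)) hj).face (⟨j + (N + 1), by omega⟩ : Fin (n + N + 2)) :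
          (prismObj.{v} n).obj (op ⦋n + N⦌)) ∈ (wordComplex n j N _ hj).obj (op ⦋n + N⦌) at h
        rw [word_face_last _ rfl] at h
        exact word_notMem_ofSimplex h

/-- Filling inner horns to attach the words with a fixed first letter of level `j > 0`. -/
theorem innerExt_word_first (hj₀ : 0 < j)
    (h₃ : (word.{v} n j 0 e hj : (prismObj.{v} n).obj (op ⦋n + 0⦌)) ∈ A.obj (op ⦋n + 0⦌)) (N : ℕ) :
    InnerExt (n + 1) A (A ⊔ wordComplex n j N e hj) := by
  induction N with
  | zero =>
    have := sup_eq_left.2 ((wordComplex_le_iff (hj := hj) A).2 h₃)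
    exact this.symm ▸ Relation.ReflTransGen.refl
  | succ N ih =>
    have hle : wordComplex.{v} n j N e hj ≤ wordComplex n j (N + 1) e hj := by
      rw [wordComplex_le_iff]
      have := word_face_mem.{v} (hj := hj) N e ⟨j + (N + 1), by omega⟩
      rwa [word_face_last _ rfl] at this
    refine ih.tail ?_
    -- Now the missing face omits the first letter of level `j`, and the horn is inner because j > 0
    -- vertices of lower level precede it.
    have step := innerStep_of_faces (U := prismObj.{v} n) (d := n + 1)
      (A ⊔ wordComplex n j N e hj) (n := n + N) (word.{v} n j (N + 1) e hj)
      ⟨j, by omega⟩ (by omega) (by simpa [Fin.lt_def]) (by simp [Fin.lt_def]; omega) ?_ ?_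
    · rwa [sup_assoc, sup_eq_right.2 hle] at step
    · intro b hb
      have hb' : (b : ℕ) ≠ j := fun h ↦ hb (Fin.ext h)
      by_cases hb₁ : (b : ℕ) < j ∨ j + (N + 1) < b
      · exact Or.inl (word_face_mem_of_boundary A h₂ N _ b hb₁)
      · exact Or.inr ((wordComplex_mem_iff ((word.{v} n j (N + 1) e hj).face b)).2
          (word_face_eq_precomp' b (by omega) (by omega)))
    · rintro (h | h)
      · change ((word.{v} n j (N + 1) e hj).face (⟨j, by omega⟩ : Fin (n + N + 2)) :
          (prismObj.{v} n).obj (op ⦋n + N⦌)) ∈ A.obj (op ⦋n + N⦌) at h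
        rw [word_face_first (j := j) _ rfl] at h
        exact word_notMem e A h₁ N _ 0 (by omega) (by have := e.2; omega) h
      · change ((word.{v} n j (N + 1) e hj).face (⟨j, by omega⟩ : Fin (n + N + 2)) :
          (prismObj.{v} n).obj (op ⦋n + N⦌)) ∈ (wordComplex n j N _ hj).obj (op ⦋n + N⦌) at h
        rw [word_face_first (j := j) _ rfl] at h
        exact word_notMem_ofSimplex h

end Filling

/-! ### Chains of inner horns between subcomplexes of the prism -/

section Chains

variable {n : ℕ}

/-- The least level carrying a label 1 is a pivot, by monotonicity of labels between levels. -/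
theorem PrismSimplex.exists_isPivot {m : ℕ} (s : PrismSimplex.{v} n m) (p : Fin (m + 1))
    (hp : s.eps p = 1) : ∃ j ≤ n, s.IsPivot j ∧ ∃ q, (s.lvl q : ℕ) = j ∧ s.eps q = 1 := by
  classical
  have hex : ∃ j, ∃ q, (s.lvl q : ℕ) = j ∧ s.eps q = 1 := ⟨_, p, rfl, hp⟩
  obtain ⟨q, hq, hq'⟩ := Nat.find_spec hex
  refine ⟨Nat.find hex, by rw [← hq]; omega, fun r ↦ ⟨fun hr ↦ ?_, fun hr ↦ ?_⟩, q, hq, hq'⟩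
  · by_contra h
    exact Nat.find_min hex hr ⟨r, rfl, by omega⟩
  · have := s.compat q r (by rw [Fin.lt_def, hq]; exact hr)
    rw [hq', Fin.le_def] at this
    have h1 : ((1 : Fin 2) : ℕ) = 1 := rfl
    omega

theorem word_zero_eps (j c : ℕ) (hj : j ≤ n) (hc : c < 2) (p : Fin (n + 0 + 1)) :
    ((word.{v} n j 0 c hj).eps p : ℕ) =
      if (p : ℕ) < j then 0 else if (p : ℕ) = j then c else 1 := by
  rw [word_eps]
  split_ifs <;> omega

theorem word_zero_lvl (j c : ℕ) (hj : j ≤ n) (p : Fin (n + 0 + 1)) :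
    ((word.{v} n j 0 c hj).lvl p : ℕ) = p := by
  rw [word_lvl]
  split_ifs <;> omega

/-- This simplex is shared by the parts with pivots `j` and `j + 1`; it supplies the starting word
when the filling moves from one pivot to a neighbouring one. -/
theorem word_zero_succ (j : ℕ) (hj : j + 1 ≤ n) :
    word.{v} n (j + 1) 0 1 hj = word n j 0 0 (by omega) := by
  refine PrismSimplex.ext_val (fun p ↦ ?_) (fun p ↦ ?_)
  · rw [word_zero_eps _ _ _ (by omega), word_zero_eps _ _ _ (by omega)]
    split_ifs <;> omega
  · rw [word_zero_lvl, word_zero_lvl]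

theorem word_zero_isPivot (j c : ℕ) (hj : j ≤ n) : (word.{v} n j 0 c hj).IsPivot j := by
  intro p
  rw [word_zero_lvl]
  refine ⟨fun h ↦ Fin.ext ?_, fun h ↦ Fin.ext ?_⟩ <;> rw [word_eps] <;> simp only [Fin.val_zero, Fin.val_one] <;>
    split_ifs <;> omega

theorem word_isPivot (j L c : ℕ) (hj : j ≤ n) : (word.{v} n j L c hj).IsPivot j := by
  intro p
  rw [word_lvl]
  refine ⟨fun h ↦ Fin.ext ?_, fun h ↦ Fin.ext ?_⟩ <;> rw [word_eps] <;> simp only [Fin.val_zero, Fin.val_one] <;>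
    split_ifs at h ⊢ <;> omega

theorem isPivot_of_mem_wordComplex {j L c m : ℕ} {hj : j ≤ n} {s : PrismSimplex.{v} n m}
    (hs : (s : (prismObj.{v} n).obj (op ⦋m⦌)) ∈ (wordComplex n j L c hj).obj (op ⦋m⦌)) :
    s.IsPivot j := by
  obtain ⟨θ, rfl⟩ := (wordComplex_mem_iff s).1 hs
  exact fun p ↦ word_isPivot.{v} j L c hj (θ p)

/-- The part of the prism with label `1` and that over the boundary generate the prism under
filling of inner horns. -/
theorem innerExt_prismEnd_one (hn : 0 < n) (K : ℕ) :
    ∃ B, InnerExt (n + 1) (prismEnd.{v} n 1) B ∧ ⊤ ⊓ (prismObj.{v} n).skeleton K ≤ B := by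
  -- Long enough for the words to contain every pivot simplex of dimension < K and also the
  -- n-dimensional starting words for the next pivot.
  let N := 2 * (n + K) + 2
  -- Pivots are treated in the order 0, 1, …, n - 1 with last letter 1. At each stage the
  -- level-surjective simplices have label 1 at all levels not yet treated.
  have key (j : ℕ) (hjn : j ≤ n) : ∃ B, InnerExt (n + 1) (prismEnd.{v} n 1) B ∧
      (∀ j' (hj' : j' < j), wordComplex n j' N (1 + N) (by omega) ≤ B) ∧
      ∀ m (s : PrismSimplex.{v} n m), (s : (prismObj.{v} n).obj (op ⦋m⦌)) ∈ B.obj (op ⦋m⦌) →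
        Function.Surjective s.lvl → ∀ p, j ≤ (s.lvl p : ℕ) → s.eps p = 1 := by
    induction j with
    | zero => exact ⟨_, .refl, by simp, fun m s hs hs' p _ ↦ (hs.resolve_left (not_not.2 hs')) p⟩
    | succ j ih =>
      obtain ⟨B, hB, hB₁, hB₂⟩ := ih (by omega)
      refine ⟨_, hB.trans (innerExt_word_last (hj := by omega) 1 B
        (fun m s hs hs' p hp ↦ hB₂ m s hs hs' p hp.ge)
        (fun L c ↦ inf_le_left.trans ((prismBoundary_le_prismEnd _).trans hB.le)) hjn ?_ N), ?_, ?_⟩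
      · obtain _ | j := j
        · refine hB.le _ (Or.inr fun p ↦ Fin.ext ?_)
          rw [word_eps]
          simp only [Fin.val_one]
          split_ifs <;> omega
        · have := word_zero_succ.{v} (n := n) j (by omega)
          change (word.{v} n (j + 1) 0 1 _ : (prismObj.{v} n).obj (op ⦋n + 0⦌)) ∈ _
          rw [this]
          exact hB₁ j (by omega) _
            ((word_zero_isPivot j 0 (by omega)).mem_ofSimplex _ (by simp only [N]; omega))
      · intro j' hj'
        obtain h | rfl := (Nat.lt_succ_iff.1 hj').lt_or_eq
        · exact (hB₁ j' h).trans le_sup_left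
        · exact le_sup_right
      · rintro m s (hs | hs) hs' p hp
        · exact hB₂ m s hs hs' p (by omega)
        · exact (isPivot_of_mem_wordComplex hs p).2 hp
  obtain ⟨B, hB, hB₁, hB₂⟩ := key n le_rfl
  obtain ⟨n, rfl⟩ : ∃ n', n = n' + 1 := ⟨n - 1, by omega⟩
  -- At the top pivot omitting the last letter would give an outer horn, so the first letter is
  -- fixed instead; this is where n > 0 enters.
  refine ⟨_, hB.trans (innerExt_word_first (hj := le_rfl) 1 B
        (fun m s hs hs' p hp ↦ hB₂ m s hs hs' p hp.ge)
        (fun L c ↦ inf_le_left.trans ((prismBoundary_le_prismEnd _).trans hB.le)) hn ?_ N), ?_⟩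
  · change (word.{v} (n + 1) (n + 1) 0 1 _ : (prismObj.{v} (n + 1)).obj (op ⦋n + 1 + 0⦌)) ∈ _
    rw [word_zero_succ.{v} n le_rfl]
    exact hB₁ n (by omega) _
      ((word_zero_isPivot n 0 (by omega)).mem_ofSimplex _ (by simp only [N]; omega))
  · refine inf_skeleton_le fun m hm (s : PrismSimplex.{v} (n + 1) m) _ ↦ ?_
    have hpiv : ∃ j, j ≤ n + 1 ∧ s.IsPivot j := by
      by_cases h : ∃ p, s.eps p = 1
      · obtain ⟨p, hp⟩ := h
        obtain ⟨j, hj, hs, -⟩ := s.exists_isPivot p hp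
        exact ⟨j, hj, hs⟩
      · push Not at h
        exact ⟨n + 1, le_rfl, fun p ↦ ⟨fun _ ↦ by have := h p; omega, fun h ↦ by omega⟩⟩
    obtain ⟨j, hj, hs⟩ := hpiv
    obtain hj' | rfl := hj.lt_or_eq
    · exact Or.inl (hB₁ j hj' _ (hs.mem_ofSimplex _ (by simp only [N]; omega)))
    · exact Or.inr (hs.mem_ofSimplex _ (by simp only [N]; omega))

/-- Pivots are treated downwards, n, n - 1, …, 1, with first letter 0. Pivot 0 would give an outer
horn, and leaving it out is why the process ends at `prismBot n` and not at the whole prism. -/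
theorem innerExt_prismEnd_zero (n K : ℕ) :
    ∃ B, InnerExt (n + 1) (prismEnd.{v} n 0) B ∧ B ≤ prismBot n ∧
      prismBot n ⊓ (prismObj.{v} n).skeleton K ≤ B := by
  let N := 2 * (n + K) + 2
  -- After `t` pivots have been treated, level-surjective simplices have label 0 at all levels ≤ n -
  -- t.
  have key (t : ℕ) (ht : t ≤ n) : ∃ B, InnerExt (n + 1) (prismEnd.{v} n 0) B ∧ B ≤ prismBot n ∧
      (∀ j' (hj' : j' ≤ n), n < j' + t + 1 → 0 < j' → n - t < j' →
        wordComplex n j' N 0 hj' ≤ B) ∧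
      ∀ m (s : PrismSimplex.{v} n m), (s : (prismObj.{v} n).obj (op ⦋m⦌)) ∈ B.obj (op ⦋m⦌) →
        Function.Surjective s.lvl → ∀ p, (s.lvl p : ℕ) + t ≤ n → s.eps p = 0 := by
    induction t with
    | zero =>
      refine ⟨_, .refl, ?_, fun j' h₁ h₂ h₃ h₄ ↦ by omega,
        fun m s hs hs' p _ ↦ (hs.resolve_left (not_not.2 hs')) p⟩
      exact fun m s hs ↦ hs.imp id fun h p _ ↦ h p
    | succ t ih =>
      obtain ⟨B, hB, hB₀, hB₁, hB₂⟩ := ih (by omega)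
      refine ⟨_, hB.trans (innerExt_word_first (j := n - t) (hj := by omega) 0 B
        (fun m s hs hs' p hp ↦ hB₂ m s hs hs' p (by omega))
        (fun L c ↦ inf_le_left.trans ((prismBoundary_le_prismEnd _).trans hB.le)) (by omega) ?_ N),
        sup_le hB₀ ?_, ?_, ?_⟩
      · obtain _ | t := t
        · refine hB.le _ (Or.inr fun p ↦ Fin.ext ?_)
          rw [word_eps]
          simp only [Fin.val_zero]
          split_ifs <;> omega
        · have := word_zero_succ.{v} (n := n) (n - (t + 1)) (by omega)
          change (word.{v} n (n - (t + 1)) 0 0 _ : (prismObj.{v} n).obj (op ⦋n + 0⦌)) ∈ _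
          rw [← this]
          exact hB₁ (n - (t + 1) + 1) (by omega) (by omega) (by omega) (by omega) _
            ((word_zero_isPivot _ 1 (by omega)).mem_ofSimplex _ (by simp only [N]; omega))
      · rw [wordComplex_le_iff]
        refine Or.inr fun p hp ↦ (word_isPivot _ N _ _ p).1 ?_
        have hp' : ((word.{v} n (n - t) N ((0 : Fin 2) : ℕ) (by omega)).lvl p : ℕ) = 0 :=
          congr_arg Fin.val hp
        omega
      · intro j' hj' h₁ h₂ h₃
        obtain h | rfl : n - t < j' ∨ j' = n - t := by omega
        · exact (hB₁ j' hj' (by omega) h₂ h).trans le_sup_left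
        · exact le_sup_right
      · rintro m s (hs | hs) hs' p hp
        · exact hB₂ m s hs hs' p (by omega)
        · exact (isPivot_of_mem_wordComplex hs p).1 (by omega)
  obtain ⟨B, hB, hB₀, hB₁, -⟩ := key n le_rfl
  refine ⟨B, hB, hB₀, inf_skeleton_le fun m hm (s : PrismSimplex.{v} n m) hs ↦ ?_⟩
  by_cases hs₀ : Function.Surjective s.lvl
  swap
  · exact hB.le _ (Or.inl hs₀)
  by_cases h : ∃ p, s.eps p = 1
  · obtain ⟨p, hp⟩ := h
    obtain ⟨j, hj, hj', q, hq, hq'⟩ := s.exists_isPivot p hp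
    have hj₀ : 0 < j := by
      by_contra! h
      have := hs.resolve_left (not_not.2 hs₀) q (Fin.ext (by simp only [Fin.val_zero]; omega))
      rw [hq'] at this
      exact absurd this (by decide)
    exact hB₁ j hj (by omega) hj₀ (by omega) _ (hj'.mem_ofSimplex _ (by simp only [N]; omega))
  · push Not at h
    exact hB.le _ (Or.inr fun p ↦ by have := h p; omega)

/-- In `prismJoin n` every simplex has pivot 0, so a single chain of words with last letter 0 is
enough; it is inner because n > 0. -/
theorem innerExt_prismJoin (hn : 0 < n) (K : ℕ) :
    ∃ B, InnerExt (n + 1) (prismJoin.{v} n ⊓ prismBot n) B ∧ B ≤ prismJoin n ∧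
      prismJoin n ⊓ (prismObj.{v} n).skeleton K ≤ B := by
  let N := 2 * (n + K) + 2
  have hJ (L c : ℕ) : wordComplex.{v} n 0 L c (by omega) ≤ prismJoin n := by
    rw [wordComplex_le_iff]
    exact fun p hp ↦ (word_isPivot 0 L c (by omega) p).2 hp
  refine ⟨_, innerExt_word_last (hj := Nat.zero_le n) 0 (prismJoin.{v} n ⊓ prismBot n)
    (fun m s hs hs' p hp ↦ hs.2.resolve_left (not_not.2 hs') p (Fin.ext hp))
    (fun L c ↦ le_inf (inf_le_right.trans (hJ L c)) (inf_le_left.trans fun _ _ h ↦ Or.inl h)) hn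
    ⟨hJ 0 _ _ (SSet.Subcomplex.mem_ofSimplex_obj _), Or.inr fun p hp ↦ ?_⟩ N,
    sup_le inf_le_left (hJ _ _), inf_skeleton_le fun m hm (s : PrismSimplex.{v} n m) hs ↦ ?_⟩
  · have hp' := congr_arg Fin.val hp
    refine Fin.ext ?_
    rw [word_zero_lvl] at hp'
    rw [word_eps]
    simp only [Fin.val_zero] at hp' ⊢
    split_ifs <;> omega
  · have : s.IsPivot 0 := fun p ↦ ⟨fun h ↦ by omega, fun h ↦ hs p h⟩
    exact Or.inr (this.mem_ofSimplex _ (by simp only [N]; omega))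

end Chains

end DescentCat

namespace DescentCat

open Limits

/-! ### Maps from the boundary into the simplicial set of prisms -/

section Bridge

variable {n : ℕ} {Z : SSet.{v}}

/-- The simplicial set whose `n`-simplices are the maps from the prism on `Δ^n` to `Z`. -/
abbrev prismHom (Z : SSet.{v}) : SSet.{v} := prism.{v}.op ⋙ yoneda.obj Z

/-- The value of `g` on a simplex of the boundary. -/
def boundaryEval (g : (SSet.boundary.{v} n : SSet.{v}) ⟶ prismHom Z) {r : SimplexCategory}
    (κ : r ⟶ ⦋n⦌) (hκ : ¬ Function.Surjective κ.toOrderHom) : prism.{v}.obj r ⟶ Z :=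
  g.app (op r) ⟨SSet.stdSimplex.objEquiv.symm κ, hκ⟩

theorem boundaryEval_comp (g : (SSet.boundary.{v} n : SSet.{v}) ⟶ prismHom Z)
    {r r' : SimplexCategory} (φ : r' ⟶ r) (κ : r ⟶ ⦋n⦌)
    (hκ : ¬ Function.Surjective κ.toOrderHom)
    (hκ' : ¬ Function.Surjective (φ ≫ κ).toOrderHom) :
    boundaryEval g (φ ≫ κ) hκ' = prism.{v}.map φ ≫ boundaryEval g κ hκ :=
  ConcreteCategory.congr_hom (g.naturality φ.op) ⟨SSet.stdSimplex.objEquiv.symm κ, hκ⟩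

theorem boundaryEval_comp_apply (g : (SSet.boundary.{v} n : SSet.{v}) ⟶ prismHom Z)
    {r r' : SimplexCategory} (φ : r' ⟶ r) (κ : r ⟶ ⦋n⦌)
    (hκ : ¬ Function.Surjective κ.toOrderHom) {κ' : r' ⟶ ⦋n⦌} (hφ : φ ≫ κ = κ')
    (hκ' : ¬ Function.Surjective κ'.toOrderHom) (m : SimplexCategoryᵒᵖ)
    (t : PrismSimplex.{v} r'.len m.unop.len) :
    (boundaryEval g κ' hκ').app m t =
      (boundaryEval g κ hκ).app m (t.postcomp φ.toOrderHom : PrismSimplex.{v} r.len m.unop.len) := by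
  subst hφ
  rw [boundaryEval_comp g φ κ hκ]
  rfl

/-- The map to `Δ^n` classifying the levels of a simplex of the prism. -/
def PrismSimplex.lvlHom {r m : SimplexCategory} (t : PrismSimplex.{v} r.len m.len) : m ⟶ r :=
  SimplexCategory.Hom.mk t.lvl

/-- Discard the levels that do not occur, by the epi-mono factorisation of the level map; the labels
are unchanged. -/
theorem PrismSimplex.exists_epi {r m : SimplexCategory} (t : PrismSimplex.{v} r.len m.len) :
    ∃ (r₀ : SimplexCategory) (ι : r₀ ⟶ r) (t₀ : PrismSimplex.{v} r₀.len m.len), Mono ι ∧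
      Epi t₀.lvlHom ∧ t₀.postcomp ι.toOrderHom = t := by
  have h : factorThruImage t.lvlHom ≫ image.ι t.lvlHom = t.lvlHom := image.fac _
  refine ⟨image t.lvlHom, image.ι t.lvlHom, ⟨t.eps, (factorThruImage t.lvlHom).toOrderHom, ?_⟩,
    inferInstance, (inferInstance : Epi (factorThruImage t.lvlHom)), ?_⟩
  · intro p q hpq
    refine t.compat p q ?_
    have hmono : StrictMono (image.ι t.lvlHom).toOrderHom :=
      (image.ι t.lvlHom).toOrderHom.monotone.strictMono_of_injective
        (SimplexCategory.mono_iff_injective.1 inferInstance)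
    have h' (x) : t.lvl x = (image.ι t.lvlHom).toOrderHom
      ((factorThruImage t.lvlHom).toOrderHom x) :=
      congr_arg (fun f : m ⟶ r ↦ f.toOrderHom x) h.symm
    rw [h', h']
    exact hmono hpq
  · exact PrismSimplex.ext rfl (congr_arg (fun f : m ⟶ r ↦ f.toOrderHom) h)

theorem not_surjective_of_postcomp {r m : SimplexCategory} {κ : r ⟶ ⦋n⦌}
    {t : PrismSimplex.{v} r.len m.len} (ht : Epi t.lvlHom)
    (h : ¬ Function.Surjective (t.postcomp κ.toOrderHom).lvl) :
    ¬ Function.Surjective κ.toOrderHom := fun h' ↦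
  h (h'.comp (SimplexCategory.epi_iff_surjective.1 ht))

/-- After unused levels of `t` are discarded, a section of its level map shows that ι ≫ μ factors
through the monomorphism μ'. Hence the value on a simplex over the boundary is independent of the
factorisation used to compute it. -/
theorem boundaryEval_eq (g : (SSet.boundary.{v} n : SSet.{v}) ⟶ prismHom Z)
    {r r' : SimplexCategory} (μ : r ⟶ ⦋n⦌) (hμ : ¬ Function.Surjective μ.toOrderHom)
    (μ' : r' ⟶ ⦋n⦌) (hμ' : ¬ Function.Surjective μ'.toOrderHom) [Mono μ'] (m : SimplexCategoryᵒᵖ)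
    (t : PrismSimplex.{v} r.len m.unop.len) (t' : PrismSimplex.{v} r'.len m.unop.len)
    (h : t.postcomp μ.toOrderHom = t'.postcomp μ'.toOrderHom) :
    (boundaryEval g μ hμ).app m t = (boundaryEval g μ' hμ').app m t' := by
  obtain ⟨r₀, ι, t₀, -, ht₀, rfl⟩ := t.exists_epi
  have := isSplitEpi_of_epi t₀.lvlHom
  have hl : t₀.lvlHom ≫ ι ≫ μ = t'.lvlHom ≫ μ' := by
    exact SimplexCategory.Hom.ext _ _ (congr_arg PrismSimplex.lvl h :)
  have h₁ : (section_ t₀.lvlHom ≫ t'.lvlHom) ≫ μ' = ι ≫ μ := by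
    rw [Category.assoc, ← hl, IsSplitEpi.id_assoc]
  have h₂ : t₀.lvlHom ≫ section_ t₀.lvlHom ≫ t'.lvlHom = t'.lvlHom := by
    rw [← cancel_mono μ', Category.assoc, h₁, hl]
  have h₃ : t₀.postcomp (section_ t₀.lvlHom ≫ t'.lvlHom).toOrderHom = t' :=
    PrismSimplex.ext (congr_arg PrismSimplex.eps h :)
      (congr_arg (fun f : m.unop ⟶ r' ↦ f.toOrderHom) h₂)
  have hι : ¬ Function.Surjective (ι ≫ μ).toOrderHom := fun h ↦ hμ (Function.Surjective.of_comp h)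
  rw [← boundaryEval_comp_apply g ι μ hμ rfl hι, boundaryEval_comp_apply g _ μ' hμ' h₁ hι, h₃]

theorem exists_factor_of_mem_prismBoundary {m : SimplexCategoryᵒᵖ}
    (s : (prismBoundary.{v} n : SSet.{v}).obj m) :
    ∃ (r : SimplexCategory) (μ : r ⟶ ⦋n⦌) (_ : ¬ Function.Surjective μ.toOrderHom)
      (t : PrismSimplex.{v} r.len m.unop.len), Mono μ ∧ t.postcomp μ.toOrderHom = s.1 := by
  obtain ⟨s, hs⟩ := s
  obtain ⟨r, μ, t, hμ, ht, rfl⟩ := PrismSimplex.exists_epi (r := ⦋n⦌) (m := m.unop) s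
  exact ⟨r, μ, not_surjective_of_postcomp ht hs, t, hμ, rfl⟩

/-- A map from the boundary of `Δ^n` to the simplicial set of maps from prisms to `Z` is the same
as a map from the part of the prism over the boundary to `Z`. -/
noncomputable def prismBoundaryDesc (g : (SSet.boundary.{v} n : SSet.{v}) ⟶ prismHom Z) :
    (prismBoundary.{v} n : SSet.{v}) ⟶ Z where
  app m := ↾fun s ↦
    let h := exists_factor_of_mem_prismBoundary s
    (boundaryEval g h.choose_spec.choose h.choose_spec.choose_spec.choose).app m
      h.choose_spec.choose_spec.choose_spec.choose
  naturality m m' θ := by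
    refine ConcreteCategory.hom_ext _ _ fun s ↦ ?_
    have h := exists_factor_of_mem_prismBoundary s
    have h' := exists_factor_of_mem_prismBoundary ((prismBoundary.{v} n : SSet.{v}).map θ s)
    have := h'.choose_spec.choose_spec.choose_spec.choose_spec.1
    refine Eq.trans ?_ (ConcreteCategory.congr_hom ((boundaryEval g h.choose_spec.choose
      h.choose_spec.choose_spec.choose).naturality θ)
      h.choose_spec.choose_spec.choose_spec.choose)
    refine (boundaryEval_eq g h.choose_spec.choose h.choose_spec.choose_spec.choose
      h'.choose_spec.choose h'.choose_spec.choose_spec.choose m'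
      (h.choose_spec.choose_spec.choose_spec.choose.precomp θ.unop.toOrderHom) _ ?_).symm
    refine Eq.trans ?_ h'.choose_spec.choose_spec.choose_spec.choose_spec.2.symm
    exact congr_arg (fun u : PrismSimplex.{v} n m.unop.len ↦ u.precomp θ.unop.toOrderHom)
      h.choose_spec.choose_spec.choose_spec.choose_spec.2

theorem prismBoundaryDesc_apply (g : (SSet.boundary.{v} n : SSet.{v}) ⟶ prismHom Z)
    {r : SimplexCategory} (κ : r ⟶ ⦋n⦌) (hκ : ¬ Function.Surjective κ.toOrderHom)
    (m : SimplexCategoryᵒᵖ) (t : PrismSimplex.{v} r.len m.unop.len)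
    (s : (prismBoundary.{v} n : SSet.{v}).obj m) (hs : t.postcomp κ.toOrderHom = s.1) :
    (prismBoundaryDesc g).app m s = (boundaryEval g κ hκ).app m t := by
  have h := exists_factor_of_mem_prismBoundary s
  have := h.choose_spec.choose_spec.choose_spec.choose_spec.1
  exact (boundaryEval_eq g κ hκ h.choose_spec.choose h.choose_spec.choose_spec.choose m t _
    (hs.trans h.choose_spec.choose_spec.choose_spec.choose_spec.2.symm)).symm

theorem prismBoundaryDesc_injective :
    Function.Injective (prismBoundaryDesc : ((SSet.boundary.{v} n : SSet.{v}) ⟶ prismHom Z) → _) := by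
  intro g g' h
  ext ⟨r⟩ ⟨κ, hκ⟩
  obtain ⟨κ, rfl⟩ := SSet.stdSimplex.objEquiv.symm.surjective κ
  refine NatTrans.ext (funext fun m ↦ ConcreteCategory.hom_ext _ _
    fun (t : PrismSimplex.{v} r.len m.unop.len) ↦ ?_)
  have hs : t.postcomp κ.toOrderHom ∈ (prismBoundary.{v} n).obj m :=
    fun h ↦ hκ (Function.Surjective.of_comp (f := κ.toOrderHom) h)
  exact (prismBoundaryDesc_apply g κ hκ m t ⟨_, hs⟩ rfl).symm.trans
    ((ConcreteCategory.congr_hom (congr_app h m) _).trans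
      (prismBoundaryDesc_apply g' κ hκ m t ⟨_, hs⟩ rfl))

theorem prismBoundaryDesc_restrict (b : prismObj.{v} n ⟶ Z) :
    prismBoundaryDesc ((SSet.boundary.{v} n).ι ≫ (SSet.yonedaEquiv (X := prismHom Z)).symm b) =
      (prismBoundary n).ι ≫ b := by
  ext m s
  obtain ⟨r, μ, hμ, t, -, hs⟩ := exists_factor_of_mem_prismBoundary s
  exact (prismBoundaryDesc_apply _ μ hμ m t s hs).trans
    (congr_arg (fun u : PrismSimplex.{v} n m.unop.len ↦ b.app m u) hs)

theorem prismBoundaryDesc_comp {Z' : SSet.{v}} (z : Z ⟶ Z')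
    (g : (SSet.boundary.{v} n : SSet.{v}) ⟶ prismHom Z) :
    prismBoundaryDesc (g ≫ Functor.whiskerLeft prism.{v}.op (yoneda.map z)) =
      prismBoundaryDesc g ≫ z := rfl

end Bridge

end DescentCat

namespace DescentCat

open Limits

/-! ### The two ends of the prism -/

section Sections

/-- The copy of `Δ^n` with label `e` in the prism. -/
def prismSection (e : Fin 2) (n : SimplexCategory) :
    SSet.stdSimplex.{v}.obj n ⟶ prism.{v}.obj n where
  app m := ↾fun s ↦
    (⟨fun _ ↦ e, (SSet.stdSimplex.objEquiv s).toOrderHom, fun _ _ _ ↦ le_rfl⟩ :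
      PrismSimplex.{v} n.len m.unop.len)

/-- The projection from the prism to `Δ^n`. -/
def prismProj (n : SimplexCategory) : prism.{v}.obj n ⟶ SSet.stdSimplex.{v}.obj n where
  app m := ↾fun (s : PrismSimplex.{v} n.len m.unop.len) ↦
    SSet.stdSimplex.objEquiv.symm (SimplexCategory.Hom.mk s.lvl)

theorem prismSection_naturality (e : Fin 2) {n n' : SimplexCategory} (φ : n ⟶ n') :
    SSet.stdSimplex.{v}.map φ ≫ prismSection e n' = prismSection e n ≫ prism.{v}.map φ := rfl

variable (e : Fin 2) (n : ℕ)

/-- The copy of the boundary of `Δ^n` with label `e` in the part of the prism over the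
boundary. -/
def boundarySection : (SSet.boundary.{v} n : SSet.{v}) ⟶ (prismBoundary.{v} n : SSet.{v}) :=
  SSet.Subcomplex.lift ((SSet.boundary.{v} n).ι ≫ prismSection e ⦋n⦌) (by
    rintro m _ ⟨s, rfl⟩
    exact s.2)

/-- The copy of `Δ^n` with label `e` in `prismEnd n e`. -/
def prismEndSection : Δ[n] ⟶ (prismEnd.{v} n e : SSet.{v}) :=
  SSet.Subcomplex.lift (prismSection e ⦋n⦌) (by
    rintro m _ ⟨s, rfl⟩
    exact Or.inr fun _ ↦ rfl)

theorem isPushout_prismEnd : IsPushout (boundarySection.{v} e n) (SSet.boundary.{v} n).ι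
    (SSet.Subcomplex.homOfLE (prismBoundary_le_prismEnd.{v} e)) (prismEndSection e n) := by
  refine isPushout_attach (prismBoundary.{v} n) (prismEnd n e) (prismSection e ⦋n⦌)
    (SSet.boundary.{v} n) rfl ?_ ?_
  · intro m s t _ h
    refine SSet.stdSimplex.objEquiv.injective (SimplexCategory.Hom.ext _ _ ?_)
    exact (congr_arg PrismSimplex.lvl h :)
  · refine le_antisymm (sup_le (prismBoundary_le_prismEnd e) ?_) ?_
    · rintro m _ ⟨s, rfl⟩
      exact Or.inr fun _ ↦ rfl
    · rintro m s (hs | hs)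
      · exact Or.inl hs
      · refine Or.inr ⟨SSet.stdSimplex.objEquiv.symm (SimplexCategory.Hom.mk
          (PrismSimplex.lvl s)), ?_⟩
        exact PrismSimplex.ext (funext fun p ↦ (hs p).symm) rfl

end Sections

/-! ### Simplicial spaces and their functors of points -/

section Points

variable {V : Type u} [Category.{v} V] {X Y P : SimplicialObject V}

/-- Yoneda in each simplicial degree: the morphism is the value of `τ` at the universal point. -/
theorem exists_pointsMap (τ : points P ⟶ points X) : ∃ p : P ⟶ X, pointsMap p = τ := by
  have key (A : Vᵒᵖ) (n : SimplexCategoryᵒᵖ) (x : A.unop ⟶ P.obj n) :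
      (τ.app A).app n x =
        (x ≫ (τ.app (op (P.obj n))).app n (𝟙 (P.obj n)) : A.unop ⟶ X.obj n) := by
    have := ConcreteCategory.congr_hom (congr_app (τ.naturality x.op) n) (𝟙 (P.obj n))
    refine Eq.trans ?_ this
    exact congr_arg ((τ.app A).app n) (Category.comp_id x).symm
  refine ⟨{ app n := (τ.app (op (P.obj n))).app n (𝟙 (P.obj n)), naturality := ?_ }, ?_⟩
  · intro n m θ
    refine (key (op (P.obj n)) m (P.map θ)).symm.trans ?_
    refine Eq.trans ?_
      (ConcreteCategory.congr_hom ((τ.app (op (P.obj n))).naturality θ) (𝟙 (P.obj n)))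
    exact congr_arg ((τ.app (op (P.obj n))).app m) (Category.id_comp (P.map θ)).symm
  · ext A n x
    exact (key A n x).symm

theorem pointsMap_injective : Function.Injective (pointsMap : (P ⟶ X) → _) := by
  intro p p' h
  ext n
  have := ConcreteCategory.congr_hom (congr_app (congr_app h (op (P.obj n))) n) (𝟙 (P.obj n))
  exact (Category.id_comp (p.app n)).symm.trans (this.trans (Category.id_comp (p'.app n)))

theorem exists_points_iso (F : SimplexCategoryᵒᵖ ⥤ Vᵒᵖ ⥤ Type v)
    (hF : ∀ n, (F.obj n).IsRepresentable) :
    ∃ P : SimplicialObject V, Nonempty (points P ≅ F.flip) := by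
  let P : SimplicialObject V :=
    { obj n := (F.obj n).reprX
      map θ := yoneda.preimage ((F.obj _).reprW.hom ≫ F.map θ ≫ (F.obj _).reprW.inv)
      map_id n := yoneda.map_injective (by simp)
      map_comp θ θ' := yoneda.map_injective (by simp) }
  have hP {n m : SimplexCategoryᵒᵖ} (θ : n ⟶ m) :
      yoneda.map (P.map θ) ≫ (F.obj m).reprW.hom = (F.obj n).reprW.hom ≫ F.map θ := by
    simp [P]
  refine ⟨P, ⟨NatIso.ofComponents (fun A ↦ NatIso.ofComponents
    (fun n ↦ (F.obj n).reprW.app A) ?_) ?_⟩⟩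
  · intro n m θ
    exact congr_app (hP θ) A
  · intro A B h
    ext n x
    exact ConcreteCategory.congr_hom ((F.obj n).reprW.hom.naturality h) x

end Points

/-! ### The path space of a morphism -/

section PathSpace

variable {V : Type u} [Category.{v} V] {X Y : SimplicialObject V} (f : X ⟶ Y)

/-- The simplicial presheaf whose `n`-simplices are `Map(Δ^n → prism, f)`. -/
def pathFunctor : SimplexCategoryᵒᵖ ⥤ Vᵒᵖ ⥤ Type v where
  obj n := RelMap (prismSection 1 n.unop) f
  map φ := relRestrict _ _ (SSet.stdSimplex.{v}.map φ.unop) (prism.{v}.map φ.unop)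
    (prismSection_naturality 1 φ.unop) f
  map_id n := by
    ext A x
    refine relMap_ext ?_ ?_
    · exact (congr_arg (· ≫ RelPoint.fst x)
        (CategoryTheory.Functor.map_id SSet.stdSimplex n.unop)).trans (Category.id_comp _)
    · exact (congr_arg (· ≫ RelPoint.snd x)
        (CategoryTheory.Functor.map_id prism n.unop)).trans (Category.id_comp _)
  map_comp φ φ' := by
    ext A x
    refine relMap_ext ?_ ?_
    · exact (congr_arg (· ≫ RelPoint.fst x)
        (SSet.stdSimplex.map_comp φ'.unop φ.unop)).trans (Category.assoc _ _ _)
    · exact (congr_arg (· ≫ RelPoint.snd x)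
        (prism.map_comp φ'.unop φ.unop)).trans (Category.assoc _ _ _)

/-- The functor of points of the path space of `f`. -/
abbrev pathSpace : Vᵒᵖ ⥤ SSet.{v} := (pathFunctor f).flip

/-- The projection from the path space of `f : X ⟶ Y` to `X`. -/
def pathFst : pathSpace f ⟶ points X where
  app A :=
    { app n := ↾fun (z : RelPoint (prismSection 1 n.unop) f A) ↦
        SSet.yonedaEquiv (X := (points X).obj A) z.fst
      naturality n m φ := by
        refine ConcreteCategory.hom_ext _ _ fun (z : RelPoint (prismSection 1 n.unop) f A) ↦ ?_
        exact (SSet.yonedaEquiv_naturality (X := (points X).obj A) φ.unop z.fst).symm }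
  naturality A B h := by
    ext n z
    rfl

/-- The map from the path space of `f : X ⟶ Y` to `Y` given by the end of the paths. -/
def pathSnd : pathSpace f ⟶ points Y where
  app A :=
    { app n := ↾fun (z : RelPoint (prismSection 1 n.unop) f A) ↦
        SSet.yonedaEquiv (X := (points Y).obj A) (prismSection 0 n.unop ≫ z.snd)
      naturality n m φ := by
        refine ConcreteCategory.hom_ext _ _ fun (z : RelPoint (prismSection 1 n.unop) f A) ↦ ?_
        exact (SSet.yonedaEquiv_naturality (X := (points Y).obj A) φ.unop
          (prismSection 0 n.unop ≫ z.snd)).symm }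
  naturality A B h := by
    ext n z
    rfl

/-- The underlying maps of prisms of the simplices of the path space. -/
def pathPrism (A : Vᵒᵖ) : (pathSpace f).obj A ⟶ prismHom ((points Y).obj A) where
  app n := ↾fun (z : RelPoint (prismSection 1 n.unop) f A) ↦ z.snd

/-- The constant paths. -/
def pathConst : points X ⟶ pathSpace f where
  app A :=
    { app n := ↾fun x ↦ (⟨SSet.yonedaEquiv.symm x,
          prismProj n.unop ≫ SSet.yonedaEquiv.symm x ≫ (pointsMap f).app A, rfl⟩ :
          RelPoint (prismSection 1 n.unop) f A)
      naturality n m φ := by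
        refine ConcreteCategory.hom_ext _ _ fun x ↦ ?_
        have := SSet.yonedaEquiv_symm_naturality_left (X := (points X).obj A) φ.unop x
        refine relMap_ext this.symm ?_
        change prismProj m.unop ≫ SSet.yonedaEquiv.symm (((points X).obj A).map φ.unop.op x) ≫ _ = _
        rw [← this]
        rfl }
  naturality A B h := by
    ext n x
    have h₁ : SSet.yonedaEquiv.symm (((points X).map h).app n x) =
        SSet.yonedaEquiv.symm x ≫ (points X).map h := (SSet.yonedaEquiv_symm_comp _ _).symm
    refine relMap_ext h₁ ?_
    change prismProj n.unop ≫ SSet.yonedaEquiv.symm (((points X).map h).app n x) ≫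
      (pointsMap f).app B = (prismProj n.unop ≫ SSet.yonedaEquiv.symm x ≫ (pointsMap f).app A) ≫
      (points Y).map h
    rw [h₁, Category.assoc, Category.assoc, Category.assoc, (pointsMap f).naturality h]

theorem pathConst_fst : pathConst f ≫ pathFst f = 𝟙 _ := by
  ext A n x
  exact (SSet.yonedaEquiv (X := (points X).obj A)).apply_symm_apply x

theorem pathConst_snd : pathConst f ≫ pathSnd f = pointsMap f := by
  ext A n x
  change SSet.yonedaEquiv (X := (points Y).obj A)
    ((SSet.yonedaEquiv (X := (points X).obj A)).symm x ≫ (pointsMap f).app A) = _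
  rw [SSet.yonedaEquiv_symm_comp, Equiv.apply_symm_apply]
  rfl

variable {f} {A : Vᵒᵖ}

theorem pathSpace_hom_ext {K : SSet.{v}} {G G' : K ⟶ (pathSpace f).obj A}
    (h₁ : G ≫ (pathFst f).app A = G' ≫ (pathFst f).app A)
    (h₂ : G ≫ pathPrism f A = G' ≫ pathPrism f A) : G = G' := by
  ext n x
  refine relMap_ext ?_ ?_
  · exact SSet.yonedaEquiv.injective (ConcreteCategory.congr_hom (congr_app h₁ n) x)
  · exact ConcreteCategory.congr_hom (congr_app h₂ n) x

variable {n : ℕ}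

theorem boundarySection_one_desc
    (G : (SSet.boundary.{v} n : SSet.{v}) ⟶ (pathSpace f).obj A) :
    boundarySection 1 n ≫ prismBoundaryDesc (G ≫ pathPrism f A) =
      G ≫ (pathFst f).app A ≫ (pointsMap f).app A := by
  ext r ⟨κ, hκ⟩
  obtain ⟨κ, rfl⟩ := SSet.stdSimplex.objEquiv.symm.surjective κ
  refine (prismBoundaryDesc_apply (G ≫ pathPrism f A) κ hκ r
    ((prismSection 1 r.unop).app r (SSet.stdSimplex.objEquiv.symm (𝟙 _))) _ ?_).trans ?_
  · exact PrismSimplex.ext rfl (OrderHom.ext _ _ rfl)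
  · have := RelPoint.w (G.app r ⟨SSet.stdSimplex.objEquiv.symm κ, hκ⟩ :
      RelPoint (prismSection 1 r.unop) f A)
    exact (ConcreteCategory.congr_hom (congr_app this r)
      (SSet.stdSimplex.objEquiv.symm (𝟙 _))).symm

theorem boundarySection_zero_desc
    (G : (SSet.boundary.{v} n : SSet.{v}) ⟶ (pathSpace f).obj A) :
    boundarySection 0 n ≫ prismBoundaryDesc (G ≫ pathPrism f A) = G ≫ (pathSnd f).app A := by
  ext r ⟨κ, hκ⟩
  obtain ⟨κ, rfl⟩ := SSet.stdSimplex.objEquiv.symm.surjective κ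
  refine (prismBoundaryDesc_apply (G ≫ pathPrism f A) κ hκ r
    ((prismSection 0 r.unop).app r (SSet.stdSimplex.objEquiv.symm (𝟙 _))) _ ?_).trans rfl
  exact PrismSimplex.ext rfl (OrderHom.ext _ _ rfl)

end PathSpace

end DescentCat

namespace DescentCat

open Limits

/-! ### The hypercover conditions for both projections of the path space -/

section PathObject

variable {V : Type u} [Category.{v} V] {X Y P : SimplicialObject V} {f : X ⟶ Y}
  (W : MorphismProperty (Vᵒᵖ ⥤ Type v)) [W.IsStableUnderBaseChange]

/-- The inclusion of `∂Δ^n`, with label `1`, in `prismEnd n 0`. -/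
def boundaryToPrismEnd (n : ℕ) : (SSet.boundary.{v} n : SSet.{v}) ⟶ (prismEnd.{v} n 0 : SSet.{v}) :=
  boundarySection 1 n ≫ SSet.Subcomplex.homOfLE (prismBoundary_le_prismEnd 0)

variable (ψ : points P ≅ pathSpace f) (n : ℕ)

/-- The simplices of `P` are the simplices of the path space. -/
def mapPathIso : Map (Δ[n] : SSet.{v}) P ≅ RelMap (prismSection.{v} 1 ⦋n⦌) f :=
  NatIso.ofComponents (fun A ↦ Equiv.toIso ((SSet.yonedaEquiv (X := (points P).obj A)).trans
    ((ψ.app A).app (op ⦋n⦌)).toEquiv)) (fun {A B} h ↦ by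
      refine ConcreteCategory.hom_ext _ _ fun (x : Δ[n] ⟶ (points P).obj A) ↦ ?_
      exact ConcreteCategory.congr_hom (congr_app (ψ.hom.naturality h) (op ⦋n⦌))
        (SSet.yonedaEquiv x))

variable {n} {A : Vᵒᵖ}

theorem yonedaEquiv_comp_pathFst (x : Δ[n] ⟶ (pathSpace f).obj A) :
    RelPoint.fst (SSet.yonedaEquiv x : RelPoint (prismSection.{v} 1 ⦋n⦌) f A) =
      x ≫ (pathFst f).app A := by
  apply SSet.yonedaEquiv.injective
  exact (SSet.yonedaEquiv_comp x ((pathFst f).app A)).symm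

theorem prismSection_zero_comp (x : Δ[n] ⟶ (pathSpace f).obj A) :
    prismSection 0 ⦋n⦌ ≫
      RelPoint.snd (SSet.yonedaEquiv x : RelPoint (prismSection.{v} 1 ⦋n⦌) f A) =
      x ≫ (pathSnd f).app A := by
  apply SSet.yonedaEquiv.injective
  exact (SSet.yonedaEquiv_comp x ((pathSnd f).app A)).symm

theorem prismBoundaryDesc_of_simplex (x : Δ[n] ⟶ (pathSpace f).obj A) :
    prismBoundaryDesc (((SSet.boundary.{v} n).ι ≫ x) ≫ pathPrism f A) =
      (prismBoundary n).ι ≫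
        RelPoint.snd (SSet.yonedaEquiv x : RelPoint (prismSection.{v} 1 ⦋n⦌) f A) := by
  rw [← prismBoundaryDesc_restrict]
  congr 1
  rw [Category.assoc]
  congr 1
  apply SSet.yonedaEquiv.injective
  rw [Equiv.apply_symm_apply, SSet.yonedaEquiv_comp]
  rfl

theorem prismBoundaryDesc_naturality {B : Vᵒᵖ} (h : A ⟶ B)
    (g : (SSet.boundary.{v} n : SSet.{v}) ⟶ (points P).obj A) :
    prismBoundaryDesc (((g ≫ (points P).map h) ≫ ψ.hom.app B) ≫ pathPrism f B) =
      prismBoundaryDesc ((g ≫ ψ.hom.app A) ≫ pathPrism f A) ≫ (points Y).map h := by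
  rw [← prismBoundaryDesc_comp]
  congr 1
  rw [Category.assoc g, ψ.hom.naturality h]
  rfl

section Fst

variable {p : P ⟶ X} (hp : pointsMap p = ψ.hom ≫ pathFst f)

include hp

theorem pointsMap_fst_app (A : Vᵒᵖ) :
    (pointsMap p).app A = ψ.hom.app A ≫ (pathFst f).app A := by
  rw [hp]
  rfl

theorem pathFst_glue (x : RelPoint (SSet.boundary.{v} n).ι p A) :
    boundarySection 1 n ≫ prismBoundaryDesc ((x.fst ≫ ψ.hom.app A) ≫ pathPrism f A) =
      (SSet.boundary.{v} n).ι ≫ x.snd ≫ (pointsMap f).app A := by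
  have h₁ := boundarySection_one_desc (f := f) (x.fst ≫ ψ.hom.app A)
  have h₂ : (x.fst ≫ ψ.hom.app A) ≫ (pathFst f).app A ≫ (pointsMap f).app A =
      (x.fst ≫ (pointsMap p).app A) ≫ (pointsMap f).app A := by
    rw [pointsMap_fst_app ψ hp]
    simp only [Category.assoc]
  rw [h₁, h₂, x.w, Category.assoc]

/-- The map from `prismEnd n 1` to `Y` defined by a point of `Map(∂Δ^n → Δ^n, p)`. -/
noncomputable def fstGlue : RelMap (SSet.boundary.{v} n).ι p ⟶
    Map (prismEnd.{v} n 1 : SSet.{v}) Y where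
  app A := ↾fun (x : RelPoint (SSet.boundary.{v} n).ι p A) ↦
    (isPushout_prismEnd 1 n).desc
      (prismBoundaryDesc ((x.fst ≫ ψ.hom.app A) ≫ pathPrism f A))
      (x.snd ≫ (pointsMap f).app A) (pathFst_glue ψ hp x)
  naturality A B h := by
    refine ConcreteCategory.hom_ext _ _ fun (x : RelPoint (SSet.boundary.{v} n).ι p A) ↦ ?_
    refine (isPushout_prismEnd 1 n).hom_ext (W := (points Y).obj B) ?_ ?_
    · refine ((isPushout_prismEnd 1 n).inl_desc _ _ _).trans ?_
      refine (prismBoundaryDesc_naturality ψ h x.fst).trans ?_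
      exact ((congr_arg (· ≫ (points Y).map h)
        ((isPushout_prismEnd 1 n).inl_desc _ _ (pathFst_glue ψ hp x))).symm.trans
          (Category.assoc _ _ _) :)
    · refine ((isPushout_prismEnd 1 n).inr_desc _ _ _).trans ?_
      refine Eq.trans ?_ ((congr_arg (· ≫ (points Y).map h)
        ((isPushout_prismEnd 1 n).inr_desc _ _ (pathFst_glue ψ hp x))).symm.trans
          (Category.assoc _ _ _) :)
      change (x.snd ≫ (points X).map h) ≫ _ = (x.snd ≫ _) ≫ _
      rw [Category.assoc, Category.assoc, (pointsMap f).naturality h]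

/-- An n-simplex of `P` over given data in `X` is a map from the whole prism to `Y`. Its boundary
prescribes the part over ∂Δ^n, and its image in `X` prescribes the end with label 1; together these
form `prismEnd n 1`. -/
theorem isPullback_fstGlue :
    IsPullback ((mapPathIso ψ n).hom ≫ relSnd (prismSection.{v} 1 ⦋n⦌) f)
      (toRelMap (SSet.boundary.{v} n).ι p) (restrict (prismEnd.{v} n 1).ι Y)
      (fstGlue ψ hp) := by
  refine isPullback_of_existsUnique ?_ ?_ ?_
  · ext A x
    change Δ[n] ⟶ (points P).obj A at x
    let z : RelPoint (prismSection.{v} 1 ⦋n⦌) f A := SSet.yonedaEquiv (x ≫ ψ.hom.app A)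
    have hz : z.fst = x ≫ (pointsMap p).app A := by
      rw [pointsMap_fst_app ψ hp, ← Category.assoc]
      exact yonedaEquiv_comp_pathFst _
    refine (isPushout_prismEnd 1 n).hom_ext (W := (points Y).obj A) ?_ ?_
    · refine Eq.trans ?_ ((isPushout_prismEnd 1 n).inl_desc _ _ _).symm
      exact (prismBoundaryDesc_of_simplex (x ≫ ψ.hom.app A)).symm
    · refine Eq.trans ?_ ((isPushout_prismEnd 1 n).inr_desc _ _ _).symm
      change prismSection 1 ⦋n⦌ ≫ z.snd = (x ≫ (pointsMap p).app A) ≫ (pointsMap f).app A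
      rw [← z.w, hz]
  · intro A (x : Δ[n] ⟶ (points P).obj A) (y : Δ[n] ⟶ (points P).obj A) h₁ h₂
    apply (isIso_iff_bijective ((mapPathIso ψ n).hom.app A)).1 inferInstance |>.1
    refine relMap_ext ?_ h₁
    have h₃ : x ≫ (pointsMap p).app A = y ≫ (pointsMap p).app A := (relMap_congr_snd h₂ :)
    rw [pointsMap_fst_app ψ hp, ← Category.assoc, ← Category.assoc] at h₃
    exact (yonedaEquiv_comp_pathFst _).trans (h₃.trans (yonedaEquiv_comp_pathFst _).symm)
  · intro A (b : prismObj n ⟶ (points Y).obj A) (x : RelPoint (SSet.boundary.{v} n).ι p A) hbx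
    have hb₁ : (prismBoundary n).ι ≫ b =
        prismBoundaryDesc ((x.fst ≫ ψ.hom.app A) ≫ pathPrism f A) :=
      (congr_arg (SSet.Subcomplex.homOfLE (prismBoundary_le_prismEnd 1) ≫ ·) hbx :).trans
        ((isPushout_prismEnd 1 n).inl_desc _ _ (pathFst_glue ψ hp x))
    have hb₂ : prismSection 1 ⦋n⦌ ≫ b = x.snd ≫ (pointsMap f).app A :=
      (congr_arg (prismEndSection 1 n ≫ ·) hbx :).trans
        ((isPushout_prismEnd 1 n).inr_desc _ _ (pathFst_glue ψ hp x))
    let z : RelPoint (prismSection.{v} 1 ⦋n⦌) f A := ⟨x.snd, b, hb₂.symm⟩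
    let y : Δ[n] ⟶ (pathSpace f).obj A := (SSet.yonedaEquiv (X := (pathSpace f).obj A)).symm z
    have hy : SSet.yonedaEquiv y = z := Equiv.apply_symm_apply _ _
    have hy₁ : y ≫ (pathFst f).app A = x.snd := by
      rw [← yonedaEquiv_comp_pathFst, hy]
    have hy₂ : (y ≫ ψ.inv.app A) ≫ ψ.hom.app A = y := by simp
    refine ⟨(y ≫ ψ.inv.app A : Δ[n] ⟶ (points P).obj A), ?_, relMap_ext ?_ ?_⟩
    · change RelPoint.snd (SSet.yonedaEquiv ((y ≫ ψ.inv.app A) ≫ ψ.hom.app A) :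
        RelPoint (prismSection.{v} 1 ⦋n⦌) f A) = b
      rw [hy₂, hy]
    · change (SSet.boundary n).ι ≫ y ≫ ψ.inv.app A = x.fst
      rw [← cancel_mono (ψ.hom.app A), Category.assoc, hy₂]
      apply pathSpace_hom_ext
      · rw [Category.assoc, hy₁, Category.assoc, ← pointsMap_fst_app ψ hp, x.w]
      · apply prismBoundaryDesc_injective
        rw [prismBoundaryDesc_of_simplex, hy, hb₁]
    · change (y ≫ ψ.inv.app A) ≫ (pointsMap p).app A = x.snd
      rw [pointsMap_fst_app ψ hp, ← Category.assoc, hy₂, hy₁]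

theorem toRelMap_fst_mem (h : W (restrict (prismEnd.{v} n 1).ι Y)) :
    W (toRelMap (SSet.boundary.{v} n).ι p) :=
  W.of_isPullback (isPullback_fstGlue ψ hp) h

end Fst

section Snd

variable {q : P ⟶ Y} (hq : pointsMap q = ψ.hom ≫ pathSnd f)

include hq

theorem pointsMap_snd_app (A : Vᵒᵖ) :
    (pointsMap q).app A = ψ.hom.app A ≫ (pathSnd f).app A := by
  rw [hq]
  rfl

theorem pathSnd_glue (x : RelPoint (SSet.boundary.{v} n).ι q A) :
    boundarySection 0 n ≫ prismBoundaryDesc ((x.fst ≫ ψ.hom.app A) ≫ pathPrism f A) =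
      (SSet.boundary.{v} n).ι ≫ x.snd := by
  rw [boundarySection_zero_desc, Category.assoc, ← pointsMap_snd_app ψ hq, x.w]

theorem sndGlue_w (x : RelPoint (SSet.boundary.{v} n).ι q A) :
    ((x.fst ≫ ψ.hom.app A) ≫ (pathFst f).app A) ≫ (pointsMap f).app A =
      boundaryToPrismEnd n ≫ (isPushout_prismEnd 0 n).desc
        (prismBoundaryDesc ((x.fst ≫ ψ.hom.app A) ≫ pathPrism f A)) x.snd
        (pathSnd_glue ψ hq x) := by
  have h : boundarySection 1 n ≫ SSet.Subcomplex.homOfLE (prismBoundary_le_prismEnd 0) ≫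
      (isPushout_prismEnd 0 n).desc (prismBoundaryDesc ((x.fst ≫ ψ.hom.app A) ≫ pathPrism f A))
        x.snd (pathSnd_glue ψ hq x) =
      boundarySection 1 n ≫ prismBoundaryDesc ((x.fst ≫ ψ.hom.app A) ≫ pathPrism f A) :=
    congr_arg (boundarySection 1 n ≫ ·)
      ((isPushout_prismEnd 0 n).inl_desc _ _ (pathSnd_glue ψ hq x))
  exact (Category.assoc _ _ _).trans
    ((boundarySection_one_desc (f := f) (x.fst ≫ ψ.hom.app A)).symm.trans h.symm)

/-- The point of `Map(∂Δ^n → prismEnd n 0, f)` defined by a point of `Map(∂Δ^n → Δ^n, q)`. -/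
noncomputable def sndGlue : RelMap (SSet.boundary.{v} n).ι q ⟶
    RelMap (boundaryToPrismEnd.{v} n) f where
  app A := ↾fun (x : RelPoint (SSet.boundary.{v} n).ι q A) ↦
    (⟨(x.fst ≫ ψ.hom.app A) ≫ (pathFst f).app A, (isPushout_prismEnd 0 n).desc
      (prismBoundaryDesc ((x.fst ≫ ψ.hom.app A) ≫ pathPrism f A)) x.snd
      (pathSnd_glue ψ hq x), sndGlue_w ψ hq x⟩ : RelPoint (boundaryToPrismEnd.{v} n) f A)
  naturality A B h := by
    refine ConcreteCategory.hom_ext _ _ fun (x : RelPoint (SSet.boundary.{v} n).ι q A) ↦ ?_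
    refine relMap_ext ?_ ((isPushout_prismEnd 0 n).hom_ext (W := (points Y).obj B) ?_ ?_)
    · change ((x.fst ≫ (points P).map h) ≫ ψ.hom.app B) ≫ (pathFst f).app B =
        ((x.fst ≫ ψ.hom.app A) ≫ (pathFst f).app A) ≫ (points X).map h
      rw [Category.assoc x.fst, ψ.hom.naturality h, Category.assoc, Category.assoc,
        (pathFst f).naturality h, Category.assoc, Category.assoc]
    · refine ((isPushout_prismEnd 0 n).inl_desc _ _ _).trans ?_
      refine (prismBoundaryDesc_naturality ψ h x.fst).trans ?_
      exact ((congr_arg (· ≫ (points Y).map h)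
        ((isPushout_prismEnd 0 n).inl_desc _ _ (pathSnd_glue ψ hq x))).symm.trans
          (Category.assoc _ _ _) :)
    · refine ((isPushout_prismEnd 0 n).inr_desc _ _ _).trans ?_
      exact ((congr_arg (· ≫ (points Y).map h)
        ((isPushout_prismEnd 0 n).inr_desc _ _ (pathSnd_glue ψ hq x))).symm.trans
          (Category.assoc _ _ _) :)

/-- Here the end with label 0 is prescribed by the n-simplex of `Y`, while the n-simplex of `X` is
known only on its boundary. The target is therefore a relative mapping space for `f`. -/
theorem isPullback_sndGlue (w : (SSet.boundary.{v} n).ι ≫ prismSection 1 ⦋n⦌ =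
    boundaryToPrismEnd n ≫ (prismEnd n 0).ι) :
    IsPullback (mapPathIso ψ n).hom
      (toRelMap (SSet.boundary.{v} n).ι q)
      (relRestrict (prismSection.{v} 1 ⦋n⦌) (boundaryToPrismEnd n) (SSet.boundary n).ι
        (prismEnd n 0).ι w f) (sndGlue ψ hq) := by
  have hw : (mapPathIso ψ n).hom ≫ relRestrict (prismSection.{v} 1 ⦋n⦌) (boundaryToPrismEnd n)
      (SSet.boundary n).ι (prismEnd n 0).ι w f =
      toRelMap (SSet.boundary.{v} n).ι q ≫ sndGlue ψ hq := by
    ext A x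
    change Δ[n] ⟶ (points P).obj A at x
    refine relMap_ext ?_ ((isPushout_prismEnd 0 n).hom_ext (W := (points Y).obj A) ?_ ?_)
    · exact (congr_arg ((SSet.boundary n).ι ≫ ·)
        (yonedaEquiv_comp_pathFst (f := f) (x ≫ ψ.hom.app A)) :)
    · refine Eq.trans ?_ ((isPushout_prismEnd 0 n).inl_desc _ _ _).symm
      exact (prismBoundaryDesc_of_simplex (x ≫ ψ.hom.app A)).symm
    · refine Eq.trans ?_ ((isPushout_prismEnd 0 n).inr_desc _ _ _).symm
      change _ = x ≫ (pointsMap q).app A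
      rw [pointsMap_snd_app ψ hq, ← Category.assoc]
      exact prismSection_zero_comp (f := f) (x ≫ ψ.hom.app A)
  -- Given that `mapPathIso` is an isomorphism, injectivity of `sndGlue` reduces the pullback
  -- property to commutativity of the square.
  have hinj (A) (x y : (RelMap (SSet.boundary.{v} n).ι q).obj A)
      (h : (sndGlue ψ hq).app A x = (sndGlue ψ hq).app A y) : x = y := by
    change RelPoint (SSet.boundary.{v} n).ι q A at x y
    have h₁ : (x.fst ≫ ψ.hom.app A) ≫ (pathFst f).app A =
      (y.fst ≫ ψ.hom.app A) ≫ (pathFst f).app A := (relMap_congr_fst h :)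
    have h₂ : (isPushout_prismEnd 0 n).desc _ _ (pathSnd_glue ψ hq x) =
        (isPushout_prismEnd 0 n).desc _ _ (pathSnd_glue ψ hq y) := (relMap_congr_snd h :)
    refine relMap_ext ?_ ?_
    · rw [← cancel_mono (ψ.hom.app A)]
      refine pathSpace_hom_ext h₁ (prismBoundaryDesc_injective ?_)
      exact ((isPushout_prismEnd 0 n).inl_desc _ _ (pathSnd_glue ψ hq x)).symm.trans
        ((congr_arg (SSet.Subcomplex.homOfLE (prismBoundary_le_prismEnd 0) ≫ ·) h₂ :).trans
          ((isPushout_prismEnd 0 n).inl_desc _ _ (pathSnd_glue ψ hq y)))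
    · exact ((isPushout_prismEnd 0 n).inr_desc _ _ (pathSnd_glue ψ hq x)).symm.trans
        ((congr_arg (prismEndSection 0 n ≫ ·) h₂ :).trans
          ((isPushout_prismEnd 0 n).inr_desc _ _ (pathSnd_glue ψ hq y)))
  refine isPullback_of_existsUnique hw (fun A x y h _ ↦ ?_) fun A x y h ↦ ?_
  · exact (bijective_of_isIso (mapPathIso ψ n).hom A).1 h
  · obtain ⟨z, hz⟩ := (bijective_of_isIso (mapPathIso ψ n).hom A).2 x
    subst hz
    have hz := ConcreteCategory.congr_hom (congr_app hw A) z
    have h' := hz.symm.trans h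
    exact ⟨z, rfl, hinj A _ _ h'⟩

theorem toRelMap_snd_mem (w : (SSet.boundary.{v} n).ι ≫ prismSection 1 ⦋n⦌ =
    boundaryToPrismEnd n ≫ (prismEnd n 0).ι)
    (h : W (relRestrict (prismSection.{v} 1 ⦋n⦌) (boundaryToPrismEnd n) (SSet.boundary n).ι
        (prismEnd n 0).ι w f)) :
    W (toRelMap (SSet.boundary.{v} n).ι q) :=
  W.of_isPullback (isPullback_sndGlue ψ hq w) h

end Snd

end PathObject

end DescentCat

namespace DescentCat

open Limits

/-! ### Degreewise finiteness -/

section Finiteness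

instance finite_orderHom (a b : ℕ) : Finite (Fin a →o Fin b) :=
  Finite.of_injective _ DFunLike.coe_injective

instance (n m : ℕ) : Finite (PrismSimplex.{v} n m) :=
  Finite.of_injective (β := (Fin (m + 1) → Fin 2) × (Fin (m + 1) →o Fin (n + 1)))
    (fun s ↦ (s.eps, s.lvl)) fun _ _ h ↦
      PrismSimplex.ext (congr_arg Prod.fst h) (congr_arg Prod.snd h)

instance (n : SimplexCategory) (m : SimplexCategoryᵒᵖ) : Finite ((prism.{v}.obj n).obj m) :=
  inferInstanceAs (Finite (PrismSimplex.{v} n.len m.unop.len))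

instance (n : ℕ) (m : SimplexCategoryᵒᵖ) : Finite ((Δ[n] : SSet.{v}).obj m) :=
  Finite.of_injective (β := Fin (m.unop.len + 1) →o Fin (n + 1))
    (fun s ↦ (SSet.stdSimplex.objEquiv s).toOrderHom) fun _ _ h ↦
      SSet.stdSimplex.objEquiv.injective (SimplexCategory.Hom.ext _ _ h)

instance finite_subcomplex {T : SSet.{v}} [∀ n, Finite (T.obj n)] (A : T.Subcomplex)
    (m : SimplexCategoryᵒᵖ) : Finite ((A : SSet.{v}).obj m) :=
  inferInstanceAs (Finite (A.obj m))

instance finite_thickSimplex (n : ℕ) (m : SimplexCategoryᵒᵖ) :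
    Finite ((thickSimplex.{v} n).obj m) :=
  inferInstanceAs (Finite (Fin (m.unop.len + 1) → ULift.{v} (Fin (n + 1))))

end Finiteness

theorem mono_of_injective_app {S T : SSet.{v}} (i : S ⟶ T)
    (h : ∀ m, Function.Injective (i.app m)) : Mono i := by
  rw [NatTrans.mono_iff_mono_app]
  exact fun m ↦ (mono_iff_injective _).2 (h m)

theorem isIso_of_bijective_app {S T : SSet.{v}} (i : S ⟶ T)
    (h : ∀ m, Function.Bijective (i.app m)) : IsIso i := by
  have : ∀ m, IsIso (i.app m) := fun m ↦ (isIso_iff_bijective _).2 (h m)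
  exact NatIso.isIso_of_isIso_app i

/-! ### The thick 1-simplex as the prism on a point -/

section Thick

/-- The thick `1`-simplex is the prism on a point. -/
def thickToPrism : thickSimplex.{v} 1 ⟶ prismObj.{v} 0 where
  app m := ↾fun s ↦ (⟨fun p ↦ (s p).down, ⟨fun _ ↦ 0, fun _ _ _ ↦ le_rfl⟩,
    fun _ _ h ↦ (lt_irrefl _ h).elim⟩ : PrismSimplex.{v} 0 m.unop.len)

instance : IsIso thickToPrism.{v} := isIso_of_bijective_app _ fun m ↦ by
  constructor
  · intro s t h
    funext p
    exact ULift.ext _ _ (congr_fun (congr_arg PrismSimplex.eps h :) p)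
  · intro (s : PrismSimplex.{v} 0 m.unop.len)
    exact ⟨fun p ↦ ULift.up (s.eps p), PrismSimplex.ext rfl
      (OrderHom.ext _ _ (funext fun p ↦ Subsingleton.elim (α := Fin 1) _ _))⟩

theorem thickVertex_toPrism (e : Fin 2) :
    thickVertex.{v} 1 e ≫ thickToPrism = prismSection e ⦋0⦌ := by
  ext m s
  exact PrismSimplex.ext rfl (OrderHom.ext _ _ (funext fun p ↦ Subsingleton.elim (α := Fin 1) _ _))

theorem isIso_toSubcomplex_of_bijective {U T : SSet.{v}} (A : U.Subcomplex) (i : T ⟶ U)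
    (h : SSet.Subcomplex.range i ≤ A) (hi : ∀ m, Function.Injective (i.app m))
    (h' : A ≤ SSet.Subcomplex.range i) : IsIso (SSet.Subcomplex.lift i h) :=
  isIso_of_bijective_app _ fun m ↦ ⟨fun s t hst ↦ hi m (congr_arg Subtype.val hst), fun s ↦ by
    obtain ⟨t, ht⟩ := h' _ s.2
    exact ⟨t, Subtype.ext ht⟩⟩

theorem prismSection_injective (e : Fin 2) (n : ℕ) (m : SimplexCategoryᵒᵖ) :
    Function.Injective ((prismSection.{v} e ⦋n⦌).app m) := by
  intro s t h
  refine SSet.stdSimplex.objEquiv.injective (SimplexCategory.Hom.ext _ _ ?_)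
  exact (congr_arg PrismSimplex.lvl h :)

theorem mem_range_prismSection {e : Fin 2} {n : ℕ} {m : SimplexCategoryᵒᵖ}
    (s : PrismSimplex.{v} n m.unop.len) (hs : ∀ p, s.eps p = e) :
    (s : (prismObj.{v} n).obj m) ∈ (SSet.Subcomplex.range (prismSection.{v} e ⦋n⦌)).obj m :=
  ⟨SSet.stdSimplex.objEquiv.symm (SimplexCategory.Hom.mk s.lvl),
    PrismSimplex.ext (funext fun p ↦ (hs p).symm) rfl⟩

theorem surjective_lvl_zero {m : ℕ} (s : PrismSimplex.{v} 0 m) : Function.Surjective s.lvl :=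
  fun _ ↦ ⟨0, Subsingleton.elim (α := Fin 1) _ _⟩

instance (e : Fin 2) : IsIso (prismEndSection.{v} e 0) :=
  isIso_toSubcomplex_of_bijective _ _ _ (prismSection_injective e 0) fun _ s hs ↦
    mem_range_prismSection s (hs.resolve_left fun h ↦ h (surjective_lvl_zero s))

end Thick

/-! ### The join part of the prism -/

section Joins

variable (n : ℕ)

/-- The copy of `Δ^n` with label `1`, as a map to `prismJoin n`. -/
def joinSection : Δ[n] ⟶ (prismJoin.{v} n : SSet.{v}) :=
  SSet.Subcomplex.lift (prismSection 1 ⦋n⦌) (by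
    rintro m _ ⟨s, rfl⟩
    exact fun _ _ ↦ rfl)

/-- The copy of `∂Δ^n` with label `1`, as a map to `prismJoin n ⊓ prismBot n`. -/
def boundaryJoinSection :
    (SSet.boundary.{v} n : SSet.{v}) ⟶ (prismJoin.{v} n ⊓ prismBot n : (prismObj.{v} n).Subcomplex) :=
  SSet.Subcomplex.lift ((SSet.boundary.{v} n).ι ≫ prismSection 1 ⦋n⦌) (by
    rintro m _ ⟨s, rfl⟩
    exact ⟨fun _ _ ↦ rfl, Or.inl s.2⟩)

instance : Mono (joinSection.{v} n) := by
  have : Mono (joinSection.{v} n ≫ (prismJoin.{v} n).ι) :=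
    mono_of_injective_app (prismSection.{v} 1 ⦋n⦌) (prismSection_injective 1 n)
  exact mono_of_mono _ (prismJoin.{v} n).ι

theorem boundaryJoinSection_w : (SSet.boundary.{v} n).ι ≫ joinSection n =
    boundaryJoinSection n ≫ SSet.Subcomplex.homOfLE inf_le_left := rfl

/-- A vertex of positive level with label 0 forces label 0 on all vertices of level 0. -/
theorem prismJoin_sup_prismBot : prismJoin.{v} n ⊔ prismBot n = ⊤ := by
  rw [eq_top_iff]
  intro m (s : PrismSimplex.{v} n m.unop.len) _
  by_cases h : ∀ p, 0 < s.lvl p → s.eps p = 1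
  · exact Or.inl h
  · push Not at h
    obtain ⟨p, hp, hp'⟩ := h
    refine Or.inr (Or.inr fun q hq ↦ ?_)
    have := s.compat q p (by rw [hq]; exact hp)
    omega

theorem isPushout_prismJoin : IsPushout
    (SSet.Subcomplex.homOfLE (inf_le_right : prismJoin.{v} n ⊓ prismBot n ≤ prismBot n))
    (SSet.Subcomplex.homOfLE (inf_le_left : prismJoin.{v} n ⊓ prismBot n ≤ prismJoin n))
    (prismBot n).ι (prismJoin n).ι := by
  have sq : SSet.Subcomplex.BicartSq (prismJoin.{v} n ⊓ prismBot n) (prismBot n) (prismJoin n) ⊤ :=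
    { sup_eq := by rw [sup_comm, prismJoin_sup_prismBot]
      inf_eq := inf_comm _ _ }
  exact IsPushout.of_iso sq.isPushout (Iso.refl _) (Iso.refl _) (Iso.refl _)
    (SSet.Subcomplex.topIso _) rfl rfl rfl rfl

theorem prismEnd_le_prismBot : prismEnd.{v} n 0 ≤ prismBot n :=
  fun _ _ hs ↦ hs.imp id fun h p _ ↦ h p

/-- The union of `prismJoin n ⊓ prismBot n` and of the copy of `Δ^n` with label `1`. -/
abbrev joinUnion : (prismObj.{v} n).Subcomplex :=
  prismJoin n ⊓ prismBot n ⊔ SSet.Subcomplex.range (prismSection 1 ⦋n⦌)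

theorem joinUnion_le : joinUnion.{v} n ≤ prismJoin n := by
  refine sup_le inf_le_left ?_
  rintro m _ ⟨s, rfl⟩
  exact fun _ _ ↦ rfl

theorem isPushout_joinUnion : IsPushout (boundaryJoinSection.{v} n) (SSet.boundary n).ι
    (SSet.Subcomplex.homOfLE (le_sup_left : _ ≤ joinUnion.{v} n))
    (SSet.Subcomplex.lift (prismSection 1 ⦋n⦌) le_sup_right) := by
  refine isPushout_attach _ (joinUnion.{v} n) (prismSection 1 ⦋n⦌)
    (SSet.boundary.{v} n) ?_ (fun m s t _ h ↦ prismSection_injective 1 n m h) rfl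
  -- A level-surjective simplex with all labels 1 has a level-0 vertex with label 1, so it is not in
  -- `prismBot n`: the label-1 copy meets it exactly in the boundary.
  refine le_antisymm ?_ fun m s hs ↦ ⟨fun _ _ ↦ rfl, Or.inl hs⟩
  rintro m s ⟨-, hs | hs⟩
  · exact hs
  · intro h
    obtain ⟨p, hp⟩ := h 0
    exact absurd (hs p hp) (by decide : ¬ (1 : Fin 2) = 0)

/-- The vertex with label `0`, as a map to `prismJoin 0 ⊓ prismBot 0`. -/
def joinHornSection : Δ[0] ⟶ (prismJoin.{v} 0 ⊓ prismBot 0 : (prismObj.{v} 0).Subcomplex) :=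
  SSet.Subcomplex.lift (prismSection 0 ⦋0⦌) (by
    rintro m _ ⟨s, rfl⟩
    exact ⟨fun _ hp ↦ (hp.ne' (Subsingleton.elim (α := Fin 1) _ _)).elim, Or.inr fun _ _ ↦ rfl⟩)

instance : IsIso joinHornSection.{v} :=
  isIso_toSubcomplex_of_bijective _ _ _ (prismSection_injective 0 0) fun _ s hs ↦
    mem_range_prismSection s fun p ↦ (hs.2.resolve_left fun h ↦ h (surjective_lvl_zero s)) p
      (Subsingleton.elim (α := Fin 1) _ _)

instance : IsIso (prismJoin.{v} 0).ι :=
  isIso_of_bijective_app _ fun m ↦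
    ⟨Subtype.val_injective, fun (s : PrismSimplex.{v} 0 m.unop.len) ↦ ⟨⟨s, fun _ hp ↦
      (hp.ne' (Subsingleton.elim (α := Fin 1) _ _)).elim⟩, rfl⟩⟩

end Joins

/-! ### Restriction along the prism inclusions -/

section Restriction

variable {V : Type u} [Category.{v} V] {k : ℕ} {Y : SimplicialObject V}
  (W : MorphismProperty (Vᵒᵖ ⥤ Type v)) [W.IsStableUnderBaseChange]

theorem restrict_mem_of_isIso {S S' T T' : SSet.{v}} (i : S' ⟶ S) (j : S ⟶ T) (t : T ⟶ T')
    [IsIso i] [IsIso t] (h : W (restrict (i ≫ j ≫ t) Y)) : W (restrict j Y) := by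
  rw [restrict_comp, restrict_comp, Category.assoc, W.cancel_left_of_respectsIso] at h
  rwa [W.cancel_right_of_respectsIso] at h

theorem restrict_prismEnd_zero_mem (h : W (restrict (prismSection.{v} 1 ⦋0⦌) Y)) :
    W (restrict (prismEnd.{v} 0 1).ι Y) :=
  restrict_mem_of_isIso W (prismEndSection 1 0) _ (𝟙 _) h

variable [W.IsMultiplicative] (hk : 0 < k) (hY : ∀ (n : ℕ) (i : Fin (n + 1)), 0 < i → i < Fin.last n →
    k < n → IsIso (restrict (SSet.horn.{v} n i).ι Y)) (n : ℕ)

include hk hY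

/-- The class `W` and the bound n + 1 on horn dimensions are kept explicit so that the statement
serves for covers and, when n ≥ k, for isomorphisms. -/
theorem restrict_prismEnd_mem_of_pos (hn : 0 < n)
    (hW : ∀ (m : ℕ) (i : Fin (m + 1)), n + 1 ≤ m → 0 < i → i < Fin.last m →
      W (restrict (SSet.horn.{v} m i).ι Y)) :
    W (restrict (prismEnd.{v} n 1).ι Y) := by
  obtain ⟨B, h₁, h₂⟩ := innerExt_prismEnd_one (n := n) hn (k + 2)
  have := restrict_mem_of_innerExt W hk hY hW (le_top (a := prismEnd.{v} n 1))
    ⟨B, h₁, le_top, h₂⟩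
  have := (SSet.Subcomplex.topIso (prismObj.{v} n)).isIso_hom
  exact W.comp_mem _ _ (MorphismProperty.of_isIso W
    (restrict (SSet.Subcomplex.topIso (prismObj.{v} n)).hom Y)) ‹_›

theorem restrict_prismBot_mem (hW : ∀ (m : ℕ) (i : Fin (m + 1)), 0 < i → i < Fin.last m →
      W (restrict (SSet.horn.{v} m i).ι Y)) :
    W (restrict (SSet.Subcomplex.homOfLE (prismEnd_le_prismBot.{v} n)) Y) :=
  restrict_mem_of_innerExt W hk hY (fun m i _ ↦ hW m i) _ (innerExt_prismEnd_zero n (k + 2))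

theorem restrict_prismJoin_mem (h₀ : W (restrict (prismSection.{v} 0 ⦋0⦌) Y))
    (hW : ∀ (m : ℕ) (i : Fin (m + 1)), 0 < i → i < Fin.last m →
      W (restrict (SSet.horn.{v} m i).ι Y)) :
    W (restrict (SSet.Subcomplex.homOfLE
      (inf_le_left : prismJoin.{v} n ⊓ prismBot n ≤ prismJoin n)) Y) := by
  obtain rfl | hn := n.eq_zero_or_pos
  · exact restrict_mem_of_isIso W joinHornSection _ (prismJoin 0).ι h₀
  · exact restrict_mem_of_innerExt W hk hY (fun m i _ ↦ hW m i) _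
      (innerExt_prismJoin hn (k + 2))

end Restriction

end DescentCat

namespace DescentCat

open Limits

/-! ### The criterion in terms of prisms -/

variable {V : Type u} [Category.{v} V] {cov : MorphismProperty V} {k : ℕ}
  {X Y P : SimplicialObject V}

theorem toRelMap_mem_of_mono (W : MorphismProperty (Vᵒᵖ ⥤ Type v)) [W.IsStableUnderBaseChange]
    [W.IsMultiplicative] (hk : 0 < k)
    (hP : ∀ (n : ℕ) (i : Fin (n + 1)), 0 < i → i < Fin.last n →
      k < n → IsIso (restrict (SSet.horn.{v} n i).ι P))
    (hX : ∀ (n : ℕ) (i : Fin (n + 1)), 0 < i → i < Fin.last n →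
      k < n → IsIso (restrict (SSet.horn.{v} n i).ι X)) {p : P ⟶ X}
    (hp : ∀ n, W (toRelMap (SSet.boundary.{v} n).ι p)) {S T : SSet.{v}} (i : S ⟶ T) [Mono i]
    [∀ n, Finite (T.obj n)] : W (toRelMap i p) := by
  have : IsIso (SSet.Subcomplex.toRange i) := isIso_of_mono_of_epi _
  have hS : T.skeleton 0 ≤ SSet.Subcomplex.range i := by
    rw [SSet.skeleton_zero]
    exact bot_le
  exact toRelMap_comp W (SSet.Subcomplex.toRange i) (SSet.Subcomplex.range i).ι p
    (toRelMap_mem_of_isIso W _ inferInstance inferInstance)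
    (toRelMap_mem W (fun n _ ↦ hp n) _ hS hk hP hX)

section KCategories

variable (hV : IsDescentCategory cov) (hk : 0 < k)

include hV

theorem IsKCategory.restrict_horn_mem (hX : IsKCategory cov k X) (n : ℕ) (i : Fin (n + 1))
    (hi : 0 < i) (hi' : i < Fin.last n) : cov.presheaf (restrict (SSet.horn.{v} n i).ι X) :=
  ((isCover_iff hV _).1 (hX.horn_cover n i hi hi')).2.2

theorem IsKCategory.restrict_prismSection_mem (hX : IsKCategory cov k X) (e : Fin 2) :
    cov.presheaf (restrict (prismSection.{v} e ⦋0⦌) X) := by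
  have := hV.presheaf_isMultiplicative
  have := presheaf_isStableUnderBaseChange (cov := cov)
  rw [← thickVertex_toPrism, restrict_comp, cov.presheaf.cancel_left_of_respectsIso]
  exact ((isCover_iff hV _).1 (hX.vertex_cover e)).2.2

include hk

theorem IsKCategory.restrict_prismEnd_mem (hX : IsKCategory cov k X) (n : ℕ) :
    cov.presheaf (restrict (prismEnd.{v} n 1).ι X) := by
  have := hV.presheaf_isMultiplicative
  have := presheaf_isStableUnderBaseChange (cov := cov)
  obtain rfl | hn := n.eq_zero_or_pos
  · exact restrict_prismEnd_zero_mem _ (hX.restrict_prismSection_mem hV 1)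
  · exact restrict_prismEnd_mem_of_pos _ hk hX.horn_iso n hn
      fun m i _ ↦ hX.restrict_horn_mem hV m i

omit hV in
-- All horns that are filled have dimension at least n + 1 > k, where fillers are unique.
theorem IsKCategory.isIso_restrict_prismEnd (hX : IsKCategory cov k X) (n : ℕ) (hn : k ≤ n) :
    IsIso (restrict (prismEnd.{v} n 1).ι X) :=
  restrict_prismEnd_mem_of_pos (MorphismProperty.isomorphisms _) hk hX.horn_iso n (by omega)
    fun m i hm hi hi' ↦ hX.horn_iso m i hi hi' (by omega)

theorem IsKCategory.isRepresentable_map (hX : IsKCategory cov k X) (T : SSet.{v})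
    [∀ n, Finite (T.obj n)] : (Map T X).IsRepresentable :=
  have := hV.hasFiniteLimits
  DescentCat.isRepresentable_map hk hX.horn_iso T

theorem isRepresentable_relMap_of_finite (hX : IsKCategory cov k X) (hY : IsKCategory cov k Y)
    (f : X ⟶ Y) {S T : SSet.{v}} [∀ n, Finite (S.obj n)] [∀ n, Finite (T.obj n)] (i : S ⟶ T) :
    (RelMap i f).IsRepresentable :=
  have := hV.hasPullbacks
  isRepresentable_relMap i f (hX.isRepresentable_map hV hk S) (hY.isRepresentable_map hV hk S)
    (hY.isRepresentable_map hV hk T)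

/-- Each condition on `P` is a lifting problem along `p` followed by the same condition on `X`.
Unique fillers are proved first, since coskeletality and representability for `P` rest on them. -/
theorem IsKCategory.of_hypercover (hX : IsKCategory cov k X) (p : P ⟶ X)
    (hp : ∀ n, cov.presheaf (toRelMap (SSet.boundary.{v} n).ι p))
    (hp' : ∀ n, k ≤ n → IsIso (toRelMap (SSet.boundary.{v} n).ι p)) : IsKCategory cov k P := by
  have := hV.presheaf_isMultiplicative
  have := presheaf_isStableUnderBaseChange (cov := cov)
  have := hV.hasFiniteLimits
  have hP (n : ℕ) (i : Fin (n + 1)) (hi : 0 < i) (hi' : i < Fin.last n) (hn : k < n) :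
      IsIso (restrict (SSet.horn.{v} n i).ι P) := by
    refine restrict_of_toRelMap (MorphismProperty.isomorphisms (Vᵒᵖ ⥤ Type v)) _ p ?_
      (hX.horn_iso n i hi hi' hn)
    refine toRelMap_mem_of_skeleton_eq_top (d := k) (MorphismProperty.isomorphisms (Vᵒᵖ ⥤ Type v))
      hp' _ ?_ (skeleton_succ_stdSimplex n)
    -- For n > k a horn contains all simplices of dimension < k, so only boundary conditions in
    -- dimensions ≥ k intervene, where `hp'` gives isomorphisms.
    rw [SSet.Subcomplex.le_iff_contains_nonDegenerate]
    rintro m ⟨x, hx⟩ hx'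
    rw [SSet.mem_skeleton_obj_iff_of_nonDegenerate] at hx'
    rw [SSet.horn_obj_eq_univ i m (by omega)]
    trivial
  refine ⟨fun n i hi hi' ↦ ?_, hP, fun i ↦ ?_⟩
  · refine isCover_of_presheaf hV (DescentCat.isRepresentable_map hk hP _) ?_
    exact restrict_of_toRelMap cov.presheaf _ p
      (toRelMap_mem_of_mono _ hk hP hX.horn_iso hp _) (hX.restrict_horn_mem hV n i hi hi')
  · refine isCover_of_presheaf hV (DescentCat.isRepresentable_map hk hP _) ?_
    have : Mono (thickVertex.{v} 1 i) := by
      have : Mono (thickVertex.{v} 1 i ≫ thickToPrism) := by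
        rw [thickVertex_toPrism]
        exact mono_of_injective_app _ (prismSection_injective i 0)
      exact mono_of_mono _ thickToPrism
    exact restrict_of_toRelMap cov.presheaf _ p
      (toRelMap_mem_of_mono _ hk hP hX.horn_iso hp _)
      ((isCover_iff hV _).1 (hX.vertex_cover i)).2.2

/-- The criterion for weak equivalences, in terms of prisms. -/
theorem isWeakEquivalence_of_isCover (hX : IsKCategory cov k X) (hY : IsKCategory cov k Y)
    (f : X ⟶ Y) (hf : ∀ n, IsCover cov (relRestrict (joinSection.{v} n) (boundaryJoinSection n)
      (SSet.boundary.{v} n).ι (SSet.Subcomplex.homOfLE inf_le_left) (boundaryJoinSection_w n) f)) :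
    IsWeakEquivalence cov k f := by
  have := hV.presheaf_isMultiplicative
  have := presheaf_isStableUnderBaseChange (cov := cov)
  obtain ⟨P, ⟨ψ⟩⟩ := exists_points_iso (pathFunctor f)
    fun n ↦ isRepresentable_relMap_of_finite hV hk hX hY f (prismSection.{v} 1 ⦋n.unop.len⦌)
  obtain ⟨p, hp⟩ := exists_pointsMap (ψ.hom ≫ pathFst f)
  obtain ⟨q, hq⟩ := exists_pointsMap (ψ.hom ≫ pathSnd f)
  obtain ⟨s, hs⟩ := exists_pointsMap (pathConst f ≫ ψ.inv)
  have hp₁ (n : ℕ) : cov.presheaf (toRelMap (SSet.boundary.{v} n).ι p) :=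
    toRelMap_fst_mem _ ψ hp (hY.restrict_prismEnd_mem hV hk n)
  have hp₂ (n : ℕ) (hn : k ≤ n) : IsIso (toRelMap (SSet.boundary.{v} n).ι p) :=
    toRelMap_fst_mem (MorphismProperty.isomorphisms _) ψ hp (hY.isIso_restrict_prismEnd hk n hn)
  have hP := hX.of_hypercover hV hk p hp₁ hp₂
  have hq₁ (n : ℕ) : cov.presheaf (toRelMap (SSet.boundary.{v} n).ι q) := by
    refine toRelMap_snd_mem _ ψ hq rfl ?_
    -- The hypothesis is transported from the join part to the whole prism by gluing along `prismBot
    -- n`.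
    have h₁ : cov.presheaf (relRestrict (prismSection 1 ⦋n⦌)
        (boundaryToPrismEnd n ≫ SSet.Subcomplex.homOfLE (prismEnd_le_prismBot n))
        (SSet.boundary.{v} n).ι (prismBot n).ι rfl f) := relRestrict_of_isPushout cov.presheaf (isPushout_prismJoin n) _ _ _
      (boundaryJoinSection_w n) f ((isCover_iff hV _).1 (hf n)).2.2
    -- The passage from `prismBot n` down to `prismEnd n 0` uses only inner horns in `Y`.
    have h₂ := relRestrict_of_restrict cov.presheaf (boundaryToPrismEnd n)
      (SSet.Subcomplex.homOfLE (prismEnd_le_prismBot n)) _ rfl f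
      (restrict_prismBot_mem _ hk hY.horn_iso n (hY.restrict_horn_mem hV))
    have h := cov.presheaf.comp_mem _ _ h₁ h₂
    have e := relRestrict_comp (i := prismSection.{v} 1 ⦋n⦌)
      (i' := boundaryToPrismEnd n ≫ SSet.Subcomplex.homOfLE (prismEnd_le_prismBot n))
      (i'' := boundaryToPrismEnd n) (a := (SSet.boundary.{v} n).ι) (b := (prismBot n).ι)
      (a' := 𝟙 _) (b' := SSet.Subcomplex.homOfLE (prismEnd_le_prismBot n)) rfl rfl f
    exact e ▸ h
  refine ⟨P, p, q, s, hP,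
    fun n ↦ isCover_of_presheaf hV (isRepresentable_relMap_of_finite hV hk hP hX p _) (hp₁ n),
    fun n ↦ isCover_of_presheaf hV (isRepresentable_relMap_of_finite hV hk hP hY q _) (hq₁ n),
    pointsMap_injective ?_, pointsMap_injective ?_⟩
  · rw [pointsMap_comp, hs, hp, Category.assoc, ψ.inv_hom_id_assoc, pathConst_fst]
    ext A n x
    exact (Category.comp_id x).symm
  · rw [pointsMap_comp, hs, hq, Category.assoc, ψ.inv_hom_id_assoc, pathConst_snd]

theorem IsWeakEquivalence.isCover (hX : IsKCategory cov k X) (hY : IsKCategory cov k Y)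
    {f : X ⟶ Y} (hf : IsWeakEquivalence cov k f) (n : ℕ) :
    IsCover cov (relRestrict (joinSection.{v} n) (boundaryJoinSection n)
      (SSet.boundary.{v} n).ι (SSet.Subcomplex.homOfLE inf_le_left)
      (boundaryJoinSection_w n) f) := by
  have := hV.presheaf_isMultiplicative
  have := presheaf_isStableUnderBaseChange (cov := cov)
  obtain ⟨P, p, q, s, hP, hp, hq, hs, hf⟩ := hf
  have hp' (n : ℕ) := ((isCover_iff hV _).1 (hp n)).2.2
  have hq' (n : ℕ) := ((isCover_iff hV _).1 (hq n)).2.2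
  have : Mono (boundaryJoinSection.{v} n) := by
    have : Mono (boundaryJoinSection.{v} n ≫ SSet.Subcomplex.homOfLE inf_le_left) := by
      rw [← boundaryJoinSection_w]
      infer_instance
    exact mono_of_mono _ (SSet.Subcomplex.homOfLE inf_le_left)
  have h₁ := relPostcomp_mem cov.presheaf (joinSection n) s q f hf
    (toRelMap_mem_of_mono _ hk hP.horn_iso hY.horn_iso hq' _)
  have h₂ := relPostcomp_mem cov.presheaf (boundaryJoinSection n) s q f hf
    (toRelMap_mem_of_mono _ hk hP.horn_iso hY.horn_iso hq' _)
  -- The section `s` needs no condition: extension in `X` follows from inner horns or the vertex 0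
  -- of 𝚫^1, and the lift to `P` from the hypercover `p`.
  have h₃ : cov.presheaf (relRestrict (joinSection.{v} n) (boundaryJoinSection n)
      (SSet.boundary.{v} n).ι (SSet.Subcomplex.homOfLE inf_le_left)
      (boundaryJoinSection_w n) s) :=
    relRestrict_of_section cov.presheaf _ (isPushout_joinUnion n)
      (SSet.Subcomplex.homOfLE (joinUnion_le n)) rfl rfl hs
      (toRelMap_mem_of_mono _ hk hP.horn_iso hX.horn_iso hp' _)
      (restrict_prismJoin_mem _ hk hX.horn_iso n (hX.restrict_prismSection_mem hV 0)
        (hX.restrict_horn_mem hV))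
  refine isCover_of_comp hV h₁ ?_ (isRepresentable_relMap_of_finite hV hk hX hY f _)
    (isRepresentable_relMap_of_finite hV hk hX hY f _)
  rw [relPostcomp_relRestrict]
  exact cov.presheaf.comp_mem _ _ h₃ h₂

end KCategories

end DescentCat

namespace DescentCat

open Limits

/-! ### Maps out of the fibres of a cut -/

section Fibres

variable {m : SimplexCategory} {c : m ⟶ ⦋1⦌} {e : Fin 2}

/-- A vertex of a fibre. -/
def fibreVertex (p : Fin (m.len + 1)) (hp : c.toOrderHom p = e) :
    (cutFibre.{v} c e : SSet.{v}).obj (op ⦋0⦌) :=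
  ⟨SSet.stdSimplex.objEquiv.symm (SimplexCategory.const ⦋0⦌ m p), fun _ ↦ hp⟩

/-- A simplex of a thick simplex is the list of its vertices, so naturality for the inclusions of
vertices determines `g`. -/
theorem app_fibre_thick {n : ℕ} (g : (cutFibre.{v} c e : SSet.{v}) ⟶ thickSimplex.{v} n)
    {k : SimplexCategoryᵒᵖ} (t : (cutFibre.{v} c e : SSet.{v}).obj k) (a : Fin (k.unop.len + 1)) :
    (g.app k t : Fin (k.unop.len + 1) → ULift.{v} (Fin (n + 1))) a =
      (g.app (op ⦋0⦌) (fibreVertex ((SSet.stdSimplex.objEquiv t.1).toOrderHom a) (t.2 a)) :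
        Fin 1 → ULift.{v} (Fin (n + 1))) 0 :=
  (congr_fun (ConcreteCategory.congr_hom
    (g.naturality (SimplexCategory.const ⦋0⦌ k.unop a).op) t :) (0 : Fin 1)).symm

/-- The level of a vertex of a fibre mapped to `Δ^n`. -/
def fibreLevel {n : ℕ} (g : (cutFibre.{v} c e : SSet.{v}) ⟶ Δ[n]) (p : Fin (m.len + 1))
    (hp : c.toOrderHom p = e) : Fin (n + 1) :=
  (SSet.stdSimplex.objEquiv (g.app (op ⦋0⦌) (fibreVertex p hp))).toOrderHom 0

theorem app_fibre_stdSimplex {n : ℕ} (g : (cutFibre.{v} c e : SSet.{v}) ⟶ Δ[n])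
    {k : SimplexCategoryᵒᵖ} (t : (cutFibre.{v} c e : SSet.{v}).obj k) (a : Fin (k.unop.len + 1)) :
    (SSet.stdSimplex.objEquiv (g.app k t)).toOrderHom a =
      fibreLevel g ((SSet.stdSimplex.objEquiv t.1).toOrderHom a) (t.2 a) :=
  (congr_arg (fun x ↦ (SSet.stdSimplex.objEquiv x).toOrderHom 0) (ConcreteCategory.congr_hom
    (g.naturality (SimplexCategory.const ⦋0⦌ k.unop a).op) t :)).symm

theorem fibreLevel_mono {n : ℕ} (g : (cutFibre.{v} c e : SSet.{v}) ⟶ Δ[n])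
    {p q : Fin (m.len + 1)} (h : p ≤ q) (hp : c.toOrderHom p = e) (hq : c.toOrderHom q = e) :
    fibreLevel g p hp ≤ fibreLevel g q hq := by
  -- Both ends of the edge from `p` to `q` lie in the fibre, hence so does the edge; monotonicity of
  -- its image in Δ^n gives the inequality.
  let θ : ⦋1⦌ ⟶ m := SimplexCategory.Hom.mk ⟨fun i : Fin 2 ↦ if i = 0 then p else q, by
    intro i j hij
    dsimp only
    split_ifs with h₁ h₂ h₂
    · exact le_rfl
    · exact h
    · exact absurd (Fin.le_zero_iff.1 (h₂ ▸ hij)) h₁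
    · exact le_rfl⟩
  let t : (cutFibre.{v} c e : SSet.{v}).obj (op ⦋1⦌) := ⟨SSet.stdSimplex.objEquiv.symm θ, by
    intro i
    change c.toOrderHom (if i = 0 then p else q) = e
    split_ifs
    · exact hp
    · exact hq⟩
  have h₀ := app_fibre_stdSimplex g t 0
  have h₁ := app_fibre_stdSimplex g t 1
  exact h₀ ▸ h₁ ▸ (SSet.stdSimplex.objEquiv (g.app (op ⦋1⦌) t)).toOrderHom.monotone (Fin.zero_le 1)

end Fibres

/-! ### Comparison of the join part of the prism with the join -/

section Join

/-- The cut of a simplex of the prism into its part of level `0` and its part of positive level. -/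
def PrismSimplex.cut {n : ℕ} {m : SimplexCategory} (s : PrismSimplex.{v} n m.len) : m ⟶ ⦋1⦌ :=
  SimplexCategory.Hom.mk ⟨fun p ↦ if s.lvl p = 0 then (0 : Fin 2) else 1, fun p q h ↦ by
    have := s.lvl.monotone h
    dsimp only
    split_ifs with h₁ h₂ h₂
    · exact le_rfl
    · exact Fin.zero_le _
    · exact absurd (Fin.le_zero_iff.1 (h₂ ▸ this)) h₁
    · exact le_rfl⟩

theorem PrismSimplex.cut_eq_zero {n : ℕ} {m : SimplexCategory} {s : PrismSimplex.{v} n m.len}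
    {p : Fin (m.len + 1)} : s.cut.toOrderHom p = 0 ↔ s.lvl p = 0 := by
  change (if s.lvl p = 0 then (0 : Fin 2) else 1) = 0 ↔ _
  split_ifs with h <;> simp [h]

theorem PrismSimplex.cut_eq_one {n : ℕ} {m : SimplexCategory} {s : PrismSimplex.{v} n m.len}
    {p : Fin (m.len + 1)} : s.cut.toOrderHom p = 1 ↔ s.lvl p ≠ 0 := by
  change (if s.lvl p = 0 then (0 : Fin 2) else 1) = 1 ↔ _
  split_ifs with h <;> simp [h]

variable (n : ℕ)

/-- The projection of the prism on `Δ^{n+1}` to the join `𝚫^1 ⋆ Δ^n`. -/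
def prismToJoin : prismObj.{v} (n + 1) ⟶ join (thickSimplex.{v} 1) Δ[n] where
  app m := ↾fun (s : PrismSimplex.{v} (n + 1) m.unop.len) ↦
    ({ cut := s.cut
       left := (cutFibre.{v} s.cut 0).ι ≫ SSet.yonedaEquiv.symm
        ((fun p ↦ ULift.up (s.eps p)) : (thickSimplex.{v} 1).obj m)
       right := (cutFibre.{v} s.cut 1).ι ≫ SSet.stdSimplex.map
        ((SimplexCategory.Hom.mk s.lvl : m.unop ⟶ ⦋n + 1⦌) ≫ SimplexCategory.σ 0) } :
      JoinSimplex (thickSimplex.{v} 1) Δ[n] m.unop)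
  naturality m m' θ := by
    refine ConcreteCategory.hom_ext _ _ fun s ↦ ?_
    exact JoinSimplex.ext' rfl rfl rfl

theorem prismSection_toJoin : prismSection.{v} 1 ⦋n + 1⦌ ≫ prismToJoin n = simplexToJoin n := by
  apply SSet.yonedaEquiv.injective
  refine Eq.trans ?_ (Equiv.apply_symm_apply _ _).symm
  exact JoinSimplex.ext' rfl rfl rfl

variable {n} {m : SimplexCategory}

theorem ne_zero_of_cut {c : m ⟶ ⦋1⦌} {p : Fin (m.len + 1)} (h : c.toOrderHom p ≠ 0) :
    c.toOrderHom p = 1 := by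
  have := (c.toOrderHom p).2
  change _ < 2 at this
  refine Fin.ext ?_
  have : (c.toOrderHom p : ℕ) ≠ 0 := fun h' ↦ h (Fin.ext h')
  change (c.toOrderHom p : ℕ) = 1
  omega

/-- The simplex of the prism defined by a simplex of the join. -/
def JoinSimplex.toPrism (x : JoinSimplex (thickSimplex.{v} 1) Δ[n] m) :
    PrismSimplex.{v} (n + 1) m.len where
  eps p := if h : x.cut.toOrderHom p = 0 then
    ((x.left.app (op ⦋0⦌) (fibreVertex p h) : Fin 1 → ULift.{v} (Fin 2)) 0).down else 1
  lvl := ⟨fun p ↦ if h : x.cut.toOrderHom p = 0 then 0 else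
    (fibreLevel x.right p (ne_zero_of_cut h)).succ, fun p q h ↦ by
      have := x.cut.toOrderHom.monotone h
      dsimp only
      split_ifs with h₁ h₂ h₂
      · exact le_rfl
      · exact Fin.zero_le _
      · exact absurd (Fin.le_zero_iff.1 (h₂ ▸ this)) h₁
      · exact Fin.succ_le_succ_iff.2 (fibreLevel_mono _ h _ _)⟩
  compat p q h := by
    by_cases hq : x.cut.toOrderHom q = 0
    · refine absurd h (not_lt.2 ?_)
      change dite _ _ _ ≤ _
      rw [dif_pos hq]
      exact Fin.zero_le _
    · simp only [hq, dite_false]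
      exact Fin.le_last _

theorem JoinSimplex.toPrism_lvl_eq_zero {x : JoinSimplex (thickSimplex.{v} 1) Δ[n] m}
    {p : Fin (m.len + 1)} : x.toPrism.lvl p = 0 ↔ x.cut.toOrderHom p = 0 := by
  change (if h : x.cut.toOrderHom p = 0 then 0 else _) = _ ↔ _
  split_ifs with h <;> simp [h]

theorem JoinSimplex.toPrism_cut (x : JoinSimplex (thickSimplex.{v} 1) Δ[n] m) :
    x.toPrism.cut = x.cut := by
  refine SimplexCategory.Hom.ext _ _ (OrderHom.ext _ _ (funext fun p ↦ ?_))
  by_cases h : x.cut.toOrderHom p = 0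
  · rw [h, PrismSimplex.cut_eq_zero, JoinSimplex.toPrism_lvl_eq_zero, h]
  · rw [ne_zero_of_cut h, PrismSimplex.cut_eq_one, Ne, JoinSimplex.toPrism_lvl_eq_zero]
    exact h

theorem prismToJoin_toPrism {m : SimplexCategoryᵒᵖ}
    (x : JoinSimplex (thickSimplex.{v} 1) Δ[n] m.unop) :
    (prismToJoin.{v} n).app m x.toPrism = x := by
  refine JoinSimplex.ext' (x.toPrism_cut) ?_ ?_
  · ext k t
    funext a
    have ht : x.cut.toOrderHom ((SSet.stdSimplex.objEquiv t.1).toOrderHom a) = 0 := by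
      have := t.2 a
      rwa [← JoinSimplex.toPrism_cut]
    have h := app_fibre_thick x.left
      ((cutFibreMap.{v} (𝟙 m.unop) x.cut x.toPrism.cut
        (by rw [JoinSimplex.toPrism_cut, Category.id_comp]) 0).app k t) a
    refine Eq.trans (ULift.ext _ _ ?_) h.symm
    exact dif_pos ht
  · ext k t
    refine SSet.stdSimplex.objEquiv.injective (SimplexCategory.Hom.ext _ _
      (OrderHom.ext _ _ (funext fun a ↦ ?_)))
    have ht : ¬ x.cut.toOrderHom ((SSet.stdSimplex.objEquiv t.1).toOrderHom a) = 0 := by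
      have := t.2 a
      rw [← JoinSimplex.toPrism_cut]
      intro h
      exact absurd (h.symm.trans this) (by decide)
    have h := app_fibre_stdSimplex x.right
      ((cutFibreMap.{v} (𝟙 m.unop) x.cut x.toPrism.cut
        (by rw [JoinSimplex.toPrism_cut, Category.id_comp]) 1).app k t) a
    refine Eq.trans ?_ h.symm
    exact (congr_arg (Fin.predAbove 0) (dif_neg ht)).trans (Fin.predAbove_zero_succ)

/-- Passing to the join forgets the labels at positive levels; the hypothesis says that they take
the value 1, which `JoinSimplex.toPrism` restores. -/
theorem toPrism_prismToJoin {m : SimplexCategoryᵒᵖ} (s : PrismSimplex.{v} (n + 1) m.unop.len)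
    (hs : ∀ p, 0 < s.lvl p → s.eps p = 1) :
    JoinSimplex.toPrism ((prismToJoin.{v} n).app m s) = s := by
  refine PrismSimplex.ext (funext fun p ↦ ?_) (OrderHom.ext _ _ (funext fun p ↦ ?_))
  · change (if h : s.cut.toOrderHom p = 0 then s.eps p else 1) = s.eps p
    split_ifs with h
    · rfl
    · rw [PrismSimplex.cut_eq_zero] at h
      exact (hs p (Fin.pos_iff_ne_zero.2 h)).symm
  · change (if h : s.cut.toOrderHom p = 0 then 0 else
      (Fin.predAbove 0 (s.lvl p)).succ) = s.lvl p
    split_ifs with h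
    · exact (PrismSimplex.cut_eq_zero.1 h).symm
    · rw [PrismSimplex.cut_eq_zero] at h
      obtain ⟨i, hi⟩ := Fin.exists_succ_eq.2 h
      rw [← hi, Fin.predAbove_zero_succ]

instance (n : ℕ) : IsIso ((prismJoin.{v} (n + 1)).ι ≫ prismToJoin n) :=
  isIso_of_bijective_app _ fun m ↦ by
    constructor
    · rintro ⟨s, hs⟩ ⟨t, ht⟩ h
      refine Subtype.ext ?_
      exact (toPrism_prismToJoin s hs).symm.trans
        ((congr_arg JoinSimplex.toPrism h :).trans (toPrism_prismToJoin t ht))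
    · intro (x : JoinSimplex (thickSimplex.{v} 1) Δ[n] m.unop)
      refine ⟨⟨x.toPrism, fun p hp ↦ ?_⟩, prismToJoin_toPrism x⟩
      change (if h : x.cut.toOrderHom p = 0 then _ else 1) = (1 : Fin 2)
      rw [dif_neg (fun h ↦ hp.ne' (JoinSimplex.toPrism_lvl_eq_zero.2 h))]

theorem prismToJoin_mem_joinHorn_iff {m : SimplexCategoryᵒᵖ}
    (s : PrismSimplex.{v} (n + 1) m.unop.len) :
    (prismToJoin.{v} n).app m s ∈ (joinHorn.{v} n).obj m ↔
      (s : (prismObj.{v} (n + 1)).obj m) ∈ (prismBot.{v} (n + 1)).obj m := by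
  constructor
  · rintro (⟨-, h⟩ | ⟨h, -⟩)
    · refine Or.inl fun hs ↦ ?_
      -- A choice of one vertex in each positive level gives a simplex of the right-hand fibre
      -- mapping isomorphically to Δ^n, contrary to landing in ∂Δ^n.
      choose g hg using hs
      have hmono : Monotone (g ∘ Fin.succ) := by
        intro i j hij
        by_contra! hlt
        have := s.lvl.monotone hlt.le
        rw [Function.comp, Function.comp, hg, hg, Fin.succ_le_succ_iff] at this
        rw [le_antisymm this hij] at hlt
        exact lt_irrefl _ hlt
      let θ : ⦋n⦌ ⟶ m.unop := SimplexCategory.Hom.mk ⟨g ∘ Fin.succ, hmono⟩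
      refine h (op ⦋n⦌) ⟨⟨SSet.stdSimplex.objEquiv.symm θ, fun a ↦ ?_⟩, rfl⟩ fun a ↦ ⟨a, ?_⟩
      · refine PrismSimplex.cut_eq_one.2 ?_
        change s.lvl (g a.succ) ≠ 0
        rw [hg]
        exact Fin.succ_ne_zero a
      · change Fin.predAbove 0 (s.lvl (g a.succ)) = a
        rw [hg, Fin.predAbove_zero_succ]
    · refine Or.inr fun p hp ↦ ?_
      obtain ⟨j, hj, hj'⟩ := h (op ⦋0⦌) ⟨fibreVertex p (PrismSimplex.cut_eq_zero.2 hp), rfl⟩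
      have : s.eps p ≠ j := fun h ↦ hj' 0 (congr_arg ULift.up h)
      exact (by decide : ∀ a b : Fin 2, b ≠ 0 → a ≠ b → a = 0) _ j hj this
  · rintro (h | h)
    · simp only [Function.Surjective, not_forall, not_exists] at h
      obtain ⟨j, hj⟩ := h
      obtain rfl | ⟨j, rfl⟩ := Fin.eq_zero_or_eq_succ j
      · refine Or.inr ⟨?_, le_top⟩
        rintro k _ ⟨t, rfl⟩
        exact absurd (PrismSimplex.cut_eq_zero.1 (t.2 0)) (hj _)
      · refine Or.inl ⟨le_top, ?_⟩
        rintro k _ ⟨t, rfl⟩ hsurj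
        obtain ⟨a, ha⟩ := hsurj j
        have h₁ := PrismSimplex.cut_eq_one.1 (t.2 a)
        have h₂ : Fin.predAbove 0 (s.lvl ((SSet.stdSimplex.objEquiv t.1).toOrderHom a)) = j := ha
        obtain ⟨i, hi⟩ := Fin.exists_succ_eq.2 h₁
        rw [← hi, Fin.predAbove_zero_succ] at h₂
        exact hj _ (hi.symm.trans (by rw [h₂]))
    · refine Or.inr ⟨?_, le_top⟩
      rintro k _ ⟨t, rfl⟩
      refine ⟨1, by decide, fun a ha ↦ ?_⟩
      have h₁ := h _ (PrismSimplex.cut_eq_zero.1 (t.2 a))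
      have h₂ : s.eps ((SSet.stdSimplex.objEquiv t.1).toOrderHom a) = 1 :=
        congr_arg ULift.down ha
      rw [h₁] at h₂
      exact absurd h₂ (by decide)

/-- The restriction of `prismToJoin` to the horns. -/
def prismToJoinHorn (n : ℕ) : ((prismJoin.{v} (n + 1) ⊓ prismBot (n + 1) :
    (prismObj.{v} (n + 1)).Subcomplex) : SSet.{v}) ⟶ (joinHorn.{v} n : SSet.{v}) :=
  SSet.Subcomplex.lift (SSet.Subcomplex.ι _ ≫ prismToJoin n) (by
    rintro m _ ⟨s, rfl⟩
    exact (prismToJoin_mem_joinHorn_iff s.1).2 s.2.2)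

instance (n : ℕ) : IsIso (prismToJoinHorn.{v} n) :=
  isIso_of_bijective_app _ fun m ↦ by
    have hb := (isIso_iff_bijective
      (((prismJoin.{v} (n + 1)).ι ≫ prismToJoin n).app m)).1 inferInstance
    constructor
    · intro s t h
      have : (⟨s.1, s.2.1⟩ : (prismJoin.{v} (n + 1) : SSet.{v}).obj m) = ⟨t.1, t.2.1⟩ :=
        hb.1 (congr_arg Subtype.val h)
      exact Subtype.ext (Subtype.ext_iff.1 this :)
    · intro x
      obtain ⟨s, hs⟩ := hb.2 x.1
      refine ⟨⟨s.1, s.2, (prismToJoin_mem_joinHorn_iff s.1).1 ?_⟩, Subtype.ext hs⟩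
      exact (congr_arg (· ∈ (joinHorn.{v} n).obj m) hs).mpr x.2

end Join

end DescentCat

namespace DescentCat

open Limits

/-! ### The two conditions of the theorem in terms of prisms -/

section Conditions

variable {V : Type u} [Category.{v} V] {cov : MorphismProperty V} {X Y : SimplicialObject V}

theorem isCover_iff_of_iso {F G F' G' : Vᵒᵖ ⥤ Type v} {α : F ⟶ G} {α' : F' ⟶ G'} (e : F ⟶ F')
    (e' : G ⟶ G') [IsIso e] [IsIso e'] (w : e ≫ α' = α ≫ e') :
    IsCover cov α ↔ IsCover cov α' :=
  ⟨fun h ↦ h.of_iso e e' w, fun h ↦ h.of_iso (inv e) (inv e') (by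
    rw [IsIso.inv_comp_eq, ← Category.assoc, IsIso.eq_comp_inv, w])⟩

variable (f : X ⟶ Y)

theorem isCover_joinSection_succ_iff (n : ℕ) :
    IsCover cov (relRestrict (simplexToJoin.{v} n) (boundaryToJoin.{v} n)
      (SSet.boundary.{v} (n + 1)).ι (joinHorn.{v} n).ι rfl f) ↔
    IsCover cov (relRestrict (joinSection.{v} (n + 1)) (boundaryJoinSection (n + 1))
      (SSet.boundary.{v} (n + 1)).ι (SSet.Subcomplex.homOfLE inf_le_left)
      (boundaryJoinSection_w (n + 1)) f) := by
  have h₁ : joinSection.{v} (n + 1) ≫ (prismJoin.{v} (n + 1)).ι ≫ prismToJoin n =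
      simplexToJoin n := prismSection_toJoin n
  have h₂ : boundaryJoinSection.{v} (n + 1) ≫ prismToJoinHorn n = boundaryToJoin n := by
    rw [← cancel_mono (joinHorn.{v} n).ι]
    exact congr_arg ((SSet.boundary.{v} (n + 1)).ι ≫ ·) h₁
  have := isIso_relRestrict (i := simplexToJoin.{v} n) (i' := joinSection.{v} (n + 1)) (a := 𝟙 _)
    (b := (prismJoin.{v} (n + 1)).ι ≫ prismToJoin n) (h₁ ▸ Category.id_comp _) f
  have := isIso_relRestrict (i := boundaryToJoin.{v} n) (i' := boundaryJoinSection.{v} (n + 1))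
    (a := 𝟙 _) (b := prismToJoinHorn n) (h₂ ▸ Category.id_comp _) f
  refine isCover_iff_of_iso
    (relRestrict (simplexToJoin.{v} n) (joinSection.{v} (n + 1)) (𝟙 _)
      ((prismJoin.{v} (n + 1)).ι ≫ prismToJoin n) (h₁ ▸ Category.id_comp _) f)
    (relRestrict (boundaryToJoin.{v} n) (boundaryJoinSection.{v} (n + 1)) (𝟙 _)
      (prismToJoinHorn n) (h₂ ▸ Category.id_comp _) f) ?_
  ext A x
  exact relMap_ext rfl rfl

theorem subsingleton_boundary_zero_hom (Z : SSet.{v}) :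
    Subsingleton ((SSet.boundary.{v} 0 : SSet.{v}) ⟶ Z) := by
  rw [SSet.boundary_zero]
  exact ⟨fun x y ↦ NatTrans.ext (funext fun n ↦ ConcreteCategory.hom_ext _ _ fun s ↦ s.2.elim)⟩

theorem nonempty_boundary_zero_hom (Z : SSet.{v}) :
    Nonempty ((SSet.boundary.{v} 0 : SSet.{v}) ⟶ Z) := by
  rw [SSet.boundary_zero]
  exact ⟨{ app n := ↾fun s ↦ s.2.elim
           naturality n m θ := ConcreteCategory.hom_ext _ _ fun s ↦ s.2.elim }⟩

/-- Since ∂Δ^0 is empty, a relative point carries no information in `X`. -/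
theorem isIso_relProj_boundary_zero {T R : SSet.{v}} (i : (SSet.boundary.{v} 0 : SSet.{v}) ⟶ T)
    (b : R ⟶ T) [IsIso b] : IsIso (relProj i b f) := by
  refine isIso_of_bijective _ fun A ↦ ⟨?_, ?_⟩
  · intro (x : RelPoint i f A) (y : RelPoint i f A) h
    have h : b ≫ x.snd = b ≫ y.snd := h
    exact relMap_ext ((subsingleton_boundary_zero_hom _).elim _ _) ((cancel_epi b).1 h)
  · intro (y : R ⟶ (points Y).obj A)
    obtain ⟨g⟩ := nonempty_boundary_zero_hom ((points X).obj A)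
    exact ⟨(⟨g, inv b ≫ y, (subsingleton_boundary_zero_hom _).elim _ _⟩ : RelPoint i f A),
      IsIso.hom_inv_id_assoc b y⟩

theorem isCover_joinSection_zero_iff :
    IsCover cov (relProj (thickVertex.{v} 1 1) (thickVertex.{v} 1 0) f) ↔
    IsCover cov (relRestrict (joinSection.{v} 0) (boundaryJoinSection 0)
      (SSet.boundary.{v} 0).ι (SSet.Subcomplex.homOfLE inf_le_left)
      (boundaryJoinSection_w 0) f) := by
  let b := thickToPrism.{v} ≫ inv (prismJoin.{v} 0).ι
  have hb : b ≫ (prismJoin.{v} 0).ι = thickToPrism := by simp [b]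
  have h₁ : thickVertex.{v} 1 1 ≫ b = joinSection 0 := by
    rw [← cancel_mono (prismJoin.{v} 0).ι, Category.assoc, hb]
    exact thickVertex_toPrism 1
  have h₀ : thickVertex.{v} 1 0 ≫ b = joinHornSection ≫ SSet.Subcomplex.homOfLE inf_le_left := by
    rw [← cancel_mono (prismJoin.{v} 0).ι, Category.assoc, hb]
    exact thickVertex_toPrism 0
  have := isIso_relRestrict (i := joinSection.{v} 0) (i' := thickVertex.{v} 1 1) (a := 𝟙 _)
    (b := b) (h₁ ▸ Category.id_comp _) f
  have := isIso_relProj_boundary_zero f (boundaryJoinSection.{v} 0) joinHornSection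
  refine (isCover_iff_of_iso (relRestrict (joinSection.{v} 0) (thickVertex.{v} 1 1) (𝟙 _) b
    (h₁ ▸ Category.id_comp _) f) (relProj (boundaryJoinSection.{v} 0) joinHornSection f) ?_).symm
  ext A x
  exact congr_arg (· ≫ RelPoint.snd x) h₀

end Conditions

end DescentCat
theorem mainTheorem7 {V : Type u} [Category.{v} V] (cov : MorphismProperty V)
    (hV : DescentCat.IsDescentCategory cov) (k : ℕ) (hk : 0 < k)
    {X Y : SimplicialObject V} (hX : DescentCat.IsKCategory cov k X)
    (hY : DescentCat.IsKCategory cov k Y) (f : X ⟶ Y) :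
    DescentCat.IsWeakEquivalence cov k f ↔
      -- `X_0 ×_{Y_0} Map(𝚫^1, Y) ⟶ Y_0` is a cover
      (DescentCat.IsCover cov
        (DescentCat.relProj (DescentCat.thickVertex.{v} 1 1) (DescentCat.thickVertex.{v} 1 0) f)) ∧
      -- `Map(Δ^{n+1} → 𝚫^1 ⋆ Δ^n, f) ⟶ Map(∂Δ^{n+1} → 𝚫^1 ⋆ ∂Δ^n ∪ 𝚲^1_0 ⋆ Δ^n, f)` is a cover
      (∀ n : ℕ, DescentCat.IsCover cov
        (DescentCat.relRestrict (DescentCat.simplexToJoin.{v} n) (DescentCat.boundaryToJoin.{v} n)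
          (SSet.boundary.{v} (n + 1)).ι (DescentCat.joinHorn.{v} n).ι rfl f)) := by
  -- The first condition is the case n = 0, and the second the cases n > 0, of one prism condition.
  rw [DescentCat.isCover_joinSection_zero_iff]
  simp only [DescentCat.isCover_joinSection_succ_iff]
  constructor
  · intro h
    have h' := h.isCover hV hk hX hY
    exact ⟨h' 0, fun n ↦ h' (n + 1)⟩
  · rintro ⟨h₀, h₁⟩
    refine DescentCat.isWeakEquivalence_of_isCover hV hk hX hY f fun n ↦ ?_
    obtain _ | n := n
    · exact h₀
    · exact h₁ n
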